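/- Let $d\ge 2$, $k\ge 2$, $\Omega=\{x\in\mathbb R^d:|x|>1\}$, with outward unit normal $n^+(x)=-x$ on $\partial\Omega$. Let $\alpha,\beta\in\mathbb R$ with $(\alpha,\beta)\neq(0,0)$ and $\alpha\beta\ge 0$, and let $p_1,\dots,p_k>1$. For $\varepsilon>0$ consider (with $u_0:=u_k$ on the right-hand side) $$\partial_t^2u_\ell-\Delta u_\ell+\partial_tu_\ell=|u_{\ell-1}|^{p_\ell}\ \text{ in }(0,T)\times\Omega,\qquad \alpha\,\partial_{n^+}u_\ell+\beta u_\ell=0\ \text{ on }(0,T)\times\partial\Omega,$$ $$u_\ell(0)=\varepsilon u_{0,\ell},\quad \partial_tu_\ell(0)=\varepsilon u_{1,\ell}\quad\text{in }\Omega,\qquad \ell=1,\dots,k,$$ for complex-valued $u_\ell$, where $u_{1,\ell}\in L^2(\Omega)$. *Weak solutions.* $(u_1,\dots,u_k)$ is a weak solution on $[0,T)$ if, for every $\ell$, $u_\ell\in C([0,T),H)\cap C^1([0,T),L^2(\Omega))$, with $H=H^1_0(\Omega)$ if $\alpha=0$ and $H=H^1(\Omega)$ if $\alpha\ne0$; $u_{\ell-1}\in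 L^{p_\ell}_{\rm loc}([0,T)\times\overline\Omega)$; $u_\ell(0)=\varepsilon u_{0,\ell}$; and $$\int_0^T\!\!\int_\Omega|u_{\ell-1}|^{p_\ell}\Phi\,dxdt+\varepsilon\int_\Omega u_{1,\ell}\Phi(0,\cdot)\,dx=\int_0^T\!\!\int_\Omega\big(\nabla u_\ell\cdot\nabla\Phi-\partial_tu_\ell\,\partial_t\Phi+\partial_tu_\ell\,\Phi\big)dxdt+B_\ell(\Phi)$$ for all real $C^2$ functions $\Phi$ on $[0,T)\times\overline\Omega$ with compact support in $[0,T)\times\overline\Omega$ and $\alpha\,\partial_{n^+}\Phi+\beta\Phi=0$ on $[0,T)\times\partial\Omega$. Here $B_\ell(\Phi)=0$ if $\alpha=0$ and $B_\ell(\Phi)=\frac\beta\alpha\int_0^T\!\int_{\partial\Omega}u_\ell\Phi\,dS\,dt$ (with $u_\ell$ in the sense of traces) if $\alpha\neq0$. The lifespan $T_\varepsilon\in[0,\infty]$ is the supremum of all $T>0$ such that a weak solution on $[0,T)$ exists. Let $P$ be the $k\times k$ matrix with $P_{1k}=p_1$, $P_{\ell,\ell-1}=p_\ell$ ($2\le\ell\le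 k$) and all other entries $0$; let $\gamma=(P-I)^{-1}(1,\dots,1)^{\mathtt t}$ and $\gamma_{\max}=\max_\ell\gamma_\ell$. Put $$\Psi(x)=\begin{cases}1,&\beta=0,\\ \log|x|+\frac\alpha\beta,&\beta\ne0,\ d=2,\\ 1-|x|^{2-d}+\frac\alpha\beta(d-2),&\beta\neq0,\ d\ge3.\end{cases}$$ **Theorem.** Assume $\gamma_{\max}\ge d/2$ and that, for every $\ell$, $(u_{0,\ell}+u_{1,\ell})\Psi\in L^1(\Omega)$ and $\operatorname{Re}\int_\Omega(u_{0,\ell}+u_{1,\ell})\Psi\,dx>0$. Then there are constants $\varepsilon_0>0$ and $C>0$, independent of $\varepsilon$, such that for all $\varepsilon\in(0,\varepsilon_0]$ the following bounds hold. - If $\beta\neq0$ and $d=2$: - $T_\varepsilon\le C\big(\varepsilon^{-1}\log(\varepsilon^{-1})\big)^{1/(\gamma_{\max}-1)}$ when $\gamma_{\max}>1$; - $T_\varepsilon\le\exp\exp(C\varepsilon^{-1})$ when $\gamma_{\max}=1$ and $p_1=\dots=p_k$. - If $\beta\ne0$ and $d\ge3$, or $\beta=0$ and $d\ge2$: - $T_\varepsilon\le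 C\varepsilon^{-1/(\gamma_{\max}-d/2)}$ when $\gamma_{\max}>d/2$; - $T_\varepsilon\le\exp\big(C\varepsilon^{-(p_1p_2\cdots p_k-1)}\big)$ when $\gamma_{\max}=d/2$ and $p_1,\dots,p_k$ are not all equal; - $T_\varepsilon\le\exp\big(C\varepsilon^{-(p_1-1)}\big)$ when $\gamma_{\max}=d/2$ and $p_1=\dots=p_k$. In particular, weak solutions blow up in finite time in each of these cases. -/

import Mathlib

open MeasureTheory Filter Topology
open scoped ENNReal ContDiff

noncomputable section

namespace DampedWave

/-- The space `ℝ^d` with its Euclidean norm. -/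
abbrev Space (d : ℕ) : Type := EuclideanSpace ℝ (Fin d)

/-- The exterior domain `Ω = {x ∈ ℝ^d : |x| > 1}`. -/
def exterior (d : ℕ) : Set (Space d) := {x | 1 < ‖x‖}

/-- Lebesgue measure on `Ω`. -/
def exteriorMeasure (d : ℕ) : Measure (Space d) := volume.restrict (exterior d)

/-- The boundary `∂Ω`, the unit sphere. -/
abbrev Boundary (d : ℕ) : Type := Metric.sphere (0 : Space d) 1

/-- Surface measure on `∂Ω`. -/
def surfaceMeasure (d : ℕ) : Measure (Boundary d) := (volume : Measure (Space d)).toSphere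

/-! ### Exponents -/

/-- The cyclic predecessor on the `k` indices: `ℓ ↦ ℓ - 1`, the first index being sent to the
last one. -/
def cycPred {k : ℕ} (l : Fin k) : Fin k := ⟨(l.val + (k - 1)) % k, Nat.mod_lt _ l.pos⟩

/-- The matrix `P`: row `ℓ` has its only nonzero entry `p_ℓ` in column `ℓ - 1` (cyclically). -/
def matrixP {k : ℕ} (p : Fin k → ℝ) : Matrix (Fin k) (Fin k) ℝ :=
  fun i j => if j = cycPred i then p i else 0

/-- The vector `γ = (P - I)⁻¹ (1, …, 1)`. -/
def gammaVec {k : ℕ} (p : Fin k → ℝ) : Fin k → ℝ :=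
  Matrix.mulVec (matrixP p - 1)⁻¹ (fun _ => 1)

/-- `γ_max`, the largest entry of `γ`. -/
def gammaMax {k : ℕ} (p : Fin k → ℝ) : ℝ := ⨆ l, gammaVec p l

/-! ### The harmonic function adapted to the boundary condition -/

/-- The function `Ψ`. -/
def Psi (d : ℕ) (α β : ℝ) (x : Space d) : ℝ :=
  if β = 0 then 1
  else if d = 2 then Real.log ‖x‖ + α / β
  else 1 - ‖x‖ ^ (2 - (d : ℝ)) + α / β * ((d : ℝ) - 2)

/-! ### Sobolev spaces on `Ω` -/

/-- The classical gradient of a complex-valued function. -/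
def grad {d : ℕ} (φ : Space d → ℂ) (x : Space d) : EuclideanSpace ℂ (Fin d) :=
  WithLp.toLp 2 fun i => fderiv ℝ φ x (EuclideanSpace.single i 1)

/-- `G` is the distributional gradient of `f` on `Ω`. -/
def HasWeakGradient {d : ℕ} (f : Space d → ℂ) (G : Space d → EuclideanSpace ℂ (Fin d)) : Prop :=
  ∀ φ : Space d → ℝ, ContDiff ℝ ∞ φ → HasCompactSupport φ → tsupport φ ⊆ exterior d →
    ∀ i : Fin d,
      ∫ x in exterior d, f x * ((fderiv ℝ φ x (EuclideanSpace.single i 1) : ℝ) : ℂ)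
        = - ∫ x in exterior d, G x i * ((φ x : ℝ) : ℂ)

/-- `f ∈ H¹(Ω)` with gradient `G`. -/
structure MemH1 {d : ℕ} (f : Space d → ℂ) (G : Space d → EuclideanSpace ℂ (Fin d)) : Prop where
  memLp : MemLp f 2 (exteriorMeasure d)
  memLp_gradient : MemLp G 2 (exteriorMeasure d)
  hasWeakGradient : HasWeakGradient f G

/-- The smooth functions `φ n` converge in `H¹(Ω)` to `f`, whose gradient is `G`. -/
def TendstoInH1 {d : ℕ} (φ : ℕ → Space d → ℂ) (f : Space d → ℂ)
    (G : Space d → EuclideanSpace ℂ (Fin d)) : Prop :=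
  Tendsto (fun n => eLpNorm (fun x => φ n x - f x) 2 (exteriorMeasure d)) atTop (𝓝 0) ∧
  Tendsto (fun n => eLpNorm (fun x => grad (φ n) x - G x) 2 (exteriorMeasure d)) atTop (𝓝 0)

/-- `f ∈ H¹₀(Ω)` with gradient `G`: the pair is a limit in `H¹(Ω)` of smooth functions with
compact support in `Ω`. -/
def MemH10 {d : ℕ} (f : Space d → ℂ) (G : Space d → EuclideanSpace ℂ (Fin d)) : Prop :=
  MemH1 f G ∧
  ∃ φ : ℕ → Space d → ℂ,
    (∀ n, ContDiff ℝ ∞ (φ n) ∧ HasCompactSupport (φ n) ∧ tsupport (φ n) ⊆ exterior d) ∧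
    TendstoInH1 φ f G

/-- `g ∈ L²(∂Ω)` is the trace on `∂Ω` of `f ∈ H¹(Ω)` (with gradient `G`): there are smooth functions,
compactly supported in `ℝ^d`, whose restrictions converge to `f` in `H¹(Ω)` and to `g` in
`L²(∂Ω)`. -/
def IsTrace {d : ℕ} (f : Space d → ℂ) (G : Space d → EuclideanSpace ℂ (Fin d))
    (g : Boundary d → ℂ) : Prop :=
  MemLp g 2 (surfaceMeasure d) ∧
  ∃ φ : ℕ → Space d → ℂ,
    (∀ n, ContDiff ℝ ∞ (φ n) ∧ HasCompactSupport (φ n)) ∧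
    TendstoInH1 φ f G ∧
    Tendsto (fun n => eLpNorm (fun y : Boundary d => φ n y - g y) 2 (surfaceMeasure d))
      atTop (𝓝 0)

/-! ### Curves in `L²(Ω)` -/

/-- `f ∈ C([0,T), L²(Ω; F))`. -/
def ContinuousInL2 {d : ℕ} {F : Type*} [NormedAddCommGroup F] (T : ℝ) (f : ℝ → Space d → F) :
    Prop :=
  (∀ t ∈ Set.Ico 0 T, MemLp (f t) 2 (exteriorMeasure d)) ∧
  ∀ t ∈ Set.Ico 0 T,
    Tendsto (fun s => eLpNorm (fun x => f s x - f t x) 2 (exteriorMeasure d))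
      (𝓝[Set.Ico 0 T] t) (𝓝 0)

/-- `v` is the derivative of the curve `f` in `L²(Ω)` on `[0,T)` (one-sided at time `0`). -/
def HasTimeDerivInL2 {d : ℕ} (T : ℝ) (f v : ℝ → Space d → ℂ) : Prop :=
  ∀ t ∈ Set.Ico 0 T,
    Tendsto
      (fun s => eLpNorm (fun x => (s - t)⁻¹ • (f s x - f t x) - v t x) 2 (exteriorMeasure d))
      (𝓝[Set.Ico 0 T \ {t}] t) (𝓝 0)

/-- Joint measurability on `(0,T) × Ω`. -/
def JointlyMeasurable {d : ℕ} {F : Type*} [NormedAddCommGroup F] (T : ℝ)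
    (f : ℝ → Space d → F) : Prop :=
  AEStronglyMeasurable (fun z : ℝ × Space d => f z.1 z.2)
    (volume.restrict (Set.Ioo 0 T ×ˢ exterior d))

/-! ### Weak solutions -/

/-- Test functions: (restrictions to `[0,T) × closure Ω` of) real `C²` functions of `(t,x)`, with
compact support inside `{t < T}`, with `α ∂Φ/∂n⁺ + β Φ = 0` on `[0,T) × ∂Ω`.
The outward unit normal of `Ω` at `x ∈ ∂Ω` is `-x`. -/
structure IsTestFunction (d : ℕ) (α β T : ℝ) (Φ : ℝ × Space d → ℝ) : Prop where
  contDiff : ContDiff ℝ 2 Φ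
  hasCompactSupport : HasCompactSupport Φ
  tsupport_subset : tsupport Φ ⊆ Set.Iio T ×ˢ Set.univ
  boundary_condition : ∀ t ∈ Set.Ico 0 T, ∀ x : Space d, ‖x‖ = 1 →
    α * fderiv ℝ Φ (t, x) (0, -x) + β * Φ (t, x) = 0

/-- The bilinear expression
`∫₀ᵀ ∫_Ω (∇u · ∇Φ - ∂ₜu ∂ₜΦ + ∂ₜu Φ) dx dt`, where `v = ∂ₜu` and `G = ∇u`. -/
def interiorForm {d : ℕ} (T : ℝ) (v : ℝ → Space d → ℂ)
    (G : ℝ → Space d → EuclideanSpace ℂ (Fin d)) (Φ : ℝ × Space d → ℝ) : ℂ :=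
  ∫ z in Set.Ioo 0 T ×ˢ exterior d,
    ((∑ i : Fin d, G z.1 z.2 i * ((fderiv ℝ Φ z (0, EuclideanSpace.single i 1) : ℝ) : ℂ))
      - v z.1 z.2 * ((fderiv ℝ Φ z (1, 0) : ℝ) : ℂ)
      + v z.1 z.2 * ((Φ z : ℝ) : ℂ))

/-- The boundary contribution of `-Δu` under `α ∂u/∂n⁺ + β u = 0`: nothing in the Dirichlet case
`α = 0`, where the test functions vanish on `∂Ω`, and `(β/α) ∫₀ᵀ ∫_{∂Ω} u Φ dS dt` otherwise;
`g t` is the trace of `u t`. It vanishes in the Neumann case `β = 0`. -/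
def boundaryForm {d : ℕ} (α β T : ℝ) (g : ℝ → Boundary d → ℂ) (Φ : ℝ × Space d → ℝ) : ℂ :=
  if α = 0 then 0
  else ((β / α : ℝ) : ℂ) *
    ∫ t in Set.Ioo 0 T, ∫ y : Boundary d, g t y * ((Φ (t, y) : ℝ) : ℂ) ∂(surfaceMeasure d)

/-- `u = (u_1, …, u_k)` is a weak solution on `[0,T)`, with initial data `(ε u₀, ε u₁)`, of
`∂ₜ²u_ℓ - Δu_ℓ + ∂ₜu_ℓ = |u_{ℓ-1}|^{p_ℓ}` in `Ω` (indices cyclic), with the boundary condition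
`α ∂u_ℓ/∂n⁺ + β u_ℓ = 0` on `∂Ω`. The functions `v ℓ` and `G ℓ` are `∂ₜu_ℓ` and `∇u_ℓ`. -/
def IsWeakSolution {d k : ℕ} (α β : ℝ) (p : Fin k → ℝ) (ε : ℝ)
    (u₀ u₁ : Fin k → Space d → ℂ) (T : ℝ) (u : Fin k → ℝ → Space d → ℂ) : Prop :=
  ∃ (v : Fin k → ℝ → Space d → ℂ) (G : Fin k → ℝ → Space d → EuclideanSpace ℂ (Fin d))
    (g : Fin k → ℝ → Boundary d → ℂ),
    ∀ l : Fin k,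
      -- jointly measurable representatives
      (JointlyMeasurable T (u l) ∧ JointlyMeasurable T (v l) ∧ JointlyMeasurable T (G l)) ∧
      -- `u_l ∈ C([0,T), H¹(Ω)) ∩ C¹([0,T), L²(Ω))`
      (ContinuousInL2 T (u l) ∧ ContinuousInL2 T (G l) ∧ ContinuousInL2 T (v l) ∧
        HasTimeDerivInL2 T (u l) (v l) ∧
        ∀ t ∈ Set.Ico 0 T, MemH1 (u l t) (G l t)) ∧
      -- values in `H¹₀(Ω)` in the Dirichlet case, traces otherwise
      (∀ t ∈ Set.Ico 0 T,
        (α = 0 → MemH10 (u l t) (G l t)) ∧ (α ≠ 0 → IsTrace (u l t) (G l t) (g l t))) ∧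
      -- `u_{l-1} ∈ L^{p_l}_loc([0,T) × closure Ω)`
      LocallyIntegrableOn
        (fun z : ℝ × Space d => ‖u (cycPred l) z.1 z.2‖ ^ (p l))
        (Set.Ico 0 T ×ˢ closure (exterior d)) volume ∧
      -- initial displacement
      u l 0 =ᵐ[exteriorMeasure d] (fun x => (ε : ℂ) * u₀ l x) ∧
      -- weak form of the equation, including the initial velocity
      ∀ Φ : ℝ × Space d → ℝ, IsTestFunction d α β T Φ →
        (∫ z in Set.Ioo 0 T ×ˢ exterior d,
            ((‖u (cycPred l) z.1 z.2‖ ^ (p l) * Φ z : ℝ) : ℂ))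
          + (ε : ℂ) * ∫ x in exterior d, u₁ l x * ((Φ (0, x) : ℝ) : ℂ)
        = interiorForm T (v l) (G l) Φ + boundaryForm α β T (g l) Φ

/-- The lifespan of weak solutions: the supremum (in `[0,∞]`) of the times `T > 0` such that a
weak solution exists on `[0,T)`. -/
def lifespan {d k : ℕ} (α β : ℝ) (p : Fin k → ℝ) (ε : ℝ) (u₀ u₁ : Fin k → Space d → ℂ) : ℝ≥0∞ :=
  sSup {τ : ℝ≥0∞ | ∃ T : ℝ, 0 < T ∧ τ = ENNReal.ofReal T ∧
    ∃ u : Fin k → ℝ → Space d → ℂ, IsWeakSolution α β p ε u₀ u₁ T u}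

end DampedWave

end

noncomputable section

namespace DampedWave

/-! ### Cutoff functions -/

/-! The proof is a test function argument. Let `ψ` be the radial harmonic function satisfying the
boundary condition, and test the equations with `ζ(t/ρ²) ψ(|x|) ζ(|x|/ρ)`, where `ρ² < T`. Since `ψ`
is harmonic and satisfies the boundary condition, moving all derivatives onto the test function
leaves no term on `∂Ω` and no term in the region where the cutoffs equal `1`. What remains lives in
the annulus between the parabolic cylinders at scales `ρ/2` and `ρ`, with a kernel of size `ρ⁻²`;
the data contribute at least `c ε` for large `ρ`. This is `IsWeakSolution.integral_adjointTest`
together with `abs_adjointTest_le`.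

Write `J_ℓ` for the integral of `|u_{ℓ-1}|^{p_ℓ}` against the test function, `A_ℓ` for its part in
the annulus, and let `L(ρ)` dominate `ψ` up to a constant on `1 ≤ r ≤ ρ` (`L = log` if `β ≠ 0` and
`d = 2`, otherwise `L = 1`). Hölder's inequality gives `J_{ℓ-1} + cε ≤ C ρ⁻² A_ℓ^{1/p_ℓ} (ρ^{d+2}
L)^{1-1/p_ℓ}` (`totalMass_add_le`, `exists_massEstimate`). The relation `p_ℓ γ_{ℓ-1} - γ_ℓ = 1` says
exactly that multiplication by `ρ^{2γ_ℓ-d}/L` makes this cyclic system homogeneous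
(`scaling_identity`). As `A_ℓ ≤ J_ℓ` and `1/p_ℓ < 1`, a maximum argument bounds everything
(`exists_cyclic_bound`), in particular `ε ρ^{2γ_max-d} ≤ K L(ρ)`. Letting `ρ²` increase to `T`
settles the case `γ_max > d/2`.

In the critical case this power is `1`, and one uses that `A` is more than a part of `J`: it is at
most the increment `S(ρ) - S(ρ/2)` of the mass in cylinders. The estimates become a discrete form of
`s' ≥ (s + cε)^q / (C r L^{q-1})` along dyadic radii (`DyadicGrowth`), and summing the drops of `(s
+ cε)^{1-q}` bounds the number of dyadic steps (`DyadicGrowth.sum_le`). If the exponents differ,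
only a component with `γ_ℓ = γ_max` is known to be critical, and going once around the cycle costs
`q = ∏ p_ℓ`; if they agree, all components are critical, their masses can be added, and `q = p_1`.
For `L = log` one has `q = 2`, and the sum of `1/log(ρ₀ 2ⁿ)` grows only like `log N`, whence the
double exponential. -/

/-- `ζ` is a `C²` cutoff function on `ℝ`, equal to `1` near `[-1/2, 1/2]` and to `0` outside
`(-1, 1)`, whose first two derivatives are controlled by the power `ζ ^ σ`. -/
structure IsCutoff (ζ ζ' ζ'' : ℝ → ℝ) (σ K : ℝ) : Prop where
  contDiff : ContDiff ℝ 2 ζ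
  hasDerivAt : ∀ s, HasDerivAt ζ (ζ' s) s
  hasDerivAt_deriv : ∀ s, HasDerivAt ζ' (ζ'' s) s
  continuous_deriv2 : Continuous ζ''
  nonneg : ∀ s, 0 ≤ ζ s
  le_one : ∀ s, ζ s ≤ 1
  eq_one : ∀ s, |s| ≤ 3 / 4 → ζ s = 1
  eq_zero : ∀ s, 1 ≤ |s| → ζ s = 0
  deriv_eq_zero : ∀ s, |s| < 3 / 4 → ζ' s = 0
  deriv2_eq_zero : ∀ s, |s| < 3 / 4 → ζ'' s = 0
  abs_deriv_le : ∀ s, |ζ' s| ≤ K * ζ s ^ σ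
  abs_deriv2_le : ∀ s, |ζ'' s| ≤ K * ζ s ^ σ
  bound_nonneg : 0 ≤ K
  exponent_pos : 0 < σ

/-- A high power of a smooth bump: two derivatives of `f ^ q` lose at most a factor `f ^ 2`, and `f
^ (q - 2) ≤ (f ^ q) ^ σ` once `q - 2 ≥ q σ`, because `0 ≤ f ≤ 1`. -/
theorem exists_isCutoff {σ : ℝ} (hσ0 : 0 < σ) (hσ : σ < 1) :
    ∃ ζ ζ' ζ'' : ℝ → ℝ, ∃ K : ℝ, IsCutoff ζ ζ' ζ'' σ K := by
  let f : ContDiffBump (0 : ℝ) := ⟨3 / 4, 1, by norm_num, by norm_num⟩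
  -- `q ≥ 2 / (1 - σ)` is the condition `q σ ≤ q - 2`.
  obtain ⟨q, hq⟩ := exists_nat_ge (2 / (1 - σ))
  have h1σ : 0 < 1 - σ := by linarith
  have hqσ : (q : ℝ) * σ ≤ q - 2 := by
    rw [div_le_iff₀ h1σ] at hq; linarith
  have hq2 : 2 ≤ q := by
    have : (2 : ℝ) ≤ q := by nlinarith [mul_nonneg (Nat.cast_nonneg (α := ℝ) q) hσ0.le]
    exact_mod_cast this
  obtain ⟨n, rfl⟩ := Nat.exists_eq_add_of_le' hq2
  have fsm2 : ContDiff ℝ 2 f := f.contDiff (n := 2)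
  have fd : ∀ s, HasDerivAt f (deriv f s) s := fun s =>
    (fsm2.differentiable (by norm_num) s).hasDerivAt
  have fsm1 : ContDiff ℝ 1 (deriv f) := by
    have : ContDiff ℝ (1 + 1) f := by simpa [one_add_one_eq_two] using fsm2
    exact (contDiff_succ_iff_deriv.1 this).2.2
  have fdd : ∀ s, HasDerivAt (deriv f) (deriv (deriv f) s) s := fun s =>
    (fsm1.differentiable (by norm_num) s).hasDerivAt
  have fc2 : Continuous (deriv (deriv f)) := fsm1.continuous_deriv (by norm_num)
  obtain ⟨M1, hM1⟩ := f.hasCompactSupport.deriv.exists_bound_of_continuous fsm1.continuous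
  obtain ⟨M2, hM2⟩ := f.hasCompactSupport.deriv.deriv.exists_bound_of_continuous fc2
  have hM10 : 0 ≤ M1 := (norm_nonneg _).trans (hM1 0)
  have hM20 : 0 ≤ M2 := (norm_nonneg _).trans (hM2 0)
  have f0 : ∀ s, 0 ≤ f s := fun s => f.nonneg
  have f1 : ∀ s, f s ≤ 1 := fun s => f.le_one
  have hone : ∀ s : ℝ, |s| ≤ 3 / 4 → f s = 1 := fun s hs =>
    f.one_of_mem_closedBall (by simpa [f] using hs)
  have hd1 : ∀ s : ℝ, |s| < 3 / 4 → f =ᶠ[𝓝 s] 1 := fun s hs =>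
    f.eventuallyEq_one_of_mem_ball (by simpa [f] using hs)
  have hd2 : ∀ s : ℝ, |s| < 3 / 4 → deriv f =ᶠ[𝓝 s] fun _ => 0 := fun s hs => by
    filter_upwards [(hd1 s hs).eventuallyEq_nhds] with y hy
    rw [hy.deriv_eq]; simp
  have pw : ∀ s, f s ^ n ≤ (f s ^ (n + 2)) ^ σ := fun s => by
    rcases (f0 s).eq_or_lt with h | h
    -- Where `f` vanishes, `n = 0` would make the left side `1`; it is excluded because then `2 σ ≤
    -- 0`.
    · rcases Nat.eq_zero_or_pos n with rfl | hn
      · norm_num at hqσ; nlinarith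
      · rw [← h, zero_pow hn.ne']; positivity
    · rw [← Real.rpow_natCast, ← Real.rpow_natCast, ← Real.rpow_mul h.le]
      refine Real.rpow_le_rpow_of_exponent_ge h (f1 s) ?_
      push_cast at hqσ ⊢; linarith
  have pw1 : ∀ s, f s ^ (n + 1) ≤ (f s ^ (n + 2)) ^ σ := fun s =>
    (pow_le_pow_of_le_one (f0 s) (f1 s) (Nat.le_succ n)).trans (pw s)
  refine ⟨fun s => f s ^ (n + 2), fun s => ((n + 2 : ℕ) : ℝ) * f s ^ (n + 1) * deriv f s,
    fun s => ((n + 2 : ℕ) : ℝ) * (((n + 1 : ℕ) : ℝ) * f s ^ n * deriv f s) * deriv f s +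
      ((n + 2 : ℕ) : ℝ) * f s ^ (n + 1) * deriv (deriv f) s,
    ((n + 2 : ℕ) : ℝ) * M1 + (((n + 2 : ℕ) : ℝ) * (((n + 1 : ℕ) : ℝ) * M1) * M1 +
      ((n + 2 : ℕ) : ℝ) * M2), ?_⟩
  refine
    { contDiff := fsm2.pow _
      hasDerivAt := fun s => ((fd s).pow (n + 2)).congr_deriv (by simp)
      hasDerivAt_deriv := fun s => by
        exact ((((fd s).pow (n + 1)).const_mul ((n + 2 : ℕ) : ℝ)).mul (fdd s)).congr_deriv (by simp)
      continuous_deriv2 := by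
        have := fsm2.continuous
        have := fsm1.continuous
        fun_prop
      nonneg := fun s => pow_nonneg (f0 s) _
      le_one := fun s => pow_le_one₀ (f0 s) (f1 s)
      eq_one := fun s hs => by simp [hone s hs]
      eq_zero := fun s hs => by
        have : f s = 0 := f.zero_of_le_dist (by simpa [f] using hs)
        simp [this]
      deriv_eq_zero := fun s hs => by simp [(hd2 s hs).self_of_nhds]
      deriv2_eq_zero := fun s hs => by
        have : deriv (deriv f) s = 0 := by rw [(hd2 s hs).deriv_eq]; simp
        simp [(hd2 s hs).self_of_nhds, this]
      abs_deriv_le := fun s => ?_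
      abs_deriv2_le := fun s => ?_
      bound_nonneg := by positivity
      exponent_pos := hσ0 }
  · have h1 : |((n + 2 : ℕ) : ℝ) * f s ^ (n + 1) * deriv f s|
        ≤ ((n + 2 : ℕ) : ℝ) * (f s ^ (n + 2)) ^ σ * M1 := by
      rw [abs_mul, abs_of_nonneg (mul_nonneg (Nat.cast_nonneg _) (pow_nonneg (f0 s) _))]
      exact mul_le_mul (mul_le_mul_of_nonneg_left (pw1 s) (Nat.cast_nonneg _)) (hM1 s)
        (abs_nonneg _) (by have := f0 s; positivity)
    have : 0 ≤ (((n + 2 : ℕ) : ℝ) * (((n + 1 : ℕ) : ℝ) * M1) * M1 + ((n + 2 : ℕ) : ℝ) * M2)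
        * (f s ^ (n + 2)) ^ σ := by have := f0 s; positivity
    linarith
  · have g0 := f0 s
    have h1 : |((n + 2 : ℕ) : ℝ) * (((n + 1 : ℕ) : ℝ) * f s ^ n * deriv f s) * deriv f s|
        ≤ ((n + 2 : ℕ) : ℝ) * (((n + 1 : ℕ) : ℝ) * (f s ^ (n + 2)) ^ σ * M1) * M1 := by
      rw [abs_mul, abs_mul, abs_mul, abs_mul, Nat.abs_cast, Nat.abs_cast,
        abs_of_nonneg (pow_nonneg g0 _)]
      gcongr
      exacts [pw s, hM1 s, hM1 s]
    have h2 : |((n + 2 : ℕ) : ℝ) * f s ^ (n + 1) * deriv (deriv f) s|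
        ≤ ((n + 2 : ℕ) : ℝ) * (f s ^ (n + 2)) ^ σ * M2 := by
      rw [abs_mul, abs_mul, Nat.abs_cast, abs_of_nonneg (pow_nonneg g0 _)]
      gcongr
      exacts [pw1 s, hM2 s]
    have h3 := abs_add_le (((n + 2 : ℕ) : ℝ) * (((n + 1 : ℕ) : ℝ) * f s ^ n * deriv f s) * deriv f s)
      (((n + 2 : ℕ) : ℝ) * f s ^ (n + 1) * deriv (deriv f) s)
    have : 0 ≤ ((n + 2 : ℕ) : ℝ) * M1 * (f s ^ (n + 2)) ^ σ := by positivity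
    linarith

namespace IsCutoff

variable {ζ ζ' ζ'' : ℝ → ℝ} {σ K : ℝ}

theorem continuous (h : IsCutoff ζ ζ' ζ'' σ K) : Continuous ζ := h.contDiff.continuous

theorem continuous_deriv (h : IsCutoff ζ ζ' ζ'' σ K) : Continuous ζ' :=
  continuous_iff_continuousAt.2 fun s => (h.hasDerivAt_deriv s).continuousAt

theorem deriv_eq_zero' (h : IsCutoff ζ ζ' ζ'' σ K) {s : ℝ} (hs : 1 ≤ |s|) : ζ' s = 0 := by
  have := h.abs_deriv_le s
  rw [h.eq_zero s hs, Real.zero_rpow h.exponent_pos.ne', mul_zero] at this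
  exact abs_nonpos_iff.1 this

theorem deriv2_eq_zero' (h : IsCutoff ζ ζ' ζ'' σ K) {s : ℝ} (hs : 1 ≤ |s|) : ζ'' s = 0 := by
  have := h.abs_deriv2_le s
  rw [h.eq_zero s hs, Real.zero_rpow h.exponent_pos.ne', mul_zero] at this
  exact abs_nonpos_iff.1 this

end IsCutoff

/-! ### The radial harmonic weight -/

/-- The function `Ψ` as a function of the radius. -/
def psiRad (d : ℕ) (α β : ℝ) (r : ℝ) : ℝ :=
  if β = 0 then 1
  else if d = 2 then Real.log r + α / β
  else 1 - r ^ (2 - (d : ℝ)) + α / β * ((d : ℝ) - 2)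

/-- `ψ` is a nonnegative radial harmonic function on the exterior of the unit ball of `ℝ^d`,
satisfying the boundary condition `-α ψ' + β ψ = 0` on the unit sphere. -/
structure IsWeight (d : ℕ) (α β : ℝ) (ψ : ℝ → ℝ) (κ M : ℝ) : Prop where
  contDiffOn : ContDiffOn ℝ 2 ψ (Set.Ioi 0)
  hasDerivAt : ∀ r, 0 < r → HasDerivAt ψ (κ * (r ^ (d - 1))⁻¹) r
  nonneg : ∀ r, 1 ≤ r → 0 ≤ ψ r
  boundary : α * κ = β * ψ 1
  slope_nonneg : 0 ≤ κ
  bound_nonneg : 0 ≤ M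
  slope_le : ∀ r, 2 ≤ r → κ * (r ^ (d - 1))⁻¹ ≤ M * ψ r / r

/-- The slope of a radial harmonic function is a multiple of `r^{1-d}`. The sign of `α β` makes `α /
β ≥ 0`, hence `ψ ≥ 0` for `r ≥ 1`. The bound `ψ' ≤ M ψ / r` is needed only for `r ≥ 2`, away from a
possible zero of `ψ` on the sphere. -/
theorem isWeight_psiRad {d : ℕ} (hd : 2 ≤ d) {α β : ℝ} (hαβ : 0 ≤ α * β) :
    ∃ κ M, IsWeight d α β (psiRad d α β) κ M := by
  by_cases hβ : β = 0
  · refine ⟨0, 0, ?_⟩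
    have : psiRad d α β = fun _ => 1 := by ext; simp [psiRad, hβ]
    rw [this]
    refine ⟨contDiffOn_const, fun r hr => by simpa using hasDerivAt_const r (1 : ℝ),
      by norm_num, by simp [hβ], le_rfl, le_rfl, by simp⟩
  have hab : 0 ≤ α / β := by
    rcases lt_or_gt_of_ne hβ with h | h
    · exact div_nonneg_of_nonpos (by nlinarith) h.le
    · exact div_nonneg (by nlinarith) h.le
  by_cases h2 : d = 2
  · subst h2
    have he : psiRad 2 α β = fun r => Real.log r + α / β := by ext; simp [psiRad, hβ]
    rw [he]
    have hl2 : 0 < Real.log 2 := Real.log_pos one_lt_two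
    -- `r ψ' = 1` and `ψ ≥ log 2` for `r ≥ 2`.
    refine ⟨1, (Real.log 2)⁻¹, ?_, fun r hr => ?_, fun r hr => ?_, ?_, zero_le_one,
      by positivity, fun r hr => ?_⟩
    · exact (Real.contDiffOn_log.mono fun r hr => (ne_of_gt hr)).add contDiffOn_const
    · simpa using (Real.hasDerivAt_log hr.ne').add_const (α / β)
    · have := Real.log_nonneg hr; positivity
    · simp; field_simp
    · have hr0 : 0 < r := by linarith
      have hlog : Real.log 2 ≤ Real.log r + α / β :=
        (Real.log_le_log two_pos hr).trans (by linarith)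
      simp only [Nat.add_one_sub_one, pow_one, one_mul]
      rw [inv_eq_one_div, div_le_div_iff_of_pos_right hr0, inv_mul_eq_div, le_div_iff₀ hl2]
      linarith
  · have h3 : 3 ≤ d := by omega
    have hd3 : (3 : ℝ) ≤ d := by exact_mod_cast h3
    have he : psiRad d α β = fun r => 1 - r ^ (2 - (d : ℝ)) + α / β * ((d : ℝ) - 2) := by
      ext; simp [psiRad, hβ, h2]
    rw [he]
    have hab2 : 0 ≤ α / β * ((d : ℝ) - 2) := mul_nonneg hab (by linarith)
    have hpow : ∀ r : ℝ, 0 < r → r ^ (1 - (d : ℝ)) = (r ^ (d - 1))⁻¹ := fun r hr => by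
      rw [← Real.rpow_natCast, ← Real.rpow_neg hr.le]
      congr 1; rw [Nat.cast_sub (by omega)]; simp
    -- `r ψ' = (d - 2) r^{2-d}`, and `r^{2-d} ≤ 1/2` for `r ≥ 2` gives `r^{2-d} ≤ 1 - r^{2-d} ≤ ψ`.
    refine ⟨(d : ℝ) - 2, (d : ℝ) - 2, ?_, fun r hr => ?_, fun r hr => ?_, ?_, by linarith,
      by linarith, fun r hr => ?_⟩
    · refine (contDiffOn_const.sub fun r hr => ?_).add contDiffOn_const
      exact (Real.contDiffAt_rpow_const_of_ne (ne_of_gt hr)).contDiffWithinAt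
    · have := ((Real.hasDerivAt_rpow_const (p := 2 - (d : ℝ)) (Or.inl hr.ne')).const_sub 1).add_const
        (α / β * ((d : ℝ) - 2))
      refine this.congr_deriv ?_
      rw [← hpow r hr]
      have : (2 - (d : ℝ) - 1) = 1 - d := by ring
      rw [this]; ring
    · have : r ^ (2 - (d : ℝ)) ≤ 1 := Real.rpow_le_one_of_one_le_of_nonpos hr (by linarith)
      linarith
    · simp; field_simp
    · have hr0 : 0 < r := by linarith
      have h12 : r ^ (2 - (d : ℝ)) ≤ 1 / 2 := by
        calc r ^ (2 - (d : ℝ)) ≤ 2 ^ (2 - (d : ℝ)) :=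
              Real.rpow_le_rpow_of_nonpos two_pos hr (by linarith)
          _ ≤ 2 ^ (-1 : ℝ) := Real.rpow_le_rpow_of_exponent_le one_le_two (by linarith)
          _ = 1 / 2 := by rw [Real.rpow_neg_one]; norm_num
      have hsplit : r ^ (1 - (d : ℝ)) = r ^ (2 - (d : ℝ)) / r := by
        rw [← Real.rpow_sub_one hr0.ne']; congr 1; ring
      rw [← hpow r hr0, hsplit, ← mul_div_assoc, div_le_div_iff_of_pos_right hr0]
      exact mul_le_mul_of_nonneg_left (by linarith) (by linarith)

/-! ### Radial profiles of the test functions -/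

/-- A function vanishing near the origin and equal to `1` on `[1/2, ∞)`. -/
def originCutoff (r : ℝ) : ℝ := Real.smoothTransition (4 * r - 1)

theorem originCutoff_eq_one {r : ℝ} (hr : 1 / 2 ≤ r) : originCutoff r = 1 :=
  Real.smoothTransition.one_of_one_le (by linarith)

theorem originCutoff_eq_zero {r : ℝ} (hr : r ≤ 1 / 4) : originCutoff r = 0 :=
  Real.smoothTransition.zero_of_nonpos (by linarith)

/-- The radial profile of the spatial part of the test functions. -/
def profile (ψ ζ : ℝ → ℝ) (ρ r : ℝ) : ℝ := originCutoff r * (ψ r * ζ (r / ρ))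

/-- The radial derivative of `profile`, away from the origin. -/
def profileDeriv (d : ℕ) (κ : ℝ) (ψ ζ ζ' : ℝ → ℝ) (ρ r : ℝ) : ℝ :=
  κ * (r ^ (d - 1))⁻¹ * ζ (r / ρ) + ψ r * (ζ' (r / ρ) / ρ)

/-- The Laplacian of the spatial part of the test functions, away from the origin. -/
def profileLap (d : ℕ) (κ : ℝ) (ψ ζ' ζ'' : ℝ → ℝ) (ρ r : ℝ) : ℝ :=
  2 * (κ * (r ^ (d - 1))⁻¹) * (ζ' (r / ρ) / ρ)
    + ψ r * (ζ'' (r / ρ) / ρ ^ 2 + ((d : ℝ) - 1) / r * (ζ' (r / ρ) / ρ))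

section Profile

variable {d : ℕ} {α β κ M σ K : ℝ} {ψ ζ ζ' ζ'' : ℝ → ℝ}

theorem profile_eq {ρ r : ℝ} (hr : 1 / 2 ≤ r) : profile ψ ζ ρ r = ψ r * ζ (r / ρ) := by
  simp [profile, originCutoff_eq_one hr]

theorem profile_eq_zero (hζ : IsCutoff ζ ζ' ζ'' σ K) {ρ r : ℝ} (hρ : 0 < ρ) (hr : ρ ≤ r) :
    profile ψ ζ ρ r = 0 := by
  have : ζ (r / ρ) = 0 := hζ.eq_zero _ (((one_le_div hρ).2 hr).trans (le_abs_self _))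
  simp [profile, this]

theorem contDiff_profile (hψ : IsWeight d α β ψ κ M) (hζ : IsCutoff ζ ζ' ζ'' σ K) (ρ : ℝ) :
    ContDiff ℝ 2 (profile ψ ζ ρ) := by
  rw [contDiff_iff_contDiffAt]
  intro r
  rcases lt_or_ge r (1 / 4) with hr | hr
  · refine (contDiffAt_const (c := (0 : ℝ))).congr_of_eventuallyEq ?_
    filter_upwards [Iio_mem_nhds hr] with s hs
    simp [profile, originCutoff_eq_zero (le_of_lt hs)]
  · have h1 : ContDiffAt ℝ 2 originCutoff r := by
      have : ContDiff ℝ 2 Real.smoothTransition :=  Real.smoothTransition.contDiff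
      exact (this.comp ((contDiff_const.mul contDiff_id).sub contDiff_const)).contDiffAt
    have h2 : ContDiffAt ℝ 2 ψ r :=
      hψ.contDiffOn.contDiffAt (Ioi_mem_nhds (by linarith))
    have h3 : ContDiffAt ℝ 2 (fun r => ζ (r / ρ)) r :=
      (hζ.contDiff.comp (contDiff_id.div_const ρ)).contDiffAt
    exact h1.mul (h2.mul h3)

theorem hasDerivAt_comp_div {f f' : ℝ → ℝ} (hf : ∀ s, HasDerivAt f (f' s) s) (ρ r : ℝ) :
    HasDerivAt (fun r => f (r / ρ)) (f' (r / ρ) / ρ) r := by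
  exact ((hf (r / ρ)).comp r ((hasDerivAt_id r).div_const ρ)).congr_deriv (by simp [div_eq_mul_inv])

theorem hasDerivAt_profile (hψ : IsWeight d α β ψ κ M) (hζ : IsCutoff ζ ζ' ζ'' σ K) (ρ : ℝ)
    {r : ℝ} (hr : 1 / 2 < r) : HasDerivAt (profile ψ ζ ρ) (profileDeriv d κ ψ ζ ζ' ρ r) r := by
  have h := (hψ.hasDerivAt r (by linarith)).mul (hasDerivAt_comp_div hζ.hasDerivAt ρ r)
  refine h.congr_of_eventuallyEq ?_
  filter_upwards [Ioi_mem_nhds hr] with s hs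
  exact profile_eq (le_of_lt hs)

/-- Harmonicity means that `r^{d-1} ψ'` is the constant `κ`. The flux is therefore `κ ζ + r^{d-1} ψ
ζ'/ρ`, and every term of its derivative contains a derivative of the cutoff. -/
theorem hasDerivAt_flux (hd : 2 ≤ d) (hψ : IsWeight d α β ψ κ M) (hζ : IsCutoff ζ ζ' ζ'' σ K)
    (ρ : ℝ) {r : ℝ} (hr : 0 < r) :
    HasDerivAt (fun r => r ^ (d - 1) * profileDeriv d κ ψ ζ ζ' ρ r)
      (r ^ (d - 1) * profileLap d κ ψ ζ' ζ'' ρ r) r := by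
  have h1 := (hasDerivAt_comp_div hζ.hasDerivAt ρ r).const_mul κ
  have h2 := ((hasDerivAt_comp_div hζ.hasDerivAt_deriv ρ r).div_const ρ)
  have h3 := ((hasDerivAt_pow (d - 1) r).mul (hψ.hasDerivAt r hr)).mul h2
  refine ((h1.add h3).congr_of_eventuallyEq ?_).congr_deriv ?_
  · filter_upwards [Ioi_mem_nhds hr] with s hs
    have : s ^ (d - 1) ≠ 0 := (pow_pos hs _).ne'
    simp only [profileDeriv, Pi.add_apply, Pi.mul_apply]
    field_simp
  · obtain ⟨n, rfl⟩ := Nat.exists_eq_add_of_le' hd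
    simp only [profileLap]
    -- For `ρ = 0` division by zero makes both sides vanish.
    rcases eq_or_ne ρ 0 with rfl | hρ
    · simp
    · simp
      field_simp
      ring

theorem continuousOn_profileDeriv (hψ : IsWeight d α β ψ κ M) (hζ : IsCutoff ζ ζ' ζ'' σ K)
    (ρ : ℝ) : ContinuousOn (profileDeriv d κ ψ ζ ζ' ρ) (Set.Ioi 0) := by
  have h1 := hζ.continuous
  have h2 := hζ.continuous_deriv
  have h3 := hψ.contDiffOn.continuousOn
  have h4 : ContinuousOn (fun r : ℝ => (r ^ (d - 1))⁻¹) (Set.Ioi 0) :=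
    (continuous_pow _).continuousOn.inv₀ fun r hr => (pow_pos hr _).ne'
  unfold profileDeriv
  exact ((continuousOn_const.mul h4).mul (by fun_prop)).add (h3.mul (by fun_prop))

theorem continuousOn_profileLap (hψ : IsWeight d α β ψ κ M) (hζ : IsCutoff ζ ζ' ζ'' σ K)
    (ρ : ℝ) : ContinuousOn (profileLap d κ ψ ζ' ζ'' ρ) (Set.Ioi 0) := by
  have h1 := hζ.continuous_deriv2
  have h2 := hζ.continuous_deriv
  have h3 := hψ.contDiffOn.continuousOn
  have h4 : ContinuousOn (fun r : ℝ => (r ^ (d - 1))⁻¹) (Set.Ioi 0) :=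
    (continuous_pow _).continuousOn.inv₀ fun r hr => (pow_pos hr _).ne'
  have h5 : ContinuousOn (fun r : ℝ => ((d : ℝ) - 1) / r) (Set.Ioi 0) :=
    continuousOn_const.div continuousOn_id fun r hr => (ne_of_gt hr)
  unfold profileLap
  exact ((continuousOn_const.mul (continuousOn_const.mul h4)).mul (by fun_prop)).add
    (h3.mul (ContinuousOn.add (by fun_prop) (h5.mul (by fun_prop))))

theorem profileDeriv_eq_zero (hζ : IsCutoff ζ ζ' ζ'' σ K) {ρ r : ℝ} (hρ : 0 < ρ) (hr : ρ ≤ r) :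
    profileDeriv d κ ψ ζ ζ' ρ r = 0 := by
  have h : 1 ≤ |r / ρ| := ((one_le_div hρ).2 hr).trans (le_abs_self _)
  simp [profileDeriv, hζ.eq_zero _ h, hζ.deriv_eq_zero' h]

theorem profileLap_eq_zero (hζ : IsCutoff ζ ζ' ζ'' σ K) {ρ r : ℝ} (hρ : 0 < ρ) (hr : ρ ≤ r) :
    profileLap d κ ψ ζ' ζ'' ρ r = 0 := by
  have h : 1 ≤ |r / ρ| := ((one_le_div hρ).2 hr).trans (le_abs_self _)
  simp [profileLap, hζ.deriv_eq_zero' h, hζ.deriv2_eq_zero' h]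

theorem profileLap_eq_zero_of_le (hζ : IsCutoff ζ ζ' ζ'' σ K) {ρ r : ℝ} (hρ : 0 < ρ)
    (hr0 : 0 ≤ r) (hr : r ≤ ρ / 2) : profileLap d κ ψ ζ' ζ'' ρ r = 0 := by
  have h : |r / ρ| < 3 / 4 := by
    rw [abs_of_nonneg (by positivity), div_lt_iff₀ hρ]; linarith
  simp [profileLap, hζ.deriv_eq_zero _ h, hζ.deriv2_eq_zero _ h]

theorem profileDeriv_one (hζ : IsCutoff ζ ζ' ζ'' σ K) {ρ : ℝ} (hρ : 2 ≤ ρ) :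
    profileDeriv d κ ψ ζ ζ' ρ 1 = κ := by
  have h : |1 / ρ| < 3 / 4 := by
    rw [abs_of_nonneg (by positivity), div_lt_iff₀ (by linarith)]; linarith
  simp [profileDeriv, hζ.eq_one _ h.le, hζ.deriv_eq_zero _ h, -one_div]

theorem profile_one (hζ : IsCutoff ζ ζ' ζ'' σ K) {ρ : ℝ} (hρ : 2 ≤ ρ) :
    profile ψ ζ ρ 1 = ψ 1 := by
  have h : |1 / ρ| < 3 / 4 := by
    rw [abs_of_nonneg (by positivity), div_lt_iff₀ (by linarith)]; linarith
  rw [profile_eq (by norm_num), hζ.eq_one _ h.le, mul_one]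

/-- The Laplacian lives on `r > ρ/2`, and `ρ ≥ 4` puts this inside `r ≥ 2`. There `ψ' ≤ 2Mψ/ρ` and
`1/r ≤ 2/ρ`, so each of the two derivatives costs a factor `1/ρ`. -/
theorem abs_profileLap_le (hd : 2 ≤ d) (hψ : IsWeight d α β ψ κ M)
    (hζ : IsCutoff ζ ζ' ζ'' σ K) {ρ r : ℝ} (hρ : 4 ≤ ρ) (hr : 1 ≤ r) :
    |profileLap d κ ψ ζ' ζ'' ρ r| ≤ (4 * M + 2 * d) * K / ρ ^ 2 * (ψ r * ζ (r / ρ) ^ σ) := by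
  have hρ0 : 0 < ρ := by linarith
  have hψ0 := hψ.nonneg r hr
  have hM := hψ.bound_nonneg
  have hK := hζ.bound_nonneg
  have hz : 0 ≤ ζ (r / ρ) ^ σ := Real.rpow_nonneg (hζ.nonneg _) _
  rcases le_or_gt r (ρ / 2) with h | h
  · rw [profileLap_eq_zero_of_le hζ hρ0 (by linarith) h, abs_zero]; positivity
  have hr0 : 0 < r := by linarith
  have hd1 : (1 : ℝ) ≤ d := by exact_mod_cast (by omega : 1 ≤ d)
  have hκ : κ * (r ^ (d - 1))⁻¹ ≤ 2 * M * ψ r / ρ := by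
    refine (hψ.slope_le r (by linarith)).trans ?_
    rw [div_le_div_iff₀ hr0 hρ0]
    nlinarith [mul_nonneg hM hψ0]
  have hκ0 : 0 ≤ κ * (r ^ (d - 1))⁻¹ := mul_nonneg hψ.slope_nonneg (by positivity)
  have hdr : ((d : ℝ) - 1) / r ≤ 2 * (d - 1) / ρ := by
    rw [div_le_div_iff₀ hr0 hρ0]; nlinarith
  have hdr0 : 0 ≤ ((d : ℝ) - 1) / r := div_nonneg (by linarith) hr0.le
  have b1 : |2 * (κ * (r ^ (d - 1))⁻¹) * (ζ' (r / ρ) / ρ)|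
      ≤ 2 * (2 * M * ψ r / ρ) * (K * ζ (r / ρ) ^ σ / ρ) := by
    rw [abs_mul, abs_div, abs_of_nonneg (by positivity : 0 ≤ 2 * (κ * (r ^ (d - 1))⁻¹)),
      abs_of_pos hρ0]
    have := hζ.abs_deriv_le (r / ρ)
    gcongr
  have b2 : |ψ r * (ζ'' (r / ρ) / ρ ^ 2 + ((d : ℝ) - 1) / r * (ζ' (r / ρ) / ρ))|
      ≤ ψ r * (K * ζ (r / ρ) ^ σ / ρ ^ 2 + 2 * (d - 1) / ρ * (K * ζ (r / ρ) ^ σ / ρ)) := by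
    rw [abs_mul, abs_of_nonneg hψ0]
    refine mul_le_mul_of_nonneg_left ((abs_add_le _ _).trans ?_) hψ0
    rw [abs_div, abs_mul, abs_of_nonneg hdr0, abs_div, abs_of_pos hρ0,
      abs_of_pos (by positivity : 0 < ρ ^ 2)]
    have := hζ.abs_deriv_le (r / ρ)
    have := hζ.abs_deriv2_le (r / ρ)
    have : 0 ≤ 2 * ((d : ℝ) - 1) / ρ := hdr0.trans hdr
    gcongr
  have e : 2 * (2 * M * ψ r / ρ) * (K * ζ (r / ρ) ^ σ / ρ) +
      ψ r * (K * ζ (r / ρ) ^ σ / ρ ^ 2 + 2 * (d - 1) / ρ * (K * ζ (r / ρ) ^ σ / ρ))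
      = (4 * M + 2 * d - 1) * K / ρ ^ 2 * (ψ r * ζ (r / ρ) ^ σ) := by
    field_simp; ring
  have : 0 ≤ K / ρ ^ 2 * (ψ r * ζ (r / ρ) ^ σ) := by positivity
  have e2 : (4 * M + 2 * d) * K / ρ ^ 2 * (ψ r * ζ (r / ρ) ^ σ)
      = (4 * M + 2 * d - 1) * K / ρ ^ 2 * (ψ r * ζ (r / ρ) ^ σ)
        + K / ρ ^ 2 * (ψ r * ζ (r / ρ) ^ σ) := by ring
  calc _ ≤ _ := abs_add_le _ _
    _ ≤ _ := add_le_add b1 b2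
    _ ≤ _ := by rw [e, e2]; linarith

end Profile

/-! ### Polar coordinates in the exterior domain -/

instance (d : ℕ) : IsFiniteMeasure (surfaceMeasure d) :=
  inferInstanceAs (IsFiniteMeasure (volume : Measure (Space d)).toSphere)

theorem measurableSet_exterior (d : ℕ) : MeasurableSet (exterior d) :=
  (isOpen_lt continuous_const continuous_norm).measurableSet

theorem integral_volumeIoiPow (n : ℕ) (F : ℝ → ℂ) :
    ∫ r : Set.Ioi (0 : ℝ), F r ∂(Measure.volumeIoiPow n) = ∫ r in Set.Ioi (0 : ℝ), (r ^ n) • F r := by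
  simp only [Measure.volumeIoiPow, ENNReal.ofReal]
  rw [integral_withDensity_eq_integral_smul,
    integral_subtype_comap measurableSet_Ioi fun a ↦ Real.toNNReal (a ^ n) • F a,
    setIntegral_congr_fun measurableSet_Ioi fun x hx ↦ ?_]
  · rw [NNReal.smul_def, Real.coe_toNNReal _ (pow_nonneg hx.out.le _)]
  · exact (measurable_subtype_coe.pow_const _).real_toNNReal

/-- Extend by zero and use polar coordinates on the punctured space; the zero extension cuts the
radial integral down to `r > 1`. -/
theorem setIntegral_exterior_eq_polar {d : ℕ} (hd : 1 ≤ d) {f : Space d → ℂ}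
    (hf : IntegrableOn f (exterior d)) :
    ∫ x in exterior d, f x =
      ∫ y : Boundary d, (∫ r in Set.Ioi (1 : ℝ), (r ^ (d - 1)) • f (r • (y : Space d)))
        ∂(surfaceMeasure d) := by
  have : Nonempty (Fin d) := ⟨⟨0, hd⟩⟩
  have : Nontrivial (Space d) := inferInstance
  set g : Space d → ℂ := (exterior d).indicator f with hg
  have hgi : Integrable g := (integrable_indicator_iff (measurableSet_exterior d)).2 hf
  have mp := (volume : Measure (Space d)).measurePreserving_homeomorphUnitSphereProd
  have emb := (homeomorphUnitSphereProd (Space d)).measurableEmbedding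
  have hdim : Module.finrank ℝ (Space d) = d := by simp
  rw [hdim] at mp
  change MeasurePreserving _ _ ((surfaceMeasure d).prod _) at mp
  have hcomp : ∀ x : ({0}ᶜ : Set (Space d)),
      ((homeomorphUnitSphereProd (Space d) x).2 : ℝ) •
        ((homeomorphUnitSphereProd (Space d) x).1 : Space d) = x := fun x => by
    have : ‖(x : Space d)‖ ≠ 0 := norm_ne_zero_iff.2 x.2
    simp [smul_smul, this]
  set F : Boundary d × Set.Ioi (0 : ℝ) → ℂ := fun z => g ((z.2 : ℝ) • (z.1 : Space d)) with hF
  have hFi : Integrable F ((surfaceMeasure d).prod (Measure.volumeIoiPow (d - 1))) := by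
    rw [← mp.integrable_comp_emb emb]
    have : F ∘ homeomorphUnitSphereProd (Space d) = g ∘ Subtype.val := by
      ext x; simp only [hF, Function.comp_apply, hcomp]
    rw [this, ← integrableOn_iff_comap_subtypeVal (measurableSet_singleton _).compl]
    exact hgi.integrableOn
  calc ∫ x in exterior d, f x = ∫ x, g x := by
        rw [hg, integral_indicator (measurableSet_exterior d)]
    _ = ∫ x : ({0}ᶜ : Set (Space d)), g x ∂(volume.comap Subtype.val) := by
        rw [integral_subtype_comap (measurableSet_singleton _).compl g, restrict_compl_singleton]
    _ = ∫ x : ({0}ᶜ : Set (Space d)), F (homeomorphUnitSphereProd (Space d) x)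
          ∂(volume.comap Subtype.val) := by simp only [hF, hcomp]
    _ = ∫ z, F z ∂((surfaceMeasure d).prod (Measure.volumeIoiPow (d - 1))) :=
        mp.integral_comp emb F
    _ = ∫ y : Boundary d, ∫ r : Set.Ioi (0 : ℝ), g ((r : ℝ) • (y : Space d))
          ∂(Measure.volumeIoiPow (d - 1)) ∂(surfaceMeasure d) := integral_prod _ hFi
    _ = _ := by
        refine integral_congr_ae (Eventually.of_forall fun y => ?_)
        simp only
        rw [integral_volumeIoiPow (d - 1) fun r => g (r • (y : Space d)),
          ← integral_indicator measurableSet_Ioi, ← integral_indicator measurableSet_Ioi]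
        congr 1
        ext r
        have hy : ‖(y : Space d)‖ = 1 := by simp
        by_cases h1 : 1 < r
        · have h0 : 0 < r := by linarith
          have : r • (y : Space d) ∈ exterior d := by
            simp [exterior, norm_smul, hy, abs_of_pos h0, h1]
          simp [h0, h1, hg, this]
        · by_cases h0 : 0 < r
          · have : r • (y : Space d) ∉ exterior d := by
              simp only [exterior, Set.mem_ofPred_eq, norm_smul, hy, Real.norm_eq_abs, abs_of_pos h0]
              simpa using h1
            simp [h0, h1, hg, this]
          · simp [h0, h1]

/-! ### The divergence theorem for radial vector fields -/

theorem integrableOn_exterior_of_continuousOn {d : ℕ} {f : Space d → ℂ} {R : ℝ}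
    (hf : ContinuousOn f {x | 1 ≤ ‖x‖}) (h0 : ∀ x, R ≤ ‖x‖ → f x = 0) :
    IntegrableOn f (exterior d) := by
  have hK : IsCompact ({x : Space d | 1 ≤ ‖x‖} ∩ Metric.closedBall 0 R) :=
    (isCompact_closedBall _ _).inter_left (isClosed_le continuous_const continuous_norm)
  have h1 : IntegrableOn f ({x : Space d | 1 ≤ ‖x‖} ∩ Metric.closedBall 0 R) :=
    (hf.mono Set.inter_subset_left).integrableOn_compact hK
  refine (h1.of_forall_sdiff_eq_zero (t := {x : Space d | 1 ≤ ‖x‖})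
    (isClosed_le continuous_const continuous_norm).measurableSet fun x hx => h0 x ?_).mono_set ?_
  · have := hx.2
    simp only [Set.mem_inter_iff, hx.1, true_and, Metric.mem_closedBall, dist_zero_right,
      not_le] at this
    exact this.le
  · intro x hx
    exact le_of_lt (show 1 < ‖x‖ from hx)

/-- Integration by parts against the radial vector field `b(|x|) x / |x|`, whose divergence is
`Λ(|x|)`. -/
theorem integral_radial_divergence {d : ℕ} (hd : 1 ≤ d) {b Λ : ℝ → ℝ} {R : ℝ}
    (hb : ContinuousOn b (Set.Ioi 0)) (hΛ : ContinuousOn Λ (Set.Ioi 0))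
    (hflux : ∀ r, 0 < r → HasDerivAt (fun r => r ^ (d - 1) * b r) (r ^ (d - 1) * Λ r) r)
    (hb0 : ∀ r, R ≤ r → b r = 0) (hΛ0 : ∀ r, R ≤ r → Λ r = 0)
    {φ : Space d → ℂ} (hφ : ContDiff ℝ ∞ φ) :
    (∫ x in exterior d, fderiv ℝ φ x (‖x‖⁻¹ • x) * (b ‖x‖ : ℂ))
        + ∫ x in exterior d, φ x * (Λ ‖x‖ : ℂ)
      = -((b 1 : ℂ) * ∫ y : Boundary d, φ y ∂(surfaceMeasure d)) := by
  have hφ1 : Continuous (fderiv ℝ φ) := hφ.continuous_fderiv (by norm_num)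
  have hφ0 := hφ.continuous
  have hmaps : Set.MapsTo (fun x : Space d => ‖x‖) {x | 1 ≤ ‖x‖} (Set.Ioi 0) :=
    fun x hx => lt_of_lt_of_le one_pos (show 1 ≤ ‖x‖ from hx)
  have hbx : ContinuousOn (fun x : Space d => (b ‖x‖ : ℂ)) {x | 1 ≤ ‖x‖} :=
    Complex.continuous_ofReal.comp_continuousOn (hb.comp continuous_norm.continuousOn hmaps)
  have hΛx : ContinuousOn (fun x : Space d => (Λ ‖x‖ : ℂ)) {x | 1 ≤ ‖x‖} :=
    Complex.continuous_ofReal.comp_continuousOn (hΛ.comp continuous_norm.continuousOn hmaps)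
  have hinv : ContinuousOn (fun x : Space d => ‖x‖⁻¹ • x) {x | 1 ≤ ‖x‖} :=
    (continuous_norm.continuousOn.inv₀ fun x hx => (hmaps hx).ne').smul continuousOn_id
  have hc1 : ContinuousOn (fun x : Space d => fderiv ℝ φ x (‖x‖⁻¹ • x) * (b ‖x‖ : ℂ))
      {x | 1 ≤ ‖x‖} := (hφ1.continuousOn.clm_apply hinv).mul hbx
  have hc2 : ContinuousOn (fun x : Space d => φ x * (Λ ‖x‖ : ℂ)) {x | 1 ≤ ‖x‖} :=
    hφ0.continuousOn.mul hΛx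
  have hi1 := integrableOn_exterior_of_continuousOn hc1 (R := R) fun x hx => by simp [hb0 _ hx]
  have hi2 := integrableOn_exterior_of_continuousOn hc2 (R := R) fun x hx => by simp [hΛ0 _ hx]
  rw [← integral_add' hi1 hi2, setIntegral_exterior_eq_polar hd (hi1.add hi2),
    ← integral_const_mul, ← integral_neg]
  refine integral_congr_ae (Eventually.of_forall fun y => ?_)
  simp only
  have hy : ‖(y : Space d)‖ = 1 := by simp
  have hnorm : ∀ r : ℝ, 0 < r → ‖r • (y : Space d)‖ = r := fun r hr => by
    rw [norm_smul, hy, mul_one, Real.norm_eq_abs, abs_of_pos hr]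
  -- On each ray the two integrands, with the Jacobian `r^{d-1}`, add up to the derivative of `φ(ry)
  -- r^{d-1} b(r)`. This vanishes for large `r`, so the fundamental theorem of calculus leaves only
  -- the value at `r = 1`.
  have hder : ∀ r ∈ Set.Ici (1 : ℝ), HasDerivAt
      (fun r : ℝ => φ (r • (y : Space d)) * ((r ^ (d - 1) * b r : ℝ) : ℂ))
      ((r ^ (d - 1)) • (fderiv ℝ φ (r • (y : Space d))
        (‖r • (y : Space d)‖⁻¹ • r • (y : Space d)) * (b ‖r • (y : Space d)‖ : ℂ)
          + φ (r • (y : Space d)) * (Λ ‖r • (y : Space d)‖ : ℂ))) r := fun r hr => by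
    have hr0 : 0 < r := lt_of_lt_of_le one_pos hr
    have h1 : HasDerivAt (fun r : ℝ => φ (r • (y : Space d)))
        (fderiv ℝ φ (r • (y : Space d)) (y : Space d)) r := by
      have hl : HasDerivAt (fun r : ℝ => r • (y : Space d)) (y : Space d) r := by
        simpa using (hasDerivAt_id r).smul_const (y : Space d)
      exact ((hφ.differentiable (by norm_num) _).hasFDerivAt).comp_hasDerivAt r hl
    refine (h1.mul (hflux r hr0).ofReal_comp).congr_deriv ?_
    rw [hnorm r hr0, smul_smul, inv_mul_cancel₀ hr0.ne', one_smul, Complex.real_smul]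
    push_cast
    ring
  have hcont : ContinuousOn (fun r : ℝ => (r ^ (d - 1)) • (fderiv ℝ φ (r • (y : Space d))
        (‖r • (y : Space d)‖⁻¹ • r • (y : Space d)) * (b ‖r • (y : Space d)‖ : ℂ)
          + φ (r • (y : Space d)) * (Λ ‖r • (y : Space d)‖ : ℂ))) (Set.Ici 1) := by
    have hm : Set.MapsTo (fun r : ℝ => r • (y : Space d)) (Set.Ici 1) {x | 1 ≤ ‖x‖} :=
      fun r hr => by
        simp only [Set.mem_ofPred_eq, hnorm r (lt_of_lt_of_le one_pos hr)]; exact hr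
    exact (continuous_pow _).continuousOn.smul
      ((hc1.add hc2).comp (by fun_prop : Continuous fun r : ℝ => r • (y : Space d)).continuousOn hm)
  have hzero : ∀ r, max 1 R ≤ r → (r ^ (d - 1)) • (fderiv ℝ φ (r • (y : Space d))
        (‖r • (y : Space d)‖⁻¹ • r • (y : Space d)) * (b ‖r • (y : Space d)‖ : ℂ)
          + φ (r • (y : Space d)) * (Λ ‖r • (y : Space d)‖ : ℂ)) = 0 := fun r hr => by
    have h1 : 0 < r := lt_of_lt_of_le one_pos ((le_max_left _ _).trans hr)
    have h2 : R ≤ r := (le_max_right _ _).trans hr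
    simp [hnorm r h1, hb0 r h2, hΛ0 r h2]
  have hint : IntegrableOn (fun r : ℝ => (r ^ (d - 1)) • (fderiv ℝ φ (r • (y : Space d))
        (‖r • (y : Space d)‖⁻¹ • r • (y : Space d)) * (b ‖r • (y : Space d)‖ : ℂ)
          + φ (r • (y : Space d)) * (Λ ‖r • (y : Space d)‖ : ℂ))) (Set.Ioi 1) := by
    have h1 := (hcont.mono (Set.Icc_subset_Ici_self : Set.Icc 1 (max 1 R) ⊆ Set.Ici 1)).integrableOn_compact
      (μ := volume) isCompact_Icc
    refine h1.of_forall_sdiff_eq_zero measurableSet_Ioi fun r hr => hzero r ?_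
    have h2 := hr.2
    have h3 : (1 : ℝ) < r := hr.1
    simp only [Set.mem_Icc, not_and, not_le] at h2
    exact (h2 h3.le).le
  have htends : Tendsto (fun r : ℝ => φ (r • (y : Space d)) * ((r ^ (d - 1) * b r : ℝ) : ℂ))
      atTop (𝓝 0) := by
    refine tendsto_const_nhds.congr' ?_
    filter_upwards [eventually_ge_atTop R] with r hr
    simp [hb0 r hr]
  have := integral_Ioi_of_hasDerivAt_of_tendsto' hder hint htends
  simp only [Pi.add_apply]
  rw [this]
  simp
  ring

/-! ### Pairings of square integrable functions -/

theorem _root_.MeasureTheory.MemLp.integrable_real_smul {X F : Type*} [MeasurableSpace X]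
    {μ : Measure X} [NormedAddCommGroup F] [NormedSpace ℝ F] {b : X → ℝ} {f : X → F}
    (hb : MemLp b 2 μ) (hf : MemLp f 2 μ) : Integrable (fun x => b x • f x) μ :=
  memLp_one_iff_integrable.1 (hf.smul hb)

/-- By Cauchy–Schwarz. The filter is arbitrary so that the same statement serves approximating
sequences, continuity in time and difference quotients. -/
theorem tendsto_integral_smul_of_tendsto_eLpNorm {X F ι : Type*} [MeasurableSpace X]
    {μ : Measure X} [NormedAddCommGroup F] [NormedSpace ℝ F] {l : Filter ι} {b : X → ℝ}
    {f : ι → X → F} {f₀ : X → F} (hb : MemLp b 2 μ) (hf : ∀ᶠ n in l, MemLp (f n) 2 μ)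
    (hf₀ : MemLp f₀ 2 μ) (h : Tendsto (fun n => eLpNorm (fun x => f n x - f₀ x) 2 μ) l (𝓝 0)) :
    Tendsto (fun n => ∫ x, b x • f n x ∂μ) l (𝓝 (∫ x, b x • f₀ x ∂μ)) := by
  have h0 : Tendsto (fun n => eLpNorm b 2 μ * eLpNorm (fun x => f n x - f₀ x) 2 μ) l (𝓝 0) := by
    simpa using ENNReal.Tendsto.const_mul h (Or.inr hb.eLpNorm_ne_top)
  refine tendsto_integral_of_L1 _ (hb.integrable_real_smul hf₀).aestronglyMeasurable
    (hf.mono fun n hn => hb.integrable_real_smul hn) (tendsto_of_tendsto_of_tendsto_of_le_of_le'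
      tendsto_const_nhds h0 (Eventually.of_forall fun _ => zero_le) ?_)
  filter_upwards [hf] with n hn
  have := eLpNorm_smul_le_mul_eLpNorm (p := 2) (q := 2) (r := 1) (hn.sub hf₀).aestronglyMeasurable
    hb.aestronglyMeasurable
  rw [eLpNorm_one_eq_lintegral_enorm] at this
  refine le_trans (le_of_eq ?_) this
  refine lintegral_congr fun x => ?_
  simp [smul_sub]

theorem tendsto_eLpNorm_comp_sub {X F F' ι : Type*} [MeasurableSpace X] {μ : Measure X}
    [NormedAddCommGroup F] [NormedAddCommGroup F'] {l : Filter ι} {f : ι → X → F} {f₀ : X → F}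
    (Θ : F → F') (hΘ : ∀ a b, ‖Θ a - Θ b‖ ≤ ‖a - b‖)
    (h : Tendsto (fun n => eLpNorm (fun x => f n x - f₀ x) 2 μ) l (𝓝 0)) :
    Tendsto (fun n => eLpNorm (fun x => Θ (f n x) - Θ (f₀ x)) 2 μ) l (𝓝 0) :=
  tendsto_of_tendsto_of_tendsto_of_le_of_le tendsto_const_nhds h (fun _ => zero_le)
    fun _ => eLpNorm_mono fun _ => hΘ _ _

/-- Continuity is asked for only on the closed exterior because the radial fields used below, with
factors such as `‖x‖⁻¹`, are singular at the origin. -/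
theorem memLp_exterior_of_continuousOn {d : ℕ} {F : Type*} [NormedAddCommGroup F]
    {f : Space d → F} {R : ℝ} (hf : ContinuousOn f {x | 1 ≤ ‖x‖})
    (h0 : ∀ x, R ≤ ‖x‖ → f x = 0) {p : ℝ≥0∞} : MemLp f p (exteriorMeasure d) := by
  have hcl : IsClosed {x : Space d | 1 ≤ ‖x‖} := isClosed_le continuous_const continuous_norm
  have hK : IsCompact ({x : Space d | 1 ≤ ‖x‖} ∩ Metric.closedBall 0 R) :=
    (isCompact_closedBall _ _).inter_left hcl
  obtain ⟨C, hC⟩ := hK.exists_bound_of_continuousOn (hf.mono Set.inter_subset_left)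
  have hm : MeasurableSet ({x : Space d | 1 ≤ ‖x‖} ∩ Metric.closedBall 0 R) := hK.measurableSet
  have : IsFiniteMeasure (volume.restrict ({x : Space d | 1 ≤ ‖x‖} ∩ Metric.closedBall 0 R)) :=
    isFiniteMeasure_restrict.2 hK.measure_lt_top.ne
  have h1 : MemLp f p (volume.restrict ({x : Space d | 1 ≤ ‖x‖} ∩ Metric.closedBall 0 R)) :=
    MemLp.of_bound ((hf.mono Set.inter_subset_left).aestronglyMeasurable hm) C
      ((ae_restrict_iff' hm).2 (Eventually.of_forall hC))
  have h2 := ((memLp_indicator_iff_restrict hm).2 h1).restrict (exterior d)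
  refine h2.ae_eq ((ae_restrict_iff' (measurableSet_exterior d)).2 (Eventually.of_forall
    fun x hx => ?_))
  by_cases hxR : ‖x‖ ≤ R
  · have hx' : x ∈ {x : Space d | 1 ≤ ‖x‖} ∩ Metric.closedBall 0 R :=
      ⟨le_of_lt (show 1 < ‖x‖ from hx), by simpa using hxR⟩
    exact Set.indicator_of_mem hx' _
  · rw [Set.indicator_of_notMem (fun h => hxR (by simpa using h.2)), h0 x (not_le.1 hxR).le]

/-! ### Integration by parts for functions in `H¹(Ω)` -/

theorem memLp_of_continuous_hasCompactSupport {d : ℕ} {F : Type*} [NormedAddCommGroup F]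
    {f : Space d → F} (hf : Continuous f) (hc : HasCompactSupport f) {p : ℝ≥0∞} :
    MemLp f p (exteriorMeasure d) :=
  (hf.memLp_of_hasCompactSupport hc).restrict _

theorem fderiv_eq_sum_grad {d : ℕ} (φ : Space d → ℂ) (x y : Space d) :
    fderiv ℝ φ x y = ∑ i, ((y i : ℝ) : ℂ) * grad φ x i := by
  have hy : y = ∑ i, y i • EuclideanSpace.single i (1 : ℝ) := by
    simpa using ((EuclideanSpace.basisFun (Fin d) ℝ).sum_repr y).symm
  conv_lhs => rw [hy]
  simp [grad]

theorem continuous_grad {d : ℕ} {φ : Space d → ℂ} (hφ : ContDiff ℝ ∞ φ) : Continuous (grad φ) := by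
  have := hφ.continuous_fderiv (by norm_num)
  unfold grad
  fun_prop

theorem hasCompactSupport_grad {d : ℕ} {φ : Space d → ℂ} (hφ : HasCompactSupport φ) :
    HasCompactSupport (grad φ) := by
  refine (hφ.fderiv (𝕜 := ℝ)).mono fun x hx => ?_
  contrapose! hx
  simp only [Function.mem_support, not_not] at hx ⊢
  ext i
  simp [grad, hx]

/-- The left side is continuous in `H¹(Ω)`, the coefficients being square integrable. Convergence of
the boundary integrals is a hypothesis, so that one limit argument covers both the Dirichlet
condition and traces. -/
theorem integral_radial_divergence_of_tendstoInH1 {d : ℕ} (hd : 1 ≤ d) {b Λ : ℝ → ℝ} {R : ℝ}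
    (hb : ContinuousOn b (Set.Ioi 0)) (hΛ : ContinuousOn Λ (Set.Ioi 0))
    (hflux : ∀ r, 0 < r → HasDerivAt (fun r => r ^ (d - 1) * b r) (r ^ (d - 1) * Λ r) r)
    (hb0 : ∀ r, R ≤ r → b r = 0) (hΛ0 : ∀ r, R ≤ r → Λ r = 0)
    {w : Space d → ℂ} {G : Space d → EuclideanSpace ℂ (Fin d)} (hw : MemH1 w G)
    {φ : ℕ → Space d → ℂ} (hφ : ∀ n, ContDiff ℝ ∞ (φ n) ∧ HasCompactSupport (φ n))
    (hlim : TendstoInH1 φ w G) {c : ℂ}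
    (hc : Tendsto (fun n => ∫ y : Boundary d, φ n y ∂(surfaceMeasure d)) atTop (𝓝 c)) :
    (∑ i, ∫ x in exterior d, (b ‖x‖ * (‖x‖⁻¹ * x i)) • G x i)
        + ∫ x in exterior d, Λ ‖x‖ • w x = -((b 1 : ℂ) * c) := by
  have hmaps : Set.MapsTo (fun x : Space d => ‖x‖) {x | 1 ≤ ‖x‖} (Set.Ioi 0) :=
    fun x hx => lt_of_lt_of_le one_pos (show 1 ≤ ‖x‖ from hx)
  have hbx : ContinuousOn (fun x : Space d => b ‖x‖) {x | 1 ≤ ‖x‖} :=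
    hb.comp continuous_norm.continuousOn hmaps
  have hinv : ContinuousOn (fun x : Space d => ‖x‖⁻¹) {x | 1 ≤ ‖x‖} :=
    continuous_norm.continuousOn.inv₀ fun x hx => (hmaps hx).ne'
  have hB : ∀ i : Fin d, MemLp (fun x : Space d => b ‖x‖ * (‖x‖⁻¹ * x i)) 2 (exteriorMeasure d) :=
    fun i => memLp_exterior_of_continuousOn (R := R)
      (hbx.mul (hinv.mul (by fun_prop : Continuous fun x : Space d => x i).continuousOn))
      fun x hx => by simp [hb0 _ hx]
  have hL : MemLp (fun x : Space d => Λ ‖x‖) 2 (exteriorMeasure d) :=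
    memLp_exterior_of_continuousOn (R := R) (hΛ.comp continuous_norm.continuousOn hmaps)
      fun x hx => hΛ0 _ hx
  have hcoord : ∀ i : Fin d, ∀ a b : EuclideanSpace ℂ (Fin d), ‖a i - b i‖ ≤ ‖a - b‖ :=
    fun i a b => by simpa using PiLp.norm_apply_le (a - b) i
  have hcomp : ∀ (i : Fin d) {F : Space d → EuclideanSpace ℂ (Fin d)},
      MemLp F 2 (exteriorMeasure d) → MemLp (fun x => F x i) 2 (exteriorMeasure d) :=
    fun i F hF => hF.mono
      ((by fun_prop : Continuous fun a : EuclideanSpace ℂ (Fin d) => a i).comp_aestronglyMeasurable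
        hF.aestronglyMeasurable) (Eventually.of_forall fun x => PiLp.norm_apply_le (F x) i)
  have hgrad : ∀ n, MemLp (grad (φ n)) 2 (exteriorMeasure d) := fun n =>
    memLp_of_continuous_hasCompactSupport (continuous_grad (hφ n).1)
      (hasCompactSupport_grad (hφ n).2)
  have hφ2 : ∀ n, MemLp (φ n) 2 (exteriorMeasure d) := fun n =>
    memLp_of_continuous_hasCompactSupport (hφ n).1.continuous (hφ n).2
  have t1 : Tendsto (fun n => ∑ i, ∫ x in exterior d, (b ‖x‖ * (‖x‖⁻¹ * x i)) • grad (φ n) x i)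
      atTop (𝓝 (∑ i, ∫ x in exterior d, (b ‖x‖ * (‖x‖⁻¹ * x i)) • G x i)) :=
    tendsto_finsetSum _ fun i _ => tendsto_integral_smul_of_tendsto_eLpNorm (hB i)
      (Eventually.of_forall fun n => hcomp i (hgrad n)) (hcomp i hw.memLp_gradient)
      (tendsto_eLpNorm_comp_sub (fun a : EuclideanSpace ℂ (Fin d) => a i) (hcoord i) hlim.2)
  have t2 : Tendsto (fun n => ∫ x in exterior d, Λ ‖x‖ • φ n x)
      atTop (𝓝 (∫ x in exterior d, Λ ‖x‖ • w x)) :=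
    tendsto_integral_smul_of_tendsto_eLpNorm hL (Eventually.of_forall hφ2) hw.memLp hlim.1
  have t3 := (hc.const_mul (b 1 : ℂ)).neg
  refine tendsto_nhds_unique (t1.add t2) (t3.congr fun n => ?_)
  rw [← integral_radial_divergence hd hb hΛ hflux hb0 hΛ0 (hφ n).1, ← integral_finsetSum]
  · congr 1
    · refine integral_congr_ae (Eventually.of_forall fun x => ?_)
      simp only [fderiv_eq_sum_grad, Finset.sum_mul, Complex.real_smul]
      refine Finset.sum_congr rfl fun i _ => ?_
      simp
      ring
    · refine integral_congr_ae (Eventually.of_forall fun x => ?_)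
      simp [mul_comm]
  · exact fun i _ => (hB i).integrable_real_smul (hcomp i (hgrad n))

/-- The value of the boundary integral of a function in `H¹(Ω)` or `H¹₀(Ω)` whose trace is `g`. -/
theorem exists_boundary_integral {d : ℕ} (hd : 1 ≤ d) {b Λ : ℝ → ℝ} {R α : ℝ}
    (hb : ContinuousOn b (Set.Ioi 0)) (hΛ : ContinuousOn Λ (Set.Ioi 0))
    (hflux : ∀ r, 0 < r → HasDerivAt (fun r => r ^ (d - 1) * b r) (r ^ (d - 1) * Λ r) r)
    (hb0 : ∀ r, R ≤ r → b r = 0) (hΛ0 : ∀ r, R ≤ r → Λ r = 0)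
    {w : Space d → ℂ} {G : Space d → EuclideanSpace ℂ (Fin d)} {g : Boundary d → ℂ}
    (hw : MemH1 w G) (h0 : α = 0 → MemH10 w G) (h1 : α ≠ 0 → IsTrace w G g) :
    (∑ i, ∫ x in exterior d, (b ‖x‖ * (‖x‖⁻¹ * x i)) • G x i)
        + ∫ x in exterior d, Λ ‖x‖ • w x
      = -((b 1 : ℂ) * if α = 0 then 0 else ∫ y, g y ∂(surfaceMeasure d)) := by
  by_cases hα : α = 0
  · obtain ⟨-, φ, hφ, hlim⟩ := h0 hα
    refine integral_radial_divergence_of_tendstoInH1 hd hb hΛ hflux hb0 hΛ0 hw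
      (fun n => ⟨(hφ n).1, (hφ n).2.1⟩) hlim ?_
    rw [if_pos hα]
    -- The approximants have support in the open set `Ω`, so they vanish on the sphere.
    refine tendsto_const_nhds.congr fun n => ?_
    refine (integral_eq_zero_of_ae (Eventually.of_forall fun y => ?_)).symm
    refine image_eq_zero_of_notMem_tsupport fun hy => ?_
    have : 1 < ‖(y : Space d)‖ := (hφ n).2.2 hy
    simp at this
  · obtain ⟨hg, φ, hφ, hlim, hlimg⟩ := h1 hα
    refine integral_radial_divergence_of_tendstoInH1 hd hb hΛ hflux hb0 hΛ0 hw hφ hlim ?_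
    rw [if_neg hα]
    have hφg : ∀ n, MemLp (fun y : Boundary d => φ n y) 2 (surfaceMeasure d) := fun n => by
      have hc : Continuous fun y : Boundary d => φ n y :=
        (hφ n).1.continuous.comp continuous_subtype_val
      obtain ⟨C, hC⟩ := (hφ n).2.exists_bound_of_continuous (hφ n).1.continuous
      exact MemLp.of_bound hc.aestronglyMeasurable C (Eventually.of_forall fun y => hC y)
    simpa using tendsto_integral_smul_of_tendsto_eLpNorm (b := fun _ => 1)
      (memLp_const (1 : ℝ)) (Eventually.of_forall hφg) hg hlimg

/-! ### Curves in `L²(Ω)` -/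

instance (d : ℕ) : SFinite (exteriorMeasure d) :=
  inferInstanceAs (SFinite (volume.restrict (exterior d)))

section Curves

variable {d : ℕ} {F : Type*} [NormedAddCommGroup F] {T : ℝ}

theorem ContinuousInL2.comp {F' : Type*} [NormedAddCommGroup F'] {f : ℝ → Space d → F}
    (hf : ContinuousInL2 T f) (Θ : F → F') (hc : Continuous Θ) (h0 : Θ 0 = 0)
    (hΘ : ∀ a b, ‖Θ a - Θ b‖ ≤ ‖a - b‖) : ContinuousInL2 T fun t x => Θ (f t x) := by
  refine ⟨fun t ht => ?_, fun t ht => tendsto_eLpNorm_comp_sub Θ hΘ (hf.2 t ht)⟩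
  refine (hf.1 t ht).mono (hc.comp_aestronglyMeasurable (hf.1 t ht).aestronglyMeasurable)
    (Eventually.of_forall fun x => ?_)
  simpa [h0] using hΘ (f t x) 0

theorem ContinuousInL2.continuousOn_pairing [NormedSpace ℝ F] {f : ℝ → Space d → F}
    (hf : ContinuousInL2 T f) {b : Space d → ℝ} (hb : MemLp b 2 (exteriorMeasure d)) :
    ContinuousOn (fun t => ∫ x in exterior d, b x • f t x) (Set.Ico 0 T) := fun t ht =>
  tendsto_integral_smul_of_tendsto_eLpNorm hb
    (eventually_nhdsWithin_of_forall hf.1) (hf.1 t ht) (hf.2 t ht)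

/-- At interior times the one-sided filter of the definition is the full punctured neighbourhood. At
time `0` only continuity of the pairing is needed later. -/
theorem HasTimeDerivInL2.hasDerivAt_pairing {u v : ℝ → Space d → ℂ} (h : HasTimeDerivInL2 T u v)
    (hu : ContinuousInL2 T u) (hv : ContinuousInL2 T v) {b : Space d → ℝ}
    (hb : MemLp b 2 (exteriorMeasure d)) {t : ℝ} (ht : t ∈ Set.Ioo 0 T) :
    HasDerivAt (fun t => ∫ x in exterior d, b x • u t x) (∫ x in exterior d, b x • v t x) t := by
  have ht' : t ∈ Set.Ico 0 T := Set.Ioo_subset_Ico_self ht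
  have hn : 𝓝[Set.Ico 0 T \ {t}] t = 𝓝[≠] t := by
    rw [Set.sdiff_eq, Set.inter_comm]
    exact nhdsWithin_inter_of_mem' (mem_nhdsWithin_of_mem_nhds (Ico_mem_nhds ht.1 ht.2))
  have hmem : ∀ᶠ s in 𝓝[Set.Ico 0 T \ {t}] t, s ∈ Set.Ico 0 T :=
    eventually_nhdsWithin_of_forall fun s hs => hs.1
  have := tendsto_integral_smul_of_tendsto_eLpNorm (f := fun s x => (s - t)⁻¹ • (u s x - u t x)) hb
    (hmem.mono fun s hs => ((hu.1 s hs).sub (hu.1 t ht')).const_smul ((s - t)⁻¹)) (hv.1 t ht') (h t ht')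
  rw [hasDerivAt_iff_tendsto_slope, ← hn]
  refine this.congr' (hmem.mono fun s hs => ?_)
  rw [slope_def_module]
  change _ = (s - t)⁻¹ • ((∫ x, b x • u s x ∂exteriorMeasure d)
    - ∫ x, b x • u t x ∂exteriorMeasure d)
  rw [← integral_sub (hb.integrable_real_smul (hu.1 s hs))
    (hb.integrable_real_smul (hu.1 t ht')), ← integral_smul]
  refine integral_congr_ae (Eventually.of_forall fun x => ?_)
  simp only [smul_sub]
  rw [smul_comm, smul_comm (b x)]

theorem restrict_prod_exterior (s : Set ℝ) :
    (volume : Measure (ℝ × Space d)).restrict (s ×ˢ exterior d)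
      = (volume.restrict s).prod (exteriorMeasure d) := by
  rw [exteriorMeasure, Measure.prod_restrict]; rfl

/-- Tonelli: at each time the pairing is finite by Cauchy–Schwarz, and it is continuous in time on
the compact interval `[0, R]`. Nothing is known as `t → T`, hence `R < T`. -/
theorem ContinuousInL2.integrableOn_norm_mul {f : ℝ → Space d → F} (hm : JointlyMeasurable T f)
    (hf : ContinuousInL2 T f) {b : Space d → ℝ} (hb : MemLp b 2 (exteriorMeasure d)) {R : ℝ}
    (hR : R < T) :
    IntegrableOn (fun z : ℝ × Space d => ‖f z.1 z.2‖ * ‖b z.2‖) (Set.Ioo 0 R ×ˢ exterior d) := by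
  have hfn : ContinuousInL2 T fun t x => ‖f t x‖ :=
    hf.comp (fun a => ‖a‖) continuous_norm norm_zero fun a b => by
      simpa using abs_norm_sub_norm_le a b
  have hsub : Set.Ioo 0 R ×ˢ exterior d ⊆ Set.Ioo 0 T ×ˢ exterior d :=
    Set.prod_mono (Set.Ioo_subset_Ioo_right hR.le) le_rfl
  have hIcc : Set.Icc 0 R ⊆ Set.Ico 0 T := fun t ht => ⟨ht.1, ht.2.trans_lt hR⟩
  rw [IntegrableOn, restrict_prod_exterior]
  have hmeas : AEStronglyMeasurable (fun z : ℝ × Space d => ‖f z.1 z.2‖ * ‖b z.2‖)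
      ((volume.restrict (Set.Ioo 0 R)).prod (exteriorMeasure d)) := by
    refine AEStronglyMeasurable.mul ?_ hb.aestronglyMeasurable.norm.comp_snd
    rw [← restrict_prod_exterior]
    exact (AEStronglyMeasurable.mono_set hsub hm).norm
  rw [integrable_prod_iff hmeas]
  constructor
  · refine (ae_restrict_iff' measurableSet_Ioo).2 (Eventually.of_forall fun t ht => ?_)
    have := hb.norm.integrable_real_smul (hfn.1 t (hIcc (Set.Ioo_subset_Icc_self ht)))
    simpa [mul_comm] using this
  · have hc := (hfn.continuousOn_pairing hb.norm).mono hIcc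
    refine ((hc.integrableOn_compact (μ := volume) isCompact_Icc).mono_set
      Set.Ioo_subset_Icc_self).congr (Eventually.of_forall fun t => ?_)
    refine integral_congr_ae (Eventually.of_forall fun x => ?_)
    simp [mul_comm]

theorem ContinuousInL2.integrableOn_smul [NormedSpace ℝ F] {f : ℝ → Space d → F}
    (hm : JointlyMeasurable T f)
    (hf : ContinuousInL2 T f) {b : Space d → ℝ} (hb : MemLp b 2 (exteriorMeasure d)) {a : ℝ → ℝ}
    (ha : Continuous a) {R : ℝ} (hR : R < T) (ha0 : ∀ t, R ≤ t → a t = 0) :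
    IntegrableOn (fun z : ℝ × Space d => (a z.1 * b z.2) • f z.1 z.2)
      (Set.Ioo 0 T ×ˢ exterior d) := by
  obtain ⟨C, hC⟩ := (isCompact_Icc (a := (0 : ℝ)) (b := R)).exists_bound_of_continuousOn
    ha.continuousOn
  have h1 := (hf.integrableOn_norm_mul hm hb hR).const_mul C
  have hsub : Set.Ioo 0 R ×ˢ exterior d ⊆ Set.Ioo 0 T ×ˢ exterior d :=
    Set.prod_mono (Set.Ioo_subset_Ioo_right hR.le) le_rfl
  have h2 : IntegrableOn (fun z : ℝ × Space d => (a z.1 * b z.2) • f z.1 z.2)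
      (Set.Ioo 0 R ×ˢ exterior d) := by
    refine h1.mono' ?_ ((ae_restrict_iff' (measurableSet_Ioo.prod
      (measurableSet_exterior d))).2 (Eventually.of_forall fun z hz => ?_))
    · refine AEStronglyMeasurable.smul ?_ (AEStronglyMeasurable.mono_set hsub hm)
      rw [restrict_prod_exterior]
      exact (ha.comp continuous_fst).aestronglyMeasurable.mul hb.aestronglyMeasurable.comp_snd
    · rw [norm_smul, norm_mul, mul_assoc, mul_comm ‖b z.2‖]
      exact mul_le_mul_of_nonneg_right (hC z.1 (Set.Ioo_subset_Icc_self hz.1)) (by positivity)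
  refine h2.of_forall_sdiff_eq_zero (measurableSet_Ioo.prod (measurableSet_exterior d))
    fun z hz => ?_
  have : R ≤ z.1 := by
    by_contra h
    exact hz.2 ⟨⟨hz.1.1.1, not_le.1 h⟩, hz.1.2⟩
  simp [ha0 _ this]

theorem ContinuousInL2.setIntegral_smul_eq [NormedSpace ℝ F]
    {f : ℝ → Space d → F} (hm : JointlyMeasurable T f)
    (hf : ContinuousInL2 T f) {b : Space d → ℝ} (hb : MemLp b 2 (exteriorMeasure d)) {a : ℝ → ℝ}
    (ha : Continuous a) {R : ℝ} (hR : R < T) (ha0 : ∀ t, R ≤ t → a t = 0) :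
    ∫ z in Set.Ioo 0 T ×ˢ exterior d, (a z.1 * b z.2) • f z.1 z.2
      = ∫ t in Set.Ioo 0 T, a t • ∫ x in exterior d, b x • f t x := by
  have h := hf.integrableOn_smul hm hb ha hR ha0
  rw [IntegrableOn, restrict_prod_exterior] at h
  rw [restrict_prod_exterior, integral_prod _ h]
  refine integral_congr_ae (Eventually.of_forall fun t => ?_)
  simp only [mul_smul]
  rw [integral_smul]; rfl

theorem ContinuousInL2.integrableOn_time [NormedSpace ℝ F] {f : ℝ → Space d → F}
    (hm : JointlyMeasurable T f)
    (hf : ContinuousInL2 T f) {b : Space d → ℝ} (hb : MemLp b 2 (exteriorMeasure d)) {a : ℝ → ℝ}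
    (ha : Continuous a) {R : ℝ} (hR : R < T) (ha0 : ∀ t, R ≤ t → a t = 0) :
    IntegrableOn (fun t => a t • ∫ x in exterior d, b x • f t x) (Set.Ioo 0 T) := by
  have h := hf.integrableOn_smul hm hb ha hR ha0
  rw [IntegrableOn, restrict_prod_exterior] at h
  refine h.integral_prod_left.congr (Eventually.of_forall fun t => ?_)
  simp only [mul_smul]
  rw [integral_smul]; rfl

end Curves

/-- Since `a` and `a'` vanish beyond `R < T`, this is integration by parts on `[0, R]`, where
everything is continuous; the endpoint `R` contributes nothing. -/
theorem integral_deriv_smul_eq {T R : ℝ} (hR0 : 0 ≤ R) (hR : R < T) {F V : ℝ → ℂ} {a a' : ℝ → ℝ}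
    (hF : ContinuousOn F (Set.Ico 0 T)) (hV : ContinuousOn V (Set.Ico 0 T))
    (hd : ∀ t ∈ Set.Ioo 0 T, HasDerivAt F (V t) t) (ha : ∀ t, HasDerivAt a (a' t) t)
    (ha' : Continuous a') (h0 : ∀ t, R ≤ t → a t = 0) (h0' : ∀ t, R ≤ t → a' t = 0) :
    ∫ t in Set.Ioo 0 T, a t • V t = -(a 0 • F 0) - ∫ t in Set.Ioo 0 T, a' t • F t := by
  have hIcc : Set.Icc 0 R ⊆ Set.Ico 0 T := fun t ht => ⟨ht.1, ht.2.trans_lt hR⟩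
  have key : ∀ {c : ℝ → ℝ} {f : ℝ → ℂ}, (∀ t, R ≤ t → c t = 0) →
      ∫ t in Set.Ioo 0 T, c t • f t = ∫ t in (0 : ℝ)..R, (c t : ℂ) * f t := by
    intro c f hc
    rw [intervalIntegral.integral_of_le hR0]
    refine setIntegral_eq_of_subset_of_forall_sdiff_eq_zero (s := Set.Ioc 0 R)
      measurableSet_Ioo (fun t ht => ⟨ht.1, ht.2.trans_lt hR⟩) (fun t ht => ?_)
    have : R ≤ t := by
      by_contra h
      exact ht.2 ⟨ht.1.1, (not_le.1 h).le⟩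
    simp [hc t this]
  have hac : Continuous fun t => (a t : ℂ) :=
    Complex.continuous_ofReal.comp (continuous_iff_continuousAt.2 fun t => (ha t).continuousAt)
  rw [key h0, key h0', intervalIntegral.integral_mul_deriv_eq_deriv_mul_of_hasDerivAt
    (u := fun t => (a t : ℂ)) (v := F) (u' := fun t => (a' t : ℂ)) (v' := V)]
  · simp [h0 R le_rfl]
  · exact hac.continuousOn
  · rw [Set.uIcc_of_le hR0]; exact hF.mono hIcc
  · exact fun t _ => (ha t).ofReal_comp
  · intro t ht
    rw [min_eq_left hR0, max_eq_right hR0] at ht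
    exact hd t ⟨ht.1, ht.2.trans hR⟩
  · exact (Complex.continuous_ofReal.comp ha').intervalIntegrable _ _
  · refine ContinuousOn.intervalIntegrable ?_
    rw [Set.uIcc_of_le hR0]; exact hV.mono hIcc

/-! ### The test functions -/

/-- The test function `ζ(t / ρ²) H(|x|)`, where `H` is the radial profile at scale `ρ`. -/
def testFunction {d : ℕ} (ψ ζ : ℝ → ℝ) (ρ : ℝ) (z : ℝ × Space d) : ℝ :=
  ζ (z.1 / ρ ^ 2) * profile ψ ζ ρ ‖z.2‖

/-- The adjoint damped wave operator `∂ₜ² - ∂ₜ - Δ` applied to `testFunction`, on `Ω`. -/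
def adjointTest {d : ℕ} (κ : ℝ) (ψ ζ ζ' ζ'' : ℝ → ℝ) (ρ : ℝ) (z : ℝ × Space d) : ℝ :=
  ζ'' (z.1 / ρ ^ 2) / ρ ^ 2 / ρ ^ 2 * profile ψ ζ ρ ‖z.2‖
    - ζ' (z.1 / ρ ^ 2) / ρ ^ 2 * profile ψ ζ ρ ‖z.2‖
    - ζ (z.1 / ρ ^ 2) * profileLap d κ ψ ζ' ζ'' ρ ‖z.2‖

theorem hasFDerivAt_norm_of_ne_zero {E : Type*} [NormedAddCommGroup E] [InnerProductSpace ℝ E]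
    {x : E} (hx : x ≠ 0) : HasFDerivAt (fun x : E => ‖x‖) (‖x‖⁻¹ • innerSL ℝ x) x := by
  have h := (hasStrictFDerivAt_norm_sq x).hasFDerivAt.sqrt (by positivity)
  have hn : ‖x‖ ≠ 0 := norm_ne_zero_iff.2 hx
  refine (h.congr_of_eventuallyEq (Eventually.of_forall fun y => ?_)).congr_fderiv ?_
  · simp
  · ext y
    simp
    field_simp

section TestFunction

variable {d : ℕ} {α β κ M σ K ρ T : ℝ} {ψ ζ ζ' ζ'' : ℝ → ℝ}

theorem fderiv_testFunction (hψ : IsWeight d α β ψ κ M) (hζ : IsCutoff ζ ζ' ζ'' σ K)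
    {z : ℝ × Space d} (hz : 1 / 2 < ‖z.2‖) (τ : ℝ) (y : Space d) :
    fderiv ℝ (testFunction ψ ζ ρ) z (τ, y)
      = τ * (ζ' (z.1 / ρ ^ 2) / ρ ^ 2) * profile ψ ζ ρ ‖z.2‖
        + ζ (z.1 / ρ ^ 2) * (profileDeriv d κ ψ ζ ζ' ρ ‖z.2‖ * (‖z.2‖⁻¹ * inner ℝ z.2 y)) := by
  have hx : z.2 ≠ 0 := norm_ne_zero_iff.1 (by linarith)
  have hf : HasFDerivAt (fun z : ℝ × Space d => z.1) (ContinuousLinearMap.fst ℝ ℝ (Space d)) z :=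
    hasFDerivAt_fst
  have hn : HasFDerivAt (fun z : ℝ × Space d => ‖z.2‖)
      ((‖z.2‖⁻¹ • innerSL ℝ z.2) ∘L ContinuousLinearMap.snd ℝ ℝ (Space d)) z :=
    (hasFDerivAt_norm_of_ne_zero hx).comp z hasFDerivAt_snd
  have h1 : HasFDerivAt (fun z : ℝ × Space d => ζ (z.1 / ρ ^ 2)) _ z :=
    (hasDerivAt_comp_div hζ.hasDerivAt (ρ ^ 2) z.1).comp_hasFDerivAt z hf
  have hp : HasDerivAt (profile ψ ζ ρ) (profileDeriv d κ ψ ζ ζ' ρ ‖z.2‖) ‖z.2‖ :=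
    hasDerivAt_profile hψ hζ ρ hz
  have h2 := HasDerivAt.comp_hasFDerivAt z hp hn
  have h3 : HasFDerivAt (testFunction ψ ζ ρ) _ z := h1.mul h2
  rw [h3.fderiv]
  simp
  ring

theorem contDiff_profile_norm (hψ : IsWeight d α β ψ κ M) (hζ : IsCutoff ζ ζ' ζ'' σ K) (ρ : ℝ) :
    ContDiff ℝ 2 (fun x : Space d => profile ψ ζ ρ ‖x‖) := by
  rw [contDiff_iff_contDiffAt]
  intro x
  rcases eq_or_ne x 0 with rfl | hx
  · refine (contDiffAt_const (c := (0 : ℝ))).congr_of_eventuallyEq ?_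
    filter_upwards [Metric.ball_mem_nhds (0 : Space d) (by norm_num : (0 : ℝ) < 1 / 4)] with y hy
    rw [mem_ball_zero_iff] at hy
    simp [profile, originCutoff_eq_zero hy.le]
  · exact (contDiff_profile hψ hζ ρ).contDiffAt.comp x (contDiffAt_norm ℝ hx)

theorem isTestFunction_testFunction (hψ : IsWeight d α β ψ κ M) (hζ : IsCutoff ζ ζ' ζ'' σ K)
    (hρ : 2 ≤ ρ) (hT : ρ ^ 2 < T) : IsTestFunction d α β T (testFunction ψ ζ ρ) := by
  have hρ0 : 0 < ρ := by linarith
  have hsupp : Function.support (testFunction (d := d) ψ ζ ρ)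
      ⊆ Set.Icc (-ρ ^ 2) (ρ ^ 2) ×ˢ Metric.closedBall 0 ρ := by
    intro z hz
    contrapose! hz
    simp only [Set.mem_prod, Set.mem_Icc, Metric.mem_closedBall, dist_zero_right, not_and_or,
      not_le] at hz
    have ht : ρ ^ 2 ≤ |z.1| → testFunction ψ ζ ρ z = 0 := fun h => by
      have : ζ (z.1 / ρ ^ 2) = 0 := hζ.eq_zero _ (by
        rw [abs_div, abs_of_pos (by positivity : 0 < ρ ^ 2)]
        exact (one_le_div (by positivity)).2 h)
      simp [testFunction, this]
    simp only [Function.mem_support, not_not]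
    rcases hz with (h | h) | h
    · exact ht (by linarith [neg_le_abs z.1])
    · exact ht (by linarith [le_abs_self z.1])
    · simp [testFunction, profile_eq_zero hζ hρ0 h.le]
  have hK : IsCompact (Set.Icc (-ρ ^ 2) (ρ ^ 2) ×ˢ Metric.closedBall (0 : Space d) ρ) :=
    isCompact_Icc.prod (isCompact_closedBall _ _)
  have hts : tsupport (testFunction (d := d) ψ ζ ρ) ⊆ _ := closure_minimal hsupp hK.isClosed
  refine ⟨?_, hK.of_isClosed_subset (isClosed_tsupport _) hts,
    fun z hz => ⟨(hts hz).1.2.trans_lt hT, trivial⟩, fun t _ x hx => ?_⟩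
  · exact (hζ.contDiff.comp (contDiff_fst.div_const _)).mul
      ((contDiff_profile_norm hψ hζ ρ).comp contDiff_snd)
  · rw [fderiv_testFunction hψ hζ (by simp only [hx]; norm_num)]
    simp only [testFunction, hx, profile_one hζ hρ, profileDeriv_one hζ hρ, inner_neg_right,
      real_inner_self_eq_norm_sq]
    -- As `ρ ≥ 2`, the spatial cutoff is `1` near the sphere, and the boundary condition reduces to
    -- `α κ = β ψ(1)`.
    linear_combination -ζ (t / ρ ^ 2) * hψ.boundary

theorem memLp_profile_norm (hψ : IsWeight d α β ψ κ M) (hζ : IsCutoff ζ ζ' ζ'' σ K)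
    (hρ : 0 < ρ) {p : ℝ≥0∞} :
    MemLp (fun x : Space d => profile ψ ζ ρ ‖x‖) p (exteriorMeasure d) :=
  memLp_exterior_of_continuousOn (contDiff_profile_norm hψ hζ ρ).continuous.continuousOn
    fun _ hx => profile_eq_zero hζ hρ hx

theorem mapsTo_norm_exterior {d : ℕ} :
    Set.MapsTo (fun x : Space d => ‖x‖) {x | 1 ≤ ‖x‖} (Set.Ioi 0) :=
  fun x hx => lt_of_lt_of_le one_pos (show 1 ≤ ‖x‖ from hx)

theorem memLp_profileLap_norm (hψ : IsWeight d α β ψ κ M) (hζ : IsCutoff ζ ζ' ζ'' σ K)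
    (hρ : 0 < ρ) {p : ℝ≥0∞} :
    MemLp (fun x : Space d => profileLap d κ ψ ζ' ζ'' ρ ‖x‖) p (exteriorMeasure d) :=
  memLp_exterior_of_continuousOn ((continuousOn_profileLap hψ hζ ρ).comp
    continuous_norm.continuousOn mapsTo_norm_exterior) fun _ hx => profileLap_eq_zero hζ hρ hx

theorem memLp_profileDeriv_norm (hψ : IsWeight d α β ψ κ M) (hζ : IsCutoff ζ ζ' ζ'' σ K)
    (hρ : 0 < ρ) {p : ℝ≥0∞} (i : Fin d) :
    MemLp (fun x : Space d => profileDeriv d κ ψ ζ ζ' ρ ‖x‖ * (‖x‖⁻¹ * x i)) p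
      (exteriorMeasure d) :=
  memLp_exterior_of_continuousOn (R := ρ) (((continuousOn_profileDeriv hψ hζ ρ).comp
    continuous_norm.continuousOn mapsTo_norm_exterior).mul
      ((continuous_norm.continuousOn.inv₀ fun _ hx => (mapsTo_norm_exterior hx).ne').mul
        (by fun_prop : Continuous fun x : Space d => x i).continuousOn))
    fun x hx => by simp [profileDeriv_eq_zero hζ hρ hx]

/-! ### Transferring the wave operator to the test function -/

/-- All derivatives move to the test function. The gradient term produces `-Δ` and a sphere integral
with coefficient `κ = (β/α) ψ(1)`, which cancels the boundary form; in the Dirichlet case the trace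
is zero. -/
theorem interiorForm_add_boundaryForm (hd : 2 ≤ d) (hψ : IsWeight d α β ψ κ M)
    (hζ : IsCutoff ζ ζ' ζ'' σ K) (hρ : 2 ≤ ρ) (hT : ρ ^ 2 < T) {u v : ℝ → Space d → ℂ}
    {G : ℝ → Space d → EuclideanSpace ℂ (Fin d)} {g : ℝ → Boundary d → ℂ}
    (hum : JointlyMeasurable T u) (hvm : JointlyMeasurable T v) (hGm : JointlyMeasurable T G)
    (hu : ContinuousInL2 T u) (hG : ContinuousInL2 T G) (hv : ContinuousInL2 T v)
    (huv : HasTimeDerivInL2 T u v) (hH1 : ∀ t ∈ Set.Ico 0 T, MemH1 (u t) (G t))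
    (hbdry : ∀ t ∈ Set.Ico 0 T,
      (α = 0 → MemH10 (u t) (G t)) ∧ (α ≠ 0 → IsTrace (u t) (G t) (g t))) :
    interiorForm T v G (testFunction ψ ζ ρ) + boundaryForm α β T g (testFunction ψ ζ ρ)
      = -(∫ x in exterior d, profile ψ ζ ρ ‖x‖ • u 0 x)
        + ∫ z in Set.Ioo 0 T ×ˢ exterior d,
            adjointTest κ ψ ζ ζ' ζ'' ρ z • u z.1 z.2 := by
  have hρ0 : 0 < ρ := by linarith
  have hρ2 : 0 < ρ ^ 2 := by positivity
  set a : ℝ → ℝ := fun t => ζ (t / ρ ^ 2) with ha_def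
  set a' : ℝ → ℝ := fun t => ζ' (t / ρ ^ 2) / ρ ^ 2 with ha'_def
  set a'' : ℝ → ℝ := fun t => ζ'' (t / ρ ^ 2) / ρ ^ 2 / ρ ^ 2 with ha''_def
  set H : Space d → ℝ := fun x => profile ψ ζ ρ ‖x‖ with hH_def
  set L : Space d → ℝ := fun x => profileLap d κ ψ ζ' ζ'' ρ ‖x‖ with hL_def
  set B : Fin d → Space d → ℝ := fun i x =>
    profileDeriv d κ ψ ζ ζ' ρ ‖x‖ * (‖x‖⁻¹ * x i) with hB_def
  have hH : MemLp H 2 (exteriorMeasure d) := memLp_profile_norm hψ hζ hρ0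
  have hL : MemLp L 2 (exteriorMeasure d) := memLp_profileLap_norm hψ hζ hρ0
  have hB : ∀ i, MemLp (B i) 2 (exteriorMeasure d) := memLp_profileDeriv_norm hψ hζ hρ0
  have hda : ∀ t, HasDerivAt a (a' t) t := hasDerivAt_comp_div hζ.hasDerivAt _
  have hda' : ∀ t, HasDerivAt a' (a'' t) t := fun t =>
    (hasDerivAt_comp_div hζ.hasDerivAt_deriv _ t).div_const _
  have hca : Continuous a := hζ.continuous.comp (continuous_id.div_const _)
  have hca' : Continuous a' := (hζ.continuous_deriv.comp (continuous_id.div_const _)).div_const _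
  have hca'' : Continuous a'' :=
    ((hζ.continuous_deriv2.comp (continuous_id.div_const _)).div_const _).div_const _
  have hlarge : ∀ t, ρ ^ 2 ≤ t → 1 ≤ |t / ρ ^ 2| := fun t ht =>
    ((one_le_div hρ2).2 ht).trans (le_abs_self _)
  have ha0 : ∀ t, ρ ^ 2 ≤ t → a t = 0 := fun t ht => hζ.eq_zero _ (hlarge t ht)
  have ha'0 : ∀ t, ρ ^ 2 ≤ t → a' t = 0 := fun t ht => by
    simp [ha'_def, hζ.deriv_eq_zero' (hlarge t ht)]
  have ha''0 : ∀ t, ρ ^ 2 ≤ t → a'' t = 0 := fun t ht => by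
    simp [ha''_def, hζ.deriv2_eq_zero' (hlarge t ht)]
  -- These two values decide the terms at `t = 0`: the damping term leaves the integral of `H u(0)`,
  -- and the term with `∂ₜu ∂ₜΦ` leaves nothing.
  have ha_zero : a 0 = 1 := by simp [ha_def, hζ.eq_one 0 (by norm_num)]
  have ha'_zero : a' 0 = 0 := by simp [ha'_def, hζ.deriv_eq_zero 0 (by norm_num)]
  have hGi : ∀ i : Fin d, ContinuousInL2 T fun t x => G t x i := fun i =>
    hG.comp (fun b : EuclideanSpace ℂ (Fin d) => b i) (by fun_prop) rfl fun b c => by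
      simpa using PiLp.norm_apply_le (b - c) i
  have hGim : ∀ i : Fin d, JointlyMeasurable T fun t x => G t x i := fun i =>
    (by fun_prop : Continuous fun b : EuclideanSpace ℂ (Fin d) => b i).comp_aestronglyMeasurable hGm
  have hset : MeasurableSet (Set.Ioo 0 T ×ˢ exterior d) :=
    measurableSet_Ioo.prod (measurableSet_exterior d)
  -- the interior form
  have e1 : interiorForm T v G (testFunction ψ ζ ρ)
      = (∑ i, ∫ t in Set.Ioo 0 T, a t • ∫ x in exterior d, B i x • G t x i)
        - (∫ t in Set.Ioo 0 T, a' t • ∫ x in exterior d, H x • v t x)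
        + ∫ t in Set.Ioo 0 T, a t • ∫ x in exterior d, H x • v t x := by
    have i1 : ∀ i, IntegrableOn (fun z : ℝ × Space d => (a z.1 * B i z.2) • G z.1 z.2 i)
        (Set.Ioo 0 T ×ˢ exterior d) := fun i =>
      (hGi i).integrableOn_smul (hGim i) (hB i) hca hT ha0
    have i2 := hv.integrableOn_smul hvm hH hca' hT ha'0
    have i3 := hv.integrableOn_smul hvm hH hca hT ha0
    have i12 : IntegrableOn (fun z : ℝ × Space d => (∑ i, (a z.1 * B i z.2) • G z.1 z.2 i)
        - (a' z.1 * H z.2) • v z.1 z.2) (Set.Ioo 0 T ×ˢ exterior d) :=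
      (integrable_finsetSum _ fun i _ => i1 i).sub i2
    rw [← hv.setIntegral_smul_eq hvm hH hca' hT ha'0, ← hv.setIntegral_smul_eq hvm hH hca hT ha0,
      Finset.sum_congr rfl fun i _ =>
        ((hGi i).setIntegral_smul_eq (hGim i) (hB i) hca hT ha0).symm,
      ← integral_finsetSum _ fun i _ => i1 i,
      ← integral_sub (integrable_finsetSum _ fun i _ => i1 i) i2,
      ← integral_add i12 i3]
    refine setIntegral_congr_fun hset fun z hz => ?_
    have hz' : 1 / 2 < ‖z.2‖ := lt_trans (by norm_num) (show 1 < ‖z.2‖ from hz.2)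
    simp only [fderiv_testFunction hψ hζ hz', EuclideanSpace.inner_single_right, inner_zero_right,
      Complex.real_smul]
    congr 1
    · congr 1
      · refine Finset.sum_congr rfl fun i _ => ?_
        simp [ha_def, hB_def]; ring
      · simp [ha'_def, hH_def]; ring
    · simp [ha_def, hH_def, testFunction]; ring
  -- integration by parts in time
  have e2 : ∀ {c c' : ℝ → ℝ}, (∀ t, HasDerivAt c (c' t) t) → Continuous c' →
      (∀ t, ρ ^ 2 ≤ t → c t = 0) → (∀ t, ρ ^ 2 ≤ t → c' t = 0) →
      ∫ t in Set.Ioo 0 T, c t • ∫ x in exterior d, H x • v t x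
        = -(c 0 • ∫ x in exterior d, H x • u 0 x)
          - ∫ t in Set.Ioo 0 T, c' t • ∫ x in exterior d, H x • u t x :=
    fun hc hc' h0 h0' => integral_deriv_smul_eq hρ2.le hT (hu.continuousOn_pairing hH)
      (hv.continuousOn_pairing hH) (fun t ht => huv.hasDerivAt_pairing hu hv hH ht) hc hc' h0 h0'
  -- integration by parts in space
  have e3 : (∑ i, ∫ t in Set.Ioo 0 T, a t • ∫ x in exterior d, B i x • G t x i)
      + ∫ t in Set.Ioo 0 T, a t • ∫ x in exterior d, L x • u t x
      = -boundaryForm α β T g (testFunction ψ ζ ρ) := by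
    have i1 : ∀ i, IntegrableOn (fun t => a t • ∫ x in exterior d, B i x • G t x i)
        (Set.Ioo 0 T) := fun i => (hGi i).integrableOn_time (hGim i) (hB i) hca hT ha0
    have i2 := hu.integrableOn_time hum hL hca hT ha0
    rw [← integral_finsetSum _ fun i _ => i1 i,
      ← integral_add (integrable_finsetSum _ fun i _ => i1 i) i2]
    have e : ∀ t ∈ Set.Ioo 0 T, (∑ i, a t • ∫ x in exterior d, B i x • G t x i)
        + a t • ∫ x in exterior d, L x • u t x
        = -(a t • ((κ : ℂ) * if α = 0 then 0 else ∫ y, g t y ∂(surfaceMeasure d))) := by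
      intro t ht
      have ht' := Set.Ioo_subset_Ico_self ht
      have := exists_boundary_integral (α := α) (g := g t) (by omega : 1 ≤ d)
        (continuousOn_profileDeriv hψ hζ ρ)
        (continuousOn_profileLap hψ hζ ρ) (fun r hr => hasDerivAt_flux hd hψ hζ ρ hr)
        (fun r hr => profileDeriv_eq_zero hζ hρ0 hr) (fun r hr => profileLap_eq_zero hζ hρ0 hr)
        (hH1 t ht') (hbdry t ht').1 (hbdry t ht').2
      rw [profileDeriv_one hζ hρ] at this
      rw [← Finset.smul_sum, ← smul_add, ← smul_neg, ← this]
    rw [setIntegral_congr_fun measurableSet_Ioo e, integral_neg, neg_inj, boundaryForm]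
    by_cases hα : α = 0
    · simp [hα]
    · simp only [if_neg hα]
      rw [← integral_const_mul]
      refine integral_congr_ae (Eventually.of_forall fun t => ?_)
      have hκ : κ = β / α * ψ 1 := by
        have := hψ.boundary
        field_simp
        linarith
      have hy : ∀ y : Boundary d, testFunction ψ ζ ρ (t, (y : Space d)) = a t * ψ 1 := fun y => by
        have : ‖(y : Space d)‖ = 1 := by simp
        simp [testFunction, this, profile_one hζ hρ, ha_def]
      simp only [hy, integral_mul_const, hκ, Complex.real_smul]
      push_cast
      ring
  -- the adjoint operator
  have e4 : ∫ z in Set.Ioo 0 T ×ˢ exterior d, adjointTest κ ψ ζ ζ' ζ'' ρ z • u z.1 z.2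
      = (∫ t in Set.Ioo 0 T, a'' t • ∫ x in exterior d, H x • u t x)
        - (∫ t in Set.Ioo 0 T, a' t • ∫ x in exterior d, H x • u t x)
        - ∫ t in Set.Ioo 0 T, a t • ∫ x in exterior d, L x • u t x := by
    have i1 := hu.integrableOn_smul hum hH hca'' hT ha''0
    have i2 := hu.integrableOn_smul hum hH hca' hT ha'0
    have i3 := hu.integrableOn_smul hum hL hca hT ha0
    have i12 : IntegrableOn (fun z : ℝ × Space d => (a'' z.1 * H z.2) • u z.1 z.2
        - (a' z.1 * H z.2) • u z.1 z.2) (Set.Ioo 0 T ×ˢ exterior d) := i1.sub i2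
    rw [← hu.setIntegral_smul_eq hum hH hca'' hT ha''0, ← hu.setIntegral_smul_eq hum hH hca' hT ha'0,
      ← hu.setIntegral_smul_eq hum hL hca hT ha0, ← integral_sub i1 i2,
      ← integral_sub i12 i3]
    refine integral_congr_ae (Eventually.of_forall fun z => ?_)
    simp only [adjointTest, ← sub_smul, ha_def, ha'_def, ha''_def, hH_def, hL_def]
  rw [e4, e1, e2 hda hca' ha0 ha'0, e2 hda' hca'' ha'0 ha''0, ha_zero, ha'_zero, one_smul, zero_smul]
  linear_combination e3

end TestFunction

section WeakSolutions

variable {d k : ℕ} {α β κ M σ K ρ T ε : ℝ} {ψ ζ ζ' ζ'' : ℝ → ℝ} {p : Fin k → ℝ}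
  {u₀ u₁ : Fin k → Space d → ℂ} {u : Fin k → ℝ → Space d → ℂ}

/-! ### The weak formulation tested with `testFunction` -/

theorem IsWeakSolution.jointlyMeasurable (h : IsWeakSolution α β p ε u₀ u₁ T u) (l : Fin k) :
    JointlyMeasurable T (u l) := by
  obtain ⟨v, G, g, h⟩ := h
  exact (h l).1.1

theorem IsWeakSolution.locallyIntegrableOn (h : IsWeakSolution α β p ε u₀ u₁ T u) (l : Fin k) :
    LocallyIntegrableOn (fun z : ℝ × Space d => ‖u (cycPred l) z.1 z.2‖ ^ (p l))
        (Set.Ico 0 T ×ˢ closure (exterior d)) volume := by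
  obtain ⟨v, G, g, h⟩ := h
  exact (h l).2.2.2.1

/-- The data enter as the sum `u₀ + u₁`: `u₁` comes from the weak formulation and `u₀` from
integrating the damping term by parts in time. -/
theorem IsWeakSolution.integral_adjointTest (hd : 2 ≤ d) (hψ : IsWeight d α β ψ κ M)
    (hζ : IsCutoff ζ ζ' ζ'' σ K) (hρ : 2 ≤ ρ) (hT : ρ ^ 2 < T) (hε : ε ≠ 0)
    (hu₁ : ∀ l, MemLp (u₁ l) 2 (exteriorMeasure d))
    (h : IsWeakSolution α β p ε u₀ u₁ T u) (l : Fin k) :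
    ((∫ z in Set.Ioo 0 T ×ˢ exterior d,
        ‖u (cycPred l) z.1 z.2‖ ^ (p l) * testFunction ψ ζ ρ z : ℝ) : ℂ)
      + (ε : ℂ) * ∫ x in exterior d, profile ψ ζ ρ ‖x‖ • (u₀ l x + u₁ l x)
      = ∫ z in Set.Ioo 0 T ×ˢ exterior d, adjointTest κ ψ ζ ζ' ζ'' ρ z • u l z.1 z.2 := by
  have hρ0 : 0 < ρ := by linarith
  have hT0 : 0 < T := lt_of_le_of_lt (sq_nonneg ρ) hT
  obtain ⟨v, G, g, h⟩ := h
  obtain ⟨⟨hum, hvm, hGm⟩, ⟨hu, hG, hv, huv, hH1⟩, hb, -, h0, hweak⟩ := h l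
  have hw := hweak _ (isTestFunction_testFunction hψ hζ hρ hT)
  rw [interiorForm_add_boundaryForm hd hψ hζ hρ hT hum hvm hGm hu hG hv huv hH1 hb] at hw
  have hH : MemLp (fun x : Space d => profile ψ ζ ρ ‖x‖) 2 (exteriorMeasure d) :=
    memLp_profile_norm hψ hζ hρ0
  have hΦ0 : ∀ x : Space d, testFunction ψ ζ ρ ((0 : ℝ), x) = profile ψ ζ ρ ‖x‖ := fun x => by
    simp [testFunction, hζ.eq_one 0 (by norm_num)]
  have hεc : (ε : ℂ) ≠ 0 := by exact_mod_cast hε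
  have i1 : IntegrableOn (fun x => profile ψ ζ ρ ‖x‖ • u₁ l x) (exterior d) :=
    hH.integrable_real_smul (hu₁ l)
  -- Square integrability of `u₀` is inherited from the solution at time `0`, where it equals `ε u₀`
  -- with `ε ≠ 0`.
  have hu0 : MemLp (fun x => u₀ l x) 2 (exteriorMeasure d) := by
    refine ((hu.1 0 ⟨le_rfl, hT0⟩).const_smul ((ε : ℂ)⁻¹)).ae_eq ?_
    filter_upwards [h0] with x hx
    simp only [Pi.smul_apply, hx, smul_eq_mul]
    field_simp
  have i0 : IntegrableOn (fun x => profile ψ ζ ρ ‖x‖ • u₀ l x) (exterior d) :=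
    hH.integrable_real_smul hu0
  have e0 : ∫ x in exterior d, profile ψ ζ ρ ‖x‖ • u l 0 x
      = (ε : ℂ) * ∫ x in exterior d, profile ψ ζ ρ ‖x‖ • u₀ l x := by
    rw [← integral_const_mul]
    refine integral_congr_ae ?_
    filter_upwards [h0] with x hx
    rw [hx, mul_smul_comm]
  have e1 : ∫ x in exterior d, u₁ l x * ((testFunction ψ ζ ρ ((0 : ℝ), x) : ℝ) : ℂ)
      = ∫ x in exterior d, profile ψ ζ ρ ‖x‖ • u₁ l x := by
    refine integral_congr_ae (Eventually.of_forall fun x => ?_)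
    simp only [hΦ0, Complex.real_smul, mul_comm]
  have e2 : ∫ x in exterior d, profile ψ ζ ρ ‖x‖ • (u₀ l x + u₁ l x)
      = (∫ x in exterior d, profile ψ ζ ρ ‖x‖ • u₀ l x)
        + ∫ x in exterior d, profile ψ ζ ρ ‖x‖ • u₁ l x := by
    rw [← integral_add i0 i1]
    simp only [smul_add]
  rw [e0, e1, integral_complex_ofReal] at hw
  rw [e2]
  linear_combination hw

/-! ### Pointwise bounds -/

theorem testFunction_eq {z : ℝ × Space d} (hz : 1 / 2 ≤ ‖z.2‖) :
    testFunction ψ ζ ρ z = ψ ‖z.2‖ * (ζ (z.1 / ρ ^ 2) * ζ (‖z.2‖ / ρ)) := by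
  rw [testFunction, profile_eq hz]; ring

/-- The parabolic cylinder `{t ≤ ρ², |x| ≤ ρ}`. -/
def cylinder (d : ℕ) (ρ : ℝ) : Set (ℝ × Space d) := {z | z.1 ≤ ρ ^ 2 ∧ ‖z.2‖ ≤ ρ}

theorem measurableSet_cylinder (d : ℕ) (ρ : ℝ) : MeasurableSet (cylinder d ρ) :=
  ((isClosed_le continuous_fst continuous_const).inter
    (isClosed_le (continuous_norm.comp continuous_snd) continuous_const)).measurableSet

theorem testFunction_eq_zero_of_notMem (hζ : IsCutoff ζ ζ' ζ'' σ K) (hρ : 0 < ρ)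
    {z : ℝ × Space d} (hz : z ∉ cylinder d ρ) : testFunction ψ ζ ρ z = 0 := by
  simp only [cylinder, Set.mem_ofPred_eq, not_and_or, not_le] at hz
  rcases hz with h | h
  · have : ζ (z.1 / ρ ^ 2) = 0 :=
      hζ.eq_zero _ (((one_le_div (by positivity)).2 h.le).trans (le_abs_self _))
    simp [testFunction, this]
  · simp [testFunction, profile_eq_zero hζ hρ h.le]

theorem adjointTest_eq_zero_of_notMem (hζ : IsCutoff ζ ζ' ζ'' σ K) (hρ : 0 < ρ)
    {z : ℝ × Space d} (hz : z ∉ cylinder d ρ) : adjointTest κ ψ ζ ζ' ζ'' ρ z = 0 := by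
  simp only [cylinder, Set.mem_ofPred_eq, not_and_or, not_le] at hz
  rcases hz with h | h
  · have h1 : 1 ≤ |z.1 / ρ ^ 2| :=
      ((one_le_div (by positivity)).2 h.le).trans (le_abs_self _)
    simp [adjointTest, hζ.eq_zero _ h1, hζ.deriv_eq_zero' h1, hζ.deriv2_eq_zero' h1]
  · simp [adjointTest, profile_eq_zero hζ hρ h.le, profileLap_eq_zero hζ hρ h.le]

theorem abs_div_lt_of_mem_cylinder (hρ : 0 < ρ) {z : ℝ × Space d} (h0 : 0 ≤ z.1)
    (hz : z ∈ cylinder d (ρ / 2)) : |z.1 / ρ ^ 2| < 3 / 4 ∧ |‖z.2‖ / ρ| < 3 / 4 := by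
  obtain ⟨h1, h2⟩ := hz
  have : 0 < ρ ^ 2 := by positivity
  constructor
  · rw [abs_of_nonneg (by positivity), div_lt_iff₀ (by positivity)]
    have : (ρ / 2) ^ 2 = ρ ^ 2 / 4 := by ring
    linarith
  · rw [abs_of_nonneg (by positivity), div_lt_iff₀ hρ]; linarith

theorem testFunction_eq_of_mem (hζ : IsCutoff ζ ζ' ζ'' σ K) (hρ : 0 < ρ) {z : ℝ × Space d}
    (h0 : 0 ≤ z.1) (h1 : 1 / 2 ≤ ‖z.2‖) (hz : z ∈ cylinder d (ρ / 2)) :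
    testFunction ψ ζ ρ z = ψ ‖z.2‖ := by
  obtain ⟨h2, h3⟩ := abs_div_lt_of_mem_cylinder hρ h0 hz
  rw [testFunction_eq h1, hζ.eq_one _ h2.le, hζ.eq_one _ h3.le]; ring

theorem adjointTest_eq_zero_of_mem (hζ : IsCutoff ζ ζ' ζ'' σ K) (hρ : 0 < ρ) {z : ℝ × Space d}
    (h0 : 0 ≤ z.1) (hz : z ∈ cylinder d (ρ / 2)) : adjointTest κ ψ ζ ζ' ζ'' ρ z = 0 := by
  obtain ⟨h2, h3⟩ := abs_div_lt_of_mem_cylinder hρ h0 hz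
  simp [adjointTest, hζ.deriv_eq_zero _ h2, hζ.deriv2_eq_zero _ h2,
    profileLap_eq_zero_of_le hζ hρ (norm_nonneg _) hz.2]

theorem testFunction_nonneg (hψ : IsWeight d α β ψ κ M) (hζ : IsCutoff ζ ζ' ζ'' σ K)
    {z : ℝ × Space d} (hz : 1 ≤ ‖z.2‖) : 0 ≤ testFunction ψ ζ ρ z := by
  rw [testFunction_eq (by linarith)]
  exact mul_nonneg (hψ.nonneg _ hz) (mul_nonneg (hζ.nonneg _) (hζ.nonneg _))

theorem testFunction_le (hψ : IsWeight d α β ψ κ M) (hζ : IsCutoff ζ ζ' ζ'' σ K)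
    {z : ℝ × Space d} (hz : 1 ≤ ‖z.2‖) : testFunction ψ ζ ρ z ≤ ψ ‖z.2‖ := by
  rw [testFunction_eq (by linarith)]
  exact mul_le_of_le_one_right (hψ.nonneg _ hz)
    (mul_le_one₀ (hζ.le_one _) (hζ.nonneg _) (hζ.le_one _))

/-- The parabolic scaling balances the damping term and the Laplacian at `ρ⁻²`; the second time
derivative is smaller, `ρ⁻⁴`. Since `x ≤ x ^ σ` on `[0, 1]`, an undifferentiated cutoff also obeys
the bound. -/
theorem abs_adjointTest_le (hd : 2 ≤ d) (hψ : IsWeight d α β ψ κ M)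
    (hζ : IsCutoff ζ ζ' ζ'' σ K) (hσ : σ ≤ 1) (hρ : 4 ≤ ρ) {z : ℝ × Space d} (hz : 1 ≤ ‖z.2‖) :
    |adjointTest κ ψ ζ ζ' ζ'' ρ z| ≤ (4 * M + 2 * d + 2) * K / ρ ^ 2 *
      (ψ ‖z.2‖ * (ζ (z.1 / ρ ^ 2) * ζ (‖z.2‖ / ρ)) ^ σ) := by
  have hρ0 : 0 < ρ := by linarith
  have hρ1 : 1 ≤ ρ ^ 2 := by nlinarith
  have hψ0 := hψ.nonneg _ hz
  have hM := hψ.bound_nonneg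
  have hK := hζ.bound_nonneg
  rw [adjointTest, profile_eq (by linarith)]
  set s := ζ (z.1 / ρ ^ 2) with hs
  set r := ζ (‖z.2‖ / ρ) with hr
  have hs0 : 0 ≤ s := hζ.nonneg _
  have hr0 : 0 ≤ r := hζ.nonneg _
  have hle : ∀ x : ℝ, 0 ≤ x → x ≤ 1 → x ≤ x ^ σ := fun x h0 h1 => by
    rcases h0.eq_or_lt with rfl | h0
    · exact Real.rpow_nonneg le_rfl _
    · simpa using Real.rpow_le_rpow_of_exponent_ge h0 h1 hσ
  have hsσ : s ≤ s ^ σ := hle s hs0 (hζ.le_one _)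
  have hrσ : r ≤ r ^ σ := hle r hr0 (hζ.le_one _)
  have hsσ0 : 0 ≤ s ^ σ := Real.rpow_nonneg hs0 _
  have hrσ0 : 0 ≤ r ^ σ := Real.rpow_nonneg hr0 _
  rw [Real.mul_rpow hs0 hr0]
  have b1 : |ζ'' (z.1 / ρ ^ 2) / ρ ^ 2 / ρ ^ 2 * (ψ ‖z.2‖ * r)|
      ≤ K * s ^ σ / ρ ^ 2 * (ψ ‖z.2‖ * r ^ σ) := by
    rw [abs_mul, abs_div, abs_div, abs_of_pos (by positivity : 0 < ρ ^ 2),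
      abs_of_nonneg (mul_nonneg hψ0 hr0)]
    have h1 : |ζ'' (z.1 / ρ ^ 2)| / ρ ^ 2 / ρ ^ 2 ≤ K * s ^ σ / ρ ^ 2 := by
      rw [div_le_div_iff_of_pos_right (by positivity)]
      exact (div_le_self (abs_nonneg _) hρ1).trans (hζ.abs_deriv2_le _)
    gcongr
  have b2 : |ζ' (z.1 / ρ ^ 2) / ρ ^ 2 * (ψ ‖z.2‖ * r)|
      ≤ K * s ^ σ / ρ ^ 2 * (ψ ‖z.2‖ * r ^ σ) := by
    rw [abs_mul, abs_div, abs_of_pos (by positivity : 0 < ρ ^ 2),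
      abs_of_nonneg (mul_nonneg hψ0 hr0)]
    have := hζ.abs_deriv_le (z.1 / ρ ^ 2)
    gcongr
  have b3 : |s * profileLap d κ ψ ζ' ζ'' ρ ‖z.2‖|
      ≤ s ^ σ * ((4 * M + 2 * d) * K / ρ ^ 2 * (ψ ‖z.2‖ * r ^ σ)) := by
    rw [abs_mul, abs_of_nonneg hs0]
    exact mul_le_mul hsσ (abs_profileLap_le hd hψ hζ hρ hz) (abs_nonneg _) hsσ0
  have e : (4 * M + 2 * d + 2) * K / ρ ^ 2 * (ψ ‖z.2‖ * (s ^ σ * r ^ σ))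
      = K * s ^ σ / ρ ^ 2 * (ψ ‖z.2‖ * r ^ σ) + K * s ^ σ / ρ ^ 2 * (ψ ‖z.2‖ * r ^ σ)
        + s ^ σ * ((4 * M + 2 * d) * K / ρ ^ 2 * (ψ ‖z.2‖ * r ^ σ)) := by ring
  rw [e]
  exact (abs_sub _ _).trans (add_le_add ((abs_sub _ _).trans (add_le_add b1 b2)) b3)

/-! ### Integrability of the nonlinear terms -/

theorem le_norm_subset_closure_exterior (d : ℕ) : {x : Space d | 1 ≤ ‖x‖} ⊆ closure (exterior d) := by
  intro x hx
  have h1 : (1 : ℝ) ∈ closure (Set.Ioi (1 : ℝ)) := by simp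
  have hc : ContinuousWithinAt (fun t : ℝ => t • x) (Set.Ioi 1) 1 :=
    (by fun_prop : Continuous fun t : ℝ => t • x).continuousWithinAt
  simpa using hc.mem_closure h1 (t := exterior d) fun t ht => by
    have ht1 : (1 : ℝ) < t := ht
    have hx1 : 1 ≤ ‖x‖ := hx
    simp only [exterior, Set.mem_ofPred_eq, norm_smul, Real.norm_eq_abs,
      abs_of_pos (by linarith : 0 < t)]
    nlinarith

/-- The part of the cylinder at scale `ρ` inside `(0,T) × Ω`. -/
def exteriorCylinder (d : ℕ) (T ρ : ℝ) : Set (ℝ × Space d) :=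
  (Set.Ioo 0 T ×ˢ exterior d) ∩ cylinder d ρ

theorem measurableSet_exteriorCylinder (d : ℕ) (T ρ : ℝ) :
    MeasurableSet (exteriorCylinder d T ρ) :=
  (measurableSet_Ioo.prod (measurableSet_exterior d)).inter (measurableSet_cylinder d ρ)

theorem exteriorCylinder_subset_compact (d : ℕ) (T ρ : ℝ) : exteriorCylinder d T ρ ⊆
    Set.Icc 0 (ρ ^ 2) ×ˢ ({x : Space d | 1 ≤ ‖x‖} ∩ Metric.closedBall 0 ρ) :=
  fun z hz => ⟨⟨hz.1.1.1.le, hz.2.1⟩, show 1 ≤ ‖z.2‖ from le_of_lt hz.1.2, by simpa using hz.2.2⟩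

theorem isCompact_closed_exteriorCylinder (d : ℕ) (ρ : ℝ) : IsCompact
    (Set.Icc 0 (ρ ^ 2) ×ˢ ({x : Space d | 1 ≤ ‖x‖} ∩ Metric.closedBall 0 ρ)) :=
  isCompact_Icc.prod ((isCompact_closedBall _ _).inter_left
    (isClosed_le continuous_const continuous_norm))

/-- For `ρ² < T` the cylinder is contained in a compact subset of `[0,T) × closure Ω`, on which `f`
is integrable and `w` bounded. -/
theorem integrableOn_mul_exteriorCylinder {f w : ℝ × Space d → ℝ}
    (hf : LocallyIntegrableOn f (Set.Ico 0 T ×ˢ closure (exterior d)) volume) (hT : ρ ^ 2 < T)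
    (hw : ContinuousOn w (Set.univ ×ˢ {x : Space d | 1 ≤ ‖x‖})) :
    IntegrableOn (fun z => f z * w z) (exteriorCylinder d T ρ) := by
  have hK := isCompact_closed_exteriorCylinder d ρ
  refine IntegrableOn.mono_set ?_ (exteriorCylinder_subset_compact d T ρ)
  refine IntegrableOn.mul_continuousOn (hf.integrableOn_compact_subset ?_ hK) (hw.mono ?_) hK
  · exact Set.prod_mono (fun t ht => ⟨ht.1, ht.2.trans_lt hT⟩)
      (Set.inter_subset_left.trans (le_norm_subset_closure_exterior d))
  · exact Set.prod_mono (Set.subset_univ _) Set.inter_subset_left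

theorem continuousOn_weight (hψ : IsWeight d α β ψ κ M) :
    ContinuousOn (fun z : ℝ × Space d => ψ ‖z.2‖) (Set.univ ×ˢ {x : Space d | 1 ≤ ‖x‖}) :=
  hψ.contDiffOn.continuousOn.comp (continuous_norm.comp continuous_snd).continuousOn
    fun _ hz => mapsTo_norm_exterior hz.2

theorem continuous_testFunction (hψ : IsWeight d α β ψ κ M) (hζ : IsCutoff ζ ζ' ζ'' σ K) :
    Continuous (testFunction (d := d) ψ ζ ρ) :=
  (hζ.continuous.comp (continuous_fst.div_const _)).mul
    ((contDiff_profile_norm hψ hζ ρ).continuous.comp continuous_snd)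

theorem integrableOn_mul_testFunction (hψ : IsWeight d α β ψ κ M) (hζ : IsCutoff ζ ζ' ζ'' σ K)
    (hρ : 0 < ρ) (hT : ρ ^ 2 < T) {f : ℝ × Space d → ℝ}
    (hf : LocallyIntegrableOn f (Set.Ico 0 T ×ˢ closure (exterior d)) volume) :
    IntegrableOn (fun z => f z * testFunction ψ ζ ρ z) (Set.Ioo 0 T ×ˢ exterior d) := by
  refine (integrableOn_mul_exteriorCylinder hf hT
    (continuous_testFunction hψ hζ).continuousOn).of_forall_sdiff_eq_zero
    (measurableSet_Ioo.prod (measurableSet_exterior d)) fun z hz => ?_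
  rw [testFunction_eq_zero_of_notMem hζ hρ fun h => hz.2 ⟨hz.1, h⟩, mul_zero]

end WeakSolutions

section Masses

/-! ### A weighted Hölder inequality -/

/-- Hölder applied to the factorisation `w φ θ^{1/p} = (w (φ θ)^{1/p}) · φ^{1/q}`, where `1/q = 1 -
1/p`. The integrability is part of the conclusion because the comparison of integrals in the key
estimate needs it. -/
theorem weighted_holder {X : Type*} [MeasurableSpace X] {μ : Measure X} {p : ℝ} (hp : 1 < p)
    {w φ θ : X → ℝ} (hw : AEStronglyMeasurable w μ) (hφ : AEStronglyMeasurable φ μ)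
    (hθ : AEStronglyMeasurable θ μ) (hw0 : 0 ≤ᵐ[μ] w) (hφ0 : 0 ≤ᵐ[μ] φ) (hθ0 : 0 ≤ᵐ[μ] θ)
    (hφi : Integrable φ μ) (hwi : Integrable (fun x => w x ^ p * (φ x * θ x)) μ) :
    Integrable (fun x => w x * (φ x * θ x ^ p⁻¹)) μ ∧
    ∫ x, w x * (φ x * θ x ^ p⁻¹) ∂μ
      ≤ (∫ x, w x ^ p * (φ x * θ x) ∂μ) ^ p⁻¹ * (∫ x, φ x ∂μ) ^ (1 - p⁻¹) := by
  have hp0 : 0 < p := by linarith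
  have hpq := Real.HolderConjugate.conjExponent hp
  set q := p.conjExponent with hq
  have hq0 : 0 < q := hpq.symm.pos
  have hqi : q⁻¹ = 1 - p⁻¹ := by have := hpq.inv_add_inv_eq_one; linarith
  set f : X → ℝ := fun x => w x * (φ x * θ x) ^ p⁻¹ with hf
  set g : X → ℝ := fun x => φ x ^ q⁻¹ with hg
  have hfm : AEStronglyMeasurable f μ :=
    hw.mul ((hφ.mul hθ).aemeasurable.pow_const _).aestronglyMeasurable
  have hgm : AEStronglyMeasurable g μ := (hφ.aemeasurable.pow_const _).aestronglyMeasurable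
  have hf0 : 0 ≤ᵐ[μ] f := by
    filter_upwards [hw0, hφ0, hθ0] with x h1 h2 h3
    exact mul_nonneg h1 (Real.rpow_nonneg (mul_nonneg h2 h3) _)
  have hg0 : 0 ≤ᵐ[μ] g := by
    filter_upwards [hφ0] with x h2
    exact Real.rpow_nonneg h2 _
  have hfp : ∀ᵐ x ∂μ, f x ^ p = w x ^ p * (φ x * θ x) := by
    filter_upwards [hw0, hφ0, hθ0] with x h1 h2 h3
    rw [hf, Real.mul_rpow h1 (Real.rpow_nonneg (mul_nonneg h2 h3) _),
      Real.rpow_inv_rpow (mul_nonneg h2 h3) hp0.ne']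
  have hgq : ∀ᵐ x ∂μ, g x ^ q = φ x := by
    filter_upwards [hφ0] with x h2
    rw [hg, Real.rpow_inv_rpow h2 hq0.ne']
  have hfg : ∀ᵐ x ∂μ, f x * g x = w x * (φ x * θ x ^ p⁻¹) := by
    filter_upwards [hw0, hφ0, hθ0] with x h1 h2 h3
    have : φ x ^ p⁻¹ * φ x ^ q⁻¹ = φ x := by
      rw [← Real.rpow_add_of_nonneg h2 (by positivity) (by positivity), hpq.inv_add_inv_eq_one,
        Real.rpow_one]
    calc f x * g x = w x * ((φ x ^ p⁻¹ * φ x ^ q⁻¹) * θ x ^ p⁻¹) := by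
          rw [hf, hg]; simp only; rw [Real.mul_rpow h2 h3]; ring
      _ = _ := by rw [this]
  have hfL : MemLp f (ENNReal.ofReal p) μ := by
    rw [← integrable_norm_rpow_iff hfm (by simpa using hp0) ENNReal.ofReal_ne_top,
      ENNReal.toReal_ofReal hp0.le]
    refine hwi.congr ?_
    filter_upwards [hfp, hf0] with x h1 h2
    rw [Real.norm_of_nonneg h2, h1]
  have hgL : MemLp g (ENNReal.ofReal q) μ := by
    rw [← integrable_norm_rpow_iff hgm (by simpa using hq0) ENNReal.ofReal_ne_top,
      ENNReal.toReal_ofReal hq0.le]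
    refine hφi.congr ?_
    filter_upwards [hgq, hg0] with x h1 h2
    rw [Real.norm_of_nonneg h2, h1]
  have : ENNReal.HolderTriple (ENNReal.ofReal p) (ENNReal.ofReal q) 1 := by
    have := hpq.ennrealOfReal
    exact this
  refine ⟨(hfL.integrable_mul hgL).congr hfg, ?_⟩
  have h := integral_mul_le_Lp_mul_Lq_of_nonneg hpq hf0 hg0 hfL hgL
  rwa [integral_congr_ae hfg, integral_congr_ae hfp, integral_congr_ae hgq, one_div, one_div,
    hqi] at h

/-! ### The functionals controlling the lifespan -/

variable {d k : ℕ} {α β κ M σ K ρ T ε : ℝ} {ψ ζ ζ' ζ'' : ℝ → ℝ} {p : Fin k → ℝ}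
  {u₀ u₁ : Fin k → Space d → ℂ} {u : Fin k → ℝ → Space d → ℂ}

/-- The integral of the `l`-th nonlinearity against the test function at scale `ρ`. -/
def totalMass (p : Fin k → ℝ) (ψ ζ : ℝ → ℝ) (T : ℝ) (u : Fin k → ℝ → Space d → ℂ) (l : Fin k)
    (ρ : ℝ) : ℝ :=
  ∫ z in Set.Ioo 0 T ×ˢ exterior d, ‖u (cycPred l) z.1 z.2‖ ^ (p l) * testFunction ψ ζ ρ z

/-- The part of `totalMass` outside the cylinder at scale `ρ / 2`. -/
def annulusMass (p : Fin k → ℝ) (ψ ζ : ℝ → ℝ) (T : ℝ) (u : Fin k → ℝ → Space d → ℂ) (l : Fin k)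
    (ρ : ℝ) : ℝ :=
  ∫ z in (Set.Ioo 0 T ×ˢ exterior d) \ cylinder d (ρ / 2),
    ‖u (cycPred l) z.1 z.2‖ ^ (p l) * testFunction ψ ζ ρ z

/-- The integral of the `l`-th nonlinearity over the cylinder at scale `ρ`, with weight `ψ`. -/
def cylinderMass (p : Fin k → ℝ) (ψ : ℝ → ℝ) (T : ℝ) (u : Fin k → ℝ → Space d → ℂ) (l : Fin k)
    (ρ : ℝ) : ℝ :=
  ∫ z in exteriorCylinder d T ρ, ‖u (cycPred l) z.1 z.2‖ ^ (p l) * ψ ‖z.2‖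

/-! ### Comparison of the mass functionals -/

theorem mul_testFunction_nonneg (hψ : IsWeight d α β ψ κ M) (hζ : IsCutoff ζ ζ' ζ'' σ K)
    (l : Fin k) {z : ℝ × Space d} (hz : z ∈ Set.Ioo 0 T ×ˢ exterior d) :
    0 ≤ ‖u (cycPred l) z.1 z.2‖ ^ (p l) * testFunction ψ ζ ρ z :=
  mul_nonneg (Real.rpow_nonneg (norm_nonneg _) _)
    (testFunction_nonneg hψ hζ (le_of_lt (show 1 < ‖z.2‖ from hz.2)))

theorem measurableSet_spacetime (d : ℕ) (T : ℝ) :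
    MeasurableSet (Set.Ioo 0 T ×ˢ exterior d) :=
  measurableSet_Ioo.prod (measurableSet_exterior d)

theorem annulusMass_nonneg (hψ : IsWeight d α β ψ κ M) (hζ : IsCutoff ζ ζ' ζ'' σ K)
    (l : Fin k) : 0 ≤ annulusMass p ψ ζ T u l ρ :=
  setIntegral_nonneg ((measurableSet_spacetime d T).diff (measurableSet_cylinder d _))
    fun _ hz => mul_testFunction_nonneg hψ hζ l hz.1

theorem cylinderMass_nonneg (hψ : IsWeight d α β ψ κ M) (l : Fin k) :
    0 ≤ cylinderMass p ψ T u l ρ :=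
  setIntegral_nonneg (measurableSet_exteriorCylinder d T ρ) fun z hz =>
    mul_nonneg (Real.rpow_nonneg (norm_nonneg _) _)
      (hψ.nonneg _ (le_of_lt (show 1 < ‖z.2‖ from hz.1.2)))

theorem integrableOn_nonlinearity_mul_testFunction (hψ : IsWeight d α β ψ κ M) (hζ : IsCutoff ζ ζ' ζ'' σ K)
    (hρ : 0 < ρ) (hT : ρ ^ 2 < T) (h : IsWeakSolution α β p ε u₀ u₁ T u) (l : Fin k) :
    IntegrableOn (fun z => ‖u (cycPred l) z.1 z.2‖ ^ (p l) * testFunction ψ ζ ρ z)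
      (Set.Ioo 0 T ×ˢ exterior d) :=
  integrableOn_mul_testFunction hψ hζ hρ hT (h.locallyIntegrableOn l)

theorem annulusMass_le_totalMass (hψ : IsWeight d α β ψ κ M) (hζ : IsCutoff ζ ζ' ζ'' σ K)
    (hρ : 0 < ρ) (hT : ρ ^ 2 < T) (h : IsWeakSolution α β p ε u₀ u₁ T u) (l : Fin k) :
    annulusMass p ψ ζ T u l ρ ≤ totalMass p ψ ζ T u l ρ :=
  setIntegral_mono_set (integrableOn_nonlinearity_mul_testFunction hψ hζ hρ hT h l)
    ((ae_restrict_iff' (measurableSet_spacetime d T)).2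
      (Eventually.of_forall fun _ hz => mul_testFunction_nonneg hψ hζ l hz))
    (Eventually.of_forall fun _ hz => hz.1)

theorem cylinderMass_le_totalMass (hψ : IsWeight d α β ψ κ M) (hζ : IsCutoff ζ ζ' ζ'' σ K)
    (hρ : 0 < ρ) (hT : ρ ^ 2 < T) (h : IsWeakSolution α β p ε u₀ u₁ T u) (l : Fin k) :
    cylinderMass p ψ T u l (ρ / 2) ≤ totalMass p ψ ζ T u l ρ := by
  have e : cylinderMass p ψ T u l (ρ / 2) = ∫ z in exteriorCylinder d T (ρ / 2),
      ‖u (cycPred l) z.1 z.2‖ ^ (p l) * testFunction ψ ζ ρ z :=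
    setIntegral_congr_fun (measurableSet_exteriorCylinder d T _) fun z hz => by
      have h1 : 1 < ‖z.2‖ := hz.1.2
      simp only [testFunction_eq_of_mem hζ hρ hz.1.1.1.le (by linarith) hz.2]
  rw [e]
  exact setIntegral_mono_set (integrableOn_nonlinearity_mul_testFunction hψ hζ hρ hT h l)
    ((ae_restrict_iff' (measurableSet_spacetime d T)).2
      (Eventually.of_forall fun _ hz => mul_testFunction_nonneg hψ hζ l hz))
    (Eventually.of_forall fun _ hz => hz.1)

theorem annulusMass_eq (hζ : IsCutoff ζ ζ' ζ'' σ K) (hρ : 0 < ρ) (l : Fin k) :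
    annulusMass p ψ ζ T u l ρ =
    ∫ z in exteriorCylinder d T ρ \ cylinder d (ρ / 2),
      ‖u (cycPred l) z.1 z.2‖ ^ (p l) * testFunction ψ ζ ρ z := by
  refine setIntegral_eq_of_subset_of_forall_sdiff_eq_zero
    ((measurableSet_spacetime d T).diff (measurableSet_cylinder d _))
    (fun z hz => ⟨hz.1.1, hz.2⟩) fun z hz => ?_
  rw [testFunction_eq_zero_of_notMem hζ hρ fun hc => hz.2 ⟨⟨hz.1.1, hc⟩, hz.1.2⟩, mul_zero]

/-- The test function is at most `ψ`, and the annulus is the difference of two cylinders. This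
increment drives the critical case. -/
theorem annulusMass_le_sub (hψ : IsWeight d α β ψ κ M) (hζ : IsCutoff ζ ζ' ζ'' σ K)
    (hρ : 0 < ρ) (hT : ρ ^ 2 < T) (h : IsWeakSolution α β p ε u₀ u₁ T u) (l : Fin k) :
    annulusMass p ψ ζ T u l ρ
    ≤ cylinderMass p ψ T u l ρ - cylinderMass p ψ T u l (ρ / 2) := by
  have hi : IntegrableOn (fun z : ℝ × Space d => ‖u (cycPred l) z.1 z.2‖ ^ (p l) * ψ ‖z.2‖)
      (exteriorCylinder d T ρ) :=
    integrableOn_mul_exteriorCylinder (h.locallyIntegrableOn l) hT (continuousOn_weight hψ)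
  have hsub : exteriorCylinder d T (ρ / 2) ⊆ exteriorCylinder d T ρ := fun z hz =>
    ⟨hz.1, hz.2.1.trans (by nlinarith), hz.2.2.trans (by linarith)⟩
  have hdiff : exteriorCylinder d T ρ \ exteriorCylinder d T (ρ / 2)
      = exteriorCylinder d T ρ \ cylinder d (ρ / 2) := by
    ext z
    exact ⟨fun hz => ⟨hz.1, fun hc => hz.2 ⟨hz.1.1, hc⟩⟩, fun hz => ⟨hz.1, fun hc => hz.2 hc.2⟩⟩
  rw [annulusMass_eq hζ hρ l, cylinderMass, cylinderMass,
    ← setIntegral_sdiff (measurableSet_exteriorCylinder d T _) hi hsub, hdiff]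
  refine setIntegral_mono_on ?_ (hi.mono_set Set.sdiff_subset)
    ((measurableSet_exteriorCylinder d T ρ).diff (measurableSet_cylinder d _)) fun z hz => ?_
  · exact (integrableOn_nonlinearity_mul_testFunction hψ hζ hρ hT h l).mono_set
      fun z hz => hz.1.1
  · have h1 : 1 ≤ ‖z.2‖ := le_of_lt hz.1.1.2
    exact mul_le_mul_of_nonneg_left (testFunction_le hψ hζ h1) (Real.rpow_nonneg (norm_nonneg _) _)

/-- The factor `ρ^{d+2}` is the parabolic volume: `ρ²` in time and `ρ^d` in space. -/
theorem integral_weight_exteriorCylinder_le (hψ : IsWeight d α β ψ κ M) (hρ1 : 1 ≤ ρ) {m : ℝ}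
    (hm : ∀ r, 1 ≤ r → r ≤ ρ → ψ r ≤ m) :
    ∫ z in exteriorCylinder d T ρ \ cylinder d (ρ / 2), ψ ‖z.2‖
      ≤ m * (volume.real (Metric.closedBall (0 : Space d) 1) * ρ ^ (d + 2)) := by
  have hρ : 0 < ρ := by linarith
  have hvol : volume.real (Set.Icc 0 (ρ ^ 2) ×ˢ Metric.closedBall (0 : Space d) ρ)
      = volume.real (Metric.closedBall (0 : Space d) 1) * ρ ^ (d + 2) := by
    rw [Measure.volume_eq_prod, measureReal_prod_prod,
      Measure.addHaar_real_closedBall volume (0 : Space d) hρ.le,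
      Measure.addHaar_real_closedBall volume (0 : Space d) zero_le_one]
    simp [max_eq_left (sq_nonneg ρ)]
    ring
  have hK : IsCompact (Set.Icc 0 (ρ ^ 2) ×ˢ Metric.closedBall (0 : Space d) ρ) :=
    isCompact_Icc.prod (isCompact_closedBall _ _)
  have hsub : exteriorCylinder d T ρ \ cylinder d (ρ / 2)
      ⊆ Set.Icc 0 (ρ ^ 2) ×ˢ Metric.closedBall (0 : Space d) ρ := fun z hz =>
    ⟨⟨hz.1.1.1.1.le, hz.1.2.1⟩, by simpa using hz.1.2.2⟩
  have hbound : ∀ z ∈ exteriorCylinder d T ρ \ cylinder d (ρ / 2), ‖ψ ‖z.2‖‖ ≤ m := fun z hz => by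
    have h1 : 1 ≤ ‖z.2‖ := le_of_lt hz.1.1.2
    rw [Real.norm_of_nonneg (hψ.nonneg _ h1)]
    exact hm _ h1 hz.1.2.2
  by_cases hne : (exteriorCylinder d T ρ \ cylinder d (ρ / 2)).Nonempty
  · obtain ⟨z, hz⟩ := hne
    have hm0 : 0 ≤ m := (norm_nonneg _).trans (hbound z hz)
    have h1 := norm_setIntegral_le_of_norm_le_const
      (μ := volume) ((measure_mono hsub).trans_lt hK.measure_lt_top) hbound
    refine (le_abs_self _).trans (h1.trans ?_)
    rw [← hvol]
    exact mul_le_mul_of_nonneg_left (measureReal_mono hsub hK.measure_lt_top.ne) hm0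
  · rw [Set.not_nonempty_iff_eq_empty.1 hne]
    simp only [Measure.restrict_empty, integral_zero_measure]
    have : 0 ≤ m := (hψ.nonneg 1 le_rfl).trans (hm 1 le_rfl hρ1)
    positivity

end Masses

section MassEstimates

variable {d k : ℕ} {α β κ M σ K ρ T ε : ℝ} {ψ ζ ζ' ζ'' : ℝ → ℝ} {p : Fin k → ℝ}
  {u₀ u₁ : Fin k → Space d → ℂ} {u : Fin k → ℝ → Space d → ℂ}

/-! ### The key estimate -/

/-- The equation for `u_{ℓ-1}` has source mass `J_{ℓ-1}`, while `u_{ℓ-1}` itself is measured by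
`A_ℓ`; this index shift makes the system cyclic. The adjoint kernel carries `θ^σ`, and `1/p_ℓ ≤ σ`
turns it into the power `θ^{1/p_ℓ}` required by Hölder. -/
theorem totalMass_add_le (hd : 2 ≤ d) (hψ : IsWeight d α β ψ κ M)
    (hζ : IsCutoff ζ ζ' ζ'' σ K) (hσ : σ ≤ 1) (hp : ∀ l, 1 < p l) (hpσ : ∀ l, (p l)⁻¹ ≤ σ)
    (hρ : 4 ≤ ρ) (hT : ρ ^ 2 < T) (hε : ε ≠ 0)
    (hu₁ : ∀ l, MemLp (u₁ l) 2 (exteriorMeasure d))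
    (h : IsWeakSolution α β p ε u₀ u₁ T u) (l : Fin k) {m : ℝ}
    (hm : ∀ r, 1 ≤ r → r ≤ ρ → ψ r ≤ m) :
    totalMass p ψ ζ T u (cycPred l) ρ + ε * (∫ x in exterior d,
        profile ψ ζ ρ ‖x‖ • (u₀ (cycPred l) x + u₁ (cycPred l) x)).re
      ≤ (4 * M + 2 * d + 2) * K / ρ ^ 2 * ((annulusMass p ψ ζ T u l ρ) ^ (p l)⁻¹ *
        (m * (volume.real (Metric.closedBall (0 : Space d) 1) * ρ ^ (d + 2))) ^ (1 - (p l)⁻¹)) := by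
  have hρ0 : 0 < ρ := by linarith
  set C := (4 * M + 2 * d + 2) * K / ρ ^ 2 with hC
  have hC0 : 0 ≤ C := by
    have := hψ.bound_nonneg
    have := hζ.bound_nonneg
    positivity
  set W := exteriorCylinder d T ρ \ cylinder d (ρ / 2) with hW
  have hWm : MeasurableSet W :=
    (measurableSet_exteriorCylinder d T ρ).diff (measurableSet_cylinder d _)
  have hWE : W ⊆ Set.Ioo 0 T ×ˢ exterior d := fun z hz => hz.1.1
  have hW1 : ∀ z ∈ W, 1 ≤ ‖z.2‖ := fun z hz => le_of_lt hz.1.1.2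
  have hpl := hp l
  have hpi : 0 ≤ (p l)⁻¹ := by positivity
  have hpi1 : 0 ≤ 1 - (p l)⁻¹ := by
    have := inv_le_one_of_one_le₀ hpl.le
    linarith
  have hid := congrArg Complex.re
    (h.integral_adjointTest hd hψ hζ (by linarith) hT hε hu₁ (cycPred l))
  simp only [Complex.add_re, Complex.ofReal_re, Complex.re_ofReal_mul] at hid
  rw [totalMass, hid]
  set θ : ℝ × Space d → ℝ := fun z => ζ (z.1 / ρ ^ 2) * ζ (‖z.2‖ / ρ) with hθ
  have hθ0 : ∀ z, 0 ≤ θ z := fun z => mul_nonneg (hζ.nonneg _) (hζ.nonneg _)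
  have hθ1 : ∀ z, θ z ≤ 1 := fun z => mul_le_one₀ (hζ.le_one _) (hζ.nonneg _) (hζ.le_one _)
  have hθσ : ∀ z, θ z ^ σ ≤ θ z ^ (p l)⁻¹ := fun z => by
    rcases (hθ0 z).eq_or_lt with h0 | h0
    · rw [← h0, Real.zero_rpow hζ.exponent_pos.ne']
      exact Real.rpow_nonneg le_rfl _
    · exact Real.rpow_le_rpow_of_exponent_ge h0 (hθ1 z) (hpσ l)
  have hθc : Continuous θ := (hζ.continuous.comp (continuous_fst.div_const _)).mul
    (hζ.continuous.comp ((continuous_norm.comp continuous_snd).div_const _))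
  have hsubK : W ⊆ _ := Set.sdiff_subset.trans (exteriorCylinder_subset_compact d T ρ)
  have hψc : ContinuousOn (fun z : ℝ × Space d => ψ ‖z.2‖) W :=
    (continuousOn_weight hψ).mono fun z hz => ⟨trivial, hW1 z hz⟩
  have hψi : IntegrableOn (fun z : ℝ × Space d => ψ ‖z.2‖) W :=
    (((continuousOn_weight hψ).mono (Set.prod_mono (Set.subset_univ _)
      Set.inter_subset_left)).integrableOn_compact
        (isCompact_closed_exteriorCylinder d ρ)).mono_set hsubK
  have haeW : ∀ {P : ℝ × Space d → Prop}, (∀ z ∈ W, P z) → ∀ᵐ z ∂(volume.restrict W), P z :=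
    fun hP => (ae_restrict_iff' hWm).2 (Eventually.of_forall hP)
  have hum : AEStronglyMeasurable (fun z : ℝ × Space d => ‖u (cycPred l) z.1 z.2‖)
      (volume.restrict W) :=
    (AEStronglyMeasurable.mono_set hWE (h.jointlyMeasurable (cycPred l))).norm
  have hΦ : ∀ z ∈ W, testFunction ψ ζ ρ z = ψ ‖z.2‖ * θ z := fun z hz =>
    testFunction_eq (by linarith [hW1 z hz])
  have hfi : IntegrableOn (fun z : ℝ × Space d =>
      ‖u (cycPred l) z.1 z.2‖ ^ p l * (ψ ‖z.2‖ * θ z)) W := by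
    refine ((integrableOn_nonlinearity_mul_testFunction hψ hζ hρ0 hT h l).mono_set hWE).congr
      (haeW fun z hz => ?_)
    simp only [hΦ z hz]
  obtain ⟨hi, hle⟩ := weighted_holder hpl hum (hψc.aestronglyMeasurable hWm)
    hθc.aestronglyMeasurable (Eventually.of_forall fun z => norm_nonneg _)
    (haeW fun z hz => hψ.nonneg _ (hW1 z hz)) (Eventually.of_forall hθ0) hψi hfi
  have hA : annulusMass p ψ ζ T u l ρ
      = ∫ z in W, ‖u (cycPred l) z.1 z.2‖ ^ p l * (ψ ‖z.2‖ * θ z) := by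
    rw [annulusMass_eq hζ hρ0 l]
    exact setIntegral_congr_fun hWm fun z hz => by simp only [hΦ z hz]
  have hψint : 0 ≤ ∫ z in W, ψ ‖z.2‖ :=
    setIntegral_nonneg hWm fun z hz => hψ.nonneg _ (hW1 z hz)
  have hA0 : 0 ≤ annulusMass p ψ ζ T u l ρ := annulusMass_nonneg hψ hζ l
  calc (∫ z in Set.Ioo 0 T ×ˢ exterior d,
        adjointTest κ ψ ζ ζ' ζ'' ρ z • u (cycPred l) z.1 z.2).re
      = (∫ z in W, adjointTest κ ψ ζ ζ' ζ'' ρ z • u (cycPred l) z.1 z.2).re := by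
        congr 1
        -- The adjoint kernel vanishes outside the cylinder at scale `ρ` and, by harmonicity, inside
        -- the one at scale `ρ/2`.
        refine setIntegral_eq_of_subset_of_forall_sdiff_eq_zero (measurableSet_spacetime d T)
          hWE fun z hz => ?_
        have : adjointTest κ ψ ζ ζ' ζ'' ρ z = 0 := by
          by_cases h1 : z ∈ cylinder d ρ
          · refine adjointTest_eq_zero_of_mem hζ hρ0 hz.1.1.1.le ?_
            by_contra h2
            exact hz.2 ⟨⟨hz.1, h1⟩, h2⟩
          · exact adjointTest_eq_zero_of_notMem hζ hρ0 h1
        rw [this, zero_smul]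
    _ ≤ ‖∫ z in W, adjointTest κ ψ ζ ζ' ζ'' ρ z • u (cycPred l) z.1 z.2‖ :=
        Complex.re_le_norm _
    _ ≤ ∫ z in W, ‖adjointTest κ ψ ζ ζ' ζ'' ρ z • u (cycPred l) z.1 z.2‖ :=
        norm_integral_le_integral_norm _
    _ ≤ ∫ z in W, C * (‖u (cycPred l) z.1 z.2‖ * (ψ ‖z.2‖ * θ z ^ (p l)⁻¹)) := by
        refine integral_mono_of_nonneg (Eventually.of_forall fun z => norm_nonneg _)
          (hi.const_mul C) (haeW fun z hz => ?_)
        simp only [norm_smul, Real.norm_eq_abs]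
        have h1 := (abs_adjointTest_le hd hψ hζ hσ hρ (hW1 z hz)).trans
          (mul_le_mul_of_nonneg_left (mul_le_mul_of_nonneg_left (hθσ z)
            (hψ.nonneg _ (hW1 z hz))) hC0)
        calc _ ≤ C * (ψ ‖z.2‖ * θ z ^ (p l)⁻¹) * ‖u (cycPred l) z.1 z.2‖ :=
              mul_le_mul_of_nonneg_right h1 (norm_nonneg _)
          _ = _ := by ring
    _ = C * ∫ z in W, ‖u (cycPred l) z.1 z.2‖ * (ψ ‖z.2‖ * θ z ^ (p l)⁻¹) :=
        integral_const_mul _ _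
    _ ≤ _ := by
        refine mul_le_mul_of_nonneg_left (hle.trans ?_) hC0
        rw [← hA]
        refine mul_le_mul_of_nonneg_left ?_ (Real.rpow_nonneg hA0 _)
        exact Real.rpow_le_rpow hψint
          (integral_weight_exteriorCylinder_le hψ (by linarith) hm) hpi1

/-! ### The contribution of the initial data -/

/-- Dominated convergence: the cutoff is at most `1` and equals `1` at `x` as soon as `ρ ≥ 2‖x‖`. -/
theorem tendsto_integral_profile (hζ : IsCutoff ζ ζ' ζ'' σ K)
    {w : Space d → ℂ} (hw : IntegrableOn (fun x => w x * ((ψ ‖x‖ : ℝ) : ℂ)) (exterior d)) :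
    Tendsto (fun ρ => ∫ x in exterior d, profile ψ ζ ρ ‖x‖ • w x) atTop
      (𝓝 (∫ x in exterior d, w x * ((ψ ‖x‖ : ℝ) : ℂ))) := by
  have hae : ∀ ρ, ∀ᵐ x ∂(volume.restrict (exterior d)),
      ζ (‖x‖ / ρ) • (w x * ((ψ ‖x‖ : ℝ) : ℂ)) = profile ψ ζ ρ ‖x‖ • w x := fun ρ =>
    (ae_restrict_iff' (measurableSet_exterior d)).2 (Eventually.of_forall fun x hx => by
      have h1 : 1 < ‖x‖ := hx
      rw [profile_eq (by linarith), Complex.real_smul, Complex.real_smul]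
      push_cast; ring)
  refine tendsto_integral_filter_of_dominated_convergence
    (fun x => ‖w x * ((ψ ‖x‖ : ℝ) : ℂ)‖) (Eventually.of_forall fun ρ => ?_)
    (Eventually.of_forall fun ρ => ?_) hw.norm
    ((ae_restrict_iff' (measurableSet_exterior d)).2 (Eventually.of_forall fun x hx => ?_))
  · refine AEStronglyMeasurable.congr ?_ (hae ρ)
    exact (hζ.continuous.comp (continuous_norm.div_const _)).aestronglyMeasurable.smul
      hw.aestronglyMeasurable
  · filter_upwards [hae ρ] with x hx
    rw [← hx, norm_smul, Real.norm_of_nonneg (hζ.nonneg _)]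
    exact mul_le_of_le_one_left (norm_nonneg _) (hζ.le_one _)
  · refine tendsto_const_nhds.congr' ?_
    have h1 : 1 < ‖x‖ := hx
    filter_upwards [eventually_ge_atTop (2 * ‖x‖)] with ρ hρ
    have hρ0 : 0 < ρ := by linarith
    have h2 : |‖x‖ / ρ| ≤ 3 / 4 := by
      rw [abs_of_nonneg (by positivity), div_le_iff₀ hρ0]; linarith
    rw [profile_eq (by linarith), hζ.eq_one _ h2, mul_one, Complex.real_smul, mul_comm]

/-! ### Summary of the estimates for a weak solution -/

/-- The estimates satisfied by the functionals `totalMass` (`J`), `annulusMass` (`A`) and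
`cylinderMass` (`S`) of a weak solution on `[0,T)` with data of size `ε`. -/
structure MassEstimate (d : ℕ) (p : Fin k → ℝ) (L : ℝ → ℝ) (c C ρ₀ ε T : ℝ)
    (J A S : Fin k → ℝ → ℝ) : Prop where
  annulus_nonneg : ∀ l ρ, ρ₀ ≤ ρ → ρ ^ 2 < T → 0 ≤ A l ρ
  annulus_le : ∀ l ρ, ρ₀ ≤ ρ → ρ ^ 2 < T → A l ρ ≤ J l ρ
  annulus_le_sub : ∀ l ρ, ρ₀ ≤ ρ → ρ ^ 2 < T → A l ρ ≤ S l ρ - S l (ρ / 2)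
  cylinder_nonneg : ∀ l ρ, ρ₀ ≤ ρ → ρ ^ 2 < T → 0 ≤ S l (ρ / 2)
  cylinder_le : ∀ l ρ, ρ₀ ≤ ρ → ρ ^ 2 < T → S l (ρ / 2) ≤ J l ρ
  key : ∀ l ρ, ρ₀ ≤ ρ → ρ ^ 2 < T →
    J (cycPred l) ρ + c * ε
      ≤ C * (A l ρ) ^ (p l)⁻¹ * ((ρ ^ (d + 2) * L ρ) ^ (1 - (p l)⁻¹) / ρ ^ 2)

/-- Its role is uniformity: `ρ₀`, `c` and `C` depend neither on `ε` and `T` nor on the solution. All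
later arguments use only `MassEstimate` and no longer refer to the equation. -/
theorem exists_massEstimate (hd : 2 ≤ d) (hk : 0 < k) (hαβ : 0 ≤ α * β) (hp : ∀ l, 1 < p l)
    (hu₁ : ∀ l, MemLp (u₁ l) 2 (exteriorMeasure d))
    (hint : ∀ l, IntegrableOn (fun x => (u₀ l x + u₁ l x) * ((Psi d α β x : ℝ) : ℂ)) (exterior d))
    (hpos : ∀ l, 0 < (∫ x in exterior d, (u₀ l x + u₁ l x) * ((Psi d α β x : ℝ) : ℂ)).re)
    {L : ℝ → ℝ} {m ρ₁ : ℝ} (hm : 0 ≤ m) (hL0 : ∀ ρ, ρ₁ ≤ ρ → 0 < L ρ)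
    (hL : ∀ ρ, ρ₁ ≤ ρ → ∀ r, 1 ≤ r → r ≤ ρ → psiRad d α β r ≤ m * L ρ) :
    ∃ ρ₀ c C : ℝ, 4 ≤ ρ₀ ∧ ρ₁ ≤ ρ₀ ∧ 0 < c ∧ 1 ≤ C ∧ ∀ ε, 0 < ε → ∀ T u,
      IsWeakSolution α β p ε u₀ u₁ T u → ∃ J A S, MassEstimate d p L c C ρ₀ ε T J A S := by
  have : Nonempty (Fin k) := ⟨⟨0, hk⟩⟩
  obtain ⟨κ, M, hψ⟩ := isWeight_psiRad hd hαβ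
  -- Taking `σ` to be the largest `1/p_ℓ` lets a single cutoff serve all components.
  obtain ⟨l₀, hl₀⟩ := Finite.exists_max fun l => (p l)⁻¹
  have hpl₀ := hp l₀
  obtain ⟨ζ, ζ', ζ'', K, hζ⟩ := exists_isCutoff (σ := (p l₀)⁻¹) (by positivity)
    (inv_lt_one_of_one_lt₀ hpl₀)
  set ψ := psiRad d α β
  set D : Fin k → ℝ → ℝ := fun l ρ =>
    (∫ x in exterior d, profile ψ ζ ρ ‖x‖ • (u₀ l x + u₁ l x)).re with hD
  have hDlim : ∀ l, Tendsto (D l) atTop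
      (𝓝 (∫ x in exterior d, (u₀ l x + u₁ l x) * ((Psi d α β x : ℝ) : ℂ)).re) := fun l =>
    (Complex.continuous_re.tendsto _).comp (tendsto_integral_profile hζ (hint l))
  obtain ⟨l₁, hl₁⟩ := Finite.exists_min fun l =>
    (∫ x in exterior d, (u₀ l x + u₁ l x) * ((Psi d α β x : ℝ) : ℂ)).re
  -- Half of the smallest limiting data integral, so that all cut-off data integrals exceed `c` for
  -- large `ρ`.
  set c := (∫ x in exterior d, (u₀ l₁ x + u₁ l₁ x) * ((Psi d α β x : ℝ) : ℂ)).re / 2 with hc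
  have hc0 : 0 < c := half_pos (hpos l₁)
  have hev : ∀ᶠ ρ in atTop, ∀ l, c ≤ D l ρ := by
    rw [eventually_all]
    intro l
    refine (hDlim l).eventually (le_mem_nhds ?_)
    exact lt_of_lt_of_le (half_lt_self (hpos l₁)) (hl₁ l)
  obtain ⟨ρ₂, hρ₂⟩ := eventually_atTop.1 hev
  set V := volume.real (Metric.closedBall (0 : Space d) 1) with hV
  have hV0 : 0 ≤ V := measureReal_nonneg
  set B := (4 * M + 2 * d + 2) * K with hB
  have hB0 : 0 ≤ B := by
    have := hψ.bound_nonneg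
    have := hζ.bound_nonneg
    positivity
  refine ⟨max 4 (max ρ₁ ρ₂), c, 1 + B * (1 + m * V), le_max_left _ _,
    (le_max_left _ _).trans (le_max_right _ _), hc0, by
      have : 0 ≤ B * (1 + m * V) := by positivity
      linarith, fun ε hε T u h => ⟨totalMass p ψ ζ T u, annulusMass p ψ ζ T u,
      cylinderMass p ψ T u, ?_⟩⟩
  have h4 : ∀ {ρ}, max 4 (max ρ₁ ρ₂) ≤ ρ → 4 ≤ ρ := fun h => (le_max_left _ _).trans h
  have h0 : ∀ {ρ}, max 4 (max ρ₁ ρ₂) ≤ ρ → 0 < ρ := fun h => by linarith [h4 h]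
  refine ⟨fun l ρ _ _ => annulusMass_nonneg hψ hζ l,
    fun l ρ h1 h2 => annulusMass_le_totalMass hψ hζ (h0 h1) h2 h l,
    fun l ρ h1 h2 => annulusMass_le_sub hψ hζ (h0 h1) h2 h l,
    fun l ρ _ _ => cylinderMass_nonneg hψ l,
    fun l ρ h1 h2 => cylinderMass_le_totalMass hψ hζ (h0 h1) h2 h l, fun l ρ h1 h2 => ?_⟩
  have hρ1 : ρ₁ ≤ ρ := ((le_max_left _ _).trans (le_max_right _ _)).trans h1
  have hρ2 : ρ₂ ≤ ρ := ((le_max_right _ _).trans (le_max_right _ _)).trans h1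
  have hρ0 := h0 h1
  have hLρ := hL0 ρ hρ1
  have hpl := hp l
  have hpi0 : 0 < (p l)⁻¹ := by positivity
  have hpi : 0 ≤ 1 - (p l)⁻¹ := by
    have := inv_le_one_of_one_le₀ hpl.le
    linarith
  have hA : 0 ≤ annulusMass p ψ ζ T u l ρ := annulusMass_nonneg hψ hζ l
  have hest := totalMass_add_le hd hψ hζ (inv_le_one_of_one_le₀ hpl₀.le) hp hl₀ (h4 h1) h2 hε.ne'
    hu₁ h l (hL ρ hρ1)
  have hdata : c * ε ≤ ε * D (cycPred l) ρ := by
    rw [mul_comm]; exact mul_le_mul_of_nonneg_left (hρ₂ ρ hρ2 _) hε.le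
  -- The power `(mV)^{1-1/p_ℓ}` is at most `1 + mV`, a bound independent of `ℓ`.
  have hsplit : (m * L ρ * (V * ρ ^ (d + 2))) ^ (1 - (p l)⁻¹)
      ≤ (1 + m * V) * (ρ ^ (d + 2) * L ρ) ^ (1 - (p l)⁻¹) := by
    rw [show m * L ρ * (V * ρ ^ (d + 2)) = (m * V) * (ρ ^ (d + 2) * L ρ) by ring,
      Real.mul_rpow (by positivity) (by positivity)]
    refine mul_le_mul_of_nonneg_right ?_ (by positivity)
    calc (m * V) ^ (1 - (p l)⁻¹) ≤ (1 + m * V) ^ (1 - (p l)⁻¹) :=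
          Real.rpow_le_rpow (by positivity) (by linarith) hpi
      _ ≤ (1 + m * V) ^ (1 : ℝ) :=
          Real.rpow_le_rpow_of_exponent_le (by linarith [mul_nonneg hm hV0]) (by linarith)
      _ = _ := Real.rpow_one _
  calc totalMass p ψ ζ T u (cycPred l) ρ + c * ε
      ≤ totalMass p ψ ζ T u (cycPred l) ρ + ε * D (cycPred l) ρ := by linarith
    _ ≤ B / ρ ^ 2 * (annulusMass p ψ ζ T u l ρ ^ (p l)⁻¹ *
          (m * L ρ * (V * ρ ^ (d + 2))) ^ (1 - (p l)⁻¹)) := hest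
    _ ≤ B / ρ ^ 2 * (annulusMass p ψ ζ T u l ρ ^ (p l)⁻¹ *
          ((1 + m * V) * (ρ ^ (d + 2) * L ρ) ^ (1 - (p l)⁻¹))) := by gcongr
    _ = B * (1 + m * V) * annulusMass p ψ ζ T u l ρ ^ (p l)⁻¹ *
          ((ρ ^ (d + 2) * L ρ) ^ (1 - (p l)⁻¹) / ρ ^ 2) := by ring
    _ ≤ _ := by
        refine mul_le_mul_of_nonneg_right (mul_le_mul_of_nonneg_right (by linarith)
          (Real.rpow_nonneg hA _)) (by positivity)

end MassEstimates

section CyclicSystems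

variable {d k : ℕ} {p : Fin k → ℝ}

/-! ### The exponents -/

theorem cycPred_eq_sub_one [NeZero k] (hk : 2 ≤ k) (l : Fin k) : cycPred l = l - 1 := by
  apply Fin.ext
  simp only [cycPred, Fin.sub_def, Fin.val_one', Nat.mod_eq_of_lt (show 1 < k by omega)]
  rw [add_comm]

theorem cycPred_bijective (hk : 2 ≤ k) : Function.Bijective (cycPred : Fin k → Fin k) := by
  have : NeZero k := ⟨by omega⟩
  have h : (cycPred : Fin k → Fin k) = fun l => l - 1 := funext (cycPred_eq_sub_one hk)
  rw [h]
  exact (Equiv.subRight (1 : Fin k)).bijective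

theorem iterate_cycPred [NeZero k] (hk : 2 ≤ k) (m : Fin k) (n : ℕ) :
    cycPred^[n] m = m - Fin.ofNat k n := by
  induction n with
  | zero => simp
  | succ n ih =>
    rw [Function.iterate_succ_apply', ih, cycPred_eq_sub_one hk, sub_sub]
    congr 1
    apply Fin.ext
    simp [Fin.val_add]

theorem iterate_cycPred_self (hk : 2 ≤ k) (m : Fin k) : cycPred^[k] m = m := by
  have : NeZero k := ⟨by omega⟩
  rw [iterate_cycPred hk]
  have : Fin.ofNat k k = 0 := by apply Fin.ext; simp
  rw [this, sub_zero]

theorem prod_iterate_cycPred (hk : 2 ≤ k) (p : Fin k → ℝ) (m : Fin k) :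
    ∏ j ∈ Finset.range k, p (cycPred^[j] m) = ∏ l, p l := by
  have : NeZero k := ⟨by omega⟩
  rw [Finset.prod_range fun j => p (cycPred^[j] m)]
  refine Fintype.prod_equiv (Equiv.subLeft m) _ _ fun j => ?_
  rw [iterate_cycPred hk]
  simp

theorem matrixP_mulVec (p : Fin k → ℝ) (x : Fin k → ℝ) (l : Fin k) :
    Matrix.mulVec (matrixP p) x l = p l * x (cycPred l) := by
  simp [Matrix.mulVec, dotProduct, matrixP]

/-- A kernel vector satisfies `x_ℓ = p_ℓ x_{ℓ-1}`. If `|x_{ℓ-1}|` is the largest entry, then `p_ℓ >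
1` forces it to be zero. -/
theorem isUnit_matrixP_sub_one (hk : 2 ≤ k) (hp : ∀ l, 1 < p l) : IsUnit (matrixP p - 1) := by
  have : Nonempty (Fin k) := ⟨⟨0, by omega⟩⟩
  rw [← Matrix.mulVec_injective_iff_isUnit]
  rw [← Matrix.coe_mulVecLin, injective_iff_map_eq_zero]
  intro x hx
  have hx' : ∀ l, x l = p l * x (cycPred l) := fun l => by
    have := congrFun hx l
    simp only [Matrix.mulVecLin_apply, Matrix.sub_mulVec, Matrix.one_mulVec, Pi.sub_apply,
      matrixP_mulVec, Pi.zero_apply] at this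
    linarith
  obtain ⟨m, hm⟩ := Finite.exists_max fun l => |x l|
  obtain ⟨l, rfl⟩ := (cycPred_bijective hk).2 m
  have h1 : |x l| = p l * |x (cycPred l)| := by
    rw [hx' l, abs_mul, abs_of_pos (by linarith [hp l])]
  have h2 := hm l
  have h3 : |x (cycPred l)| = 0 := by
    nlinarith [hp l, abs_nonneg (x (cycPred l))]
  ext j
  have := hm j
  rw [h3] at this
  exact abs_nonpos_iff.1 this

theorem gammaVec_eq (hk : 2 ≤ k) (hp : ∀ l, 1 < p l) (l : Fin k) :
    p l * gammaVec p (cycPred l) - gammaVec p l = 1 := by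
  have hu := (Matrix.isUnit_iff_isUnit_det _).1 (isUnit_matrixP_sub_one hk hp)
  have h : Matrix.mulVec (matrixP p - 1) (gammaVec p) = fun _ => 1 := by
    rw [gammaVec, Matrix.mulVec_mulVec, Matrix.mul_nonsing_inv _ hu, Matrix.one_mulVec]
  have := congrFun h l
  simpa [Matrix.sub_mulVec, matrixP_mulVec] using this

theorem exists_gammaVec_eq_gammaMax (hk : 0 < k) (p : Fin k → ℝ) :
    ∃ m, gammaVec p m = gammaMax p ∧ ∀ l, gammaVec p l ≤ gammaMax p := by
  have : Nonempty (Fin k) := ⟨⟨0, hk⟩⟩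
  obtain ⟨m, hm⟩ := exists_eq_ciSup_of_finite (f := gammaVec p)
  exact ⟨m, hm, fun l => le_ciSup (Set.finite_range _).bddAbove l⟩

/-- If all exponents coincide, then so do the entries of `γ`. -/
theorem gammaVec_eq_of_forall_eq (hk : 2 ≤ k) (hp : ∀ l, 1 < p l) {q : ℝ} (hq : ∀ l, p l = q) :
    (∀ l, gammaVec p l = gammaMax p) ∧ (q - 1) * gammaMax p = 1 := by
  have : Nonempty (Fin k) := ⟨⟨0, by omega⟩⟩
  obtain ⟨a, ha, hmax⟩ := exists_gammaVec_eq_gammaMax (by omega) p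
  obtain ⟨b, hb⟩ := Finite.exists_min (gammaVec p)
  -- At the largest entry the recursion gives `(q - 1) γ ≤ 1`, and at the smallest one `(q - 1) γ ≥
  -- 1`.
  obtain ⟨a', rfl⟩ := (cycPred_bijective hk).2 a
  obtain ⟨b', rfl⟩ := (cycPred_bijective hk).2 b
  have h1 := gammaVec_eq hk hp a'
  have h2 := gammaVec_eq hk hp b'
  have hq1 : 1 < q := hq a' ▸ hp a'
  rw [hq] at h1 h2
  have h3 := hmax a'
  have h4 := hb b'
  have h5 := hb (cycPred a')
  have h6 : gammaVec p (cycPred b') = gammaMax p := by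
    rw [ha] at h1 h5
    nlinarith
  have h7 : ∀ l, gammaVec p l = gammaMax p := fun l =>
    le_antisymm (hmax l) (h6 ▸ hb l)
  refine ⟨h7, ?_⟩
  rw [h7, h7] at h1
  linarith

/-! ### Cyclic systems of inequalities -/

/-- The largest `Y`, say `y`, satisfies `y ≤ C y^{1/p}`, a sublinear inequality that bounds `y` by
`C^{1/(1-1/p)}`. One more use of the hypothesis bounds `e`. -/
theorem exists_cyclic_bound (hk : 2 ≤ k) (hp : ∀ l, 1 < p l) {C : ℝ} (hC : 1 ≤ C) :
    ∃ K : ℝ, 1 ≤ K ∧ ∀ Y Z e : Fin k → ℝ, (∀ l, 0 ≤ Z l) → (∀ l, Z l ≤ Y l) → (∀ l, 0 ≤ e l) →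
      (∀ l, Y (cycPred l) + e (cycPred l) ≤ C * Z l ^ (p l)⁻¹) → ∀ l, Y l ≤ K ∧ e l ≤ K := by
  have : Nonempty (Fin k) := ⟨⟨0, by omega⟩⟩
  have hi0 : ∀ l, 0 < (p l)⁻¹ := fun l => inv_pos.2 (by linarith [hp l])
  have hi1 : ∀ l, (p l)⁻¹ < 1 := fun l => inv_lt_one_of_one_lt₀ (hp l)
  -- A common upper bound for the exponents `1/(1-1/p_ℓ)`.
  set s := ∑ l, (1 - (p l)⁻¹)⁻¹ with hs
  have hs0 : ∀ l, (1 - (p l)⁻¹)⁻¹ ≤ s := fun l =>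
    Finset.single_le_sum (f := fun l => (1 - (p l)⁻¹)⁻¹)
      (fun j _ => inv_nonneg.2 (by linarith [hi1 j])) (Finset.mem_univ l)
  have hCs : 1 ≤ C ^ s := Real.one_le_rpow hC
    ((inv_nonneg.2 (by linarith [hi1 (Classical.arbitrary _)])).trans (hs0 (Classical.arbitrary _)))
  refine ⟨C * C ^ s, one_le_mul_of_one_le_of_one_le hC hCs, fun Y Z e hZ hZY he h => ?_⟩
  have hY : ∀ l, Y l ≤ C ^ s := by
    obtain ⟨m, hm⟩ := Finite.exists_max Y
    suffices Y m ≤ C ^ s from fun l => (hm l).trans this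
    obtain ⟨l, rfl⟩ := (cycPred_bijective hk).2 m
    set y := Y (cycPred l) with hy
    by_cases hy1 : y ≤ 1
    · exact hy1.trans hCs
    have hy0 : 0 < y := by linarith
    have h1 : y ≤ C * y ^ (p l)⁻¹ := by
      have h2 : Z l ^ (p l)⁻¹ ≤ y ^ (p l)⁻¹ :=
        Real.rpow_le_rpow (hZ l) ((hZY l).trans (hm l)) (hi0 l).le
      have := h l
      have := he (cycPred l)
      nlinarith
    have h2 : y ^ (1 - (p l)⁻¹) ≤ C := by
      rw [Real.rpow_sub hy0, Real.rpow_one, div_le_iff₀ (Real.rpow_pos_of_pos hy0 _)]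
      exact h1
    have h3 : 0 < 1 - (p l)⁻¹ := by linarith [hi1 l]
    calc y = (y ^ (1 - (p l)⁻¹)) ^ (1 - (p l)⁻¹)⁻¹ := (Real.rpow_rpow_inv hy0.le h3.ne').symm
      _ ≤ C ^ (1 - (p l)⁻¹)⁻¹ := Real.rpow_le_rpow (by positivity) h2 (by positivity)
      _ ≤ C ^ s := Real.rpow_le_rpow_of_exponent_le hC (hs0 l)
  intro l
  refine ⟨(hY l).trans (le_mul_of_one_le_left (by linarith) hC), ?_⟩
  obtain ⟨j, rfl⟩ := (cycPred_bijective hk).2 l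
  have h1 : Z j ^ (p j)⁻¹ ≤ C ^ s := by
    calc Z j ^ (p j)⁻¹ ≤ (C ^ s) ^ (p j)⁻¹ :=
          Real.rpow_le_rpow (hZ j) ((hZY j).trans (hY j)) (hi0 j).le
      _ ≤ (C ^ s) ^ (1 : ℝ) := Real.rpow_le_rpow_of_exponent_le hCs (hi1 j).le
      _ = C ^ s := Real.rpow_one _
  have h2 := h j
  have h3 := (hZ (cycPred j)).trans (hZY (cycPred j))
  nlinarith

/-- Substitute the inequalities into one another, discarding the intermediate `e`. Because `C ≥ 1`,
the root of an earlier constant is bounded by the constant itself. -/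
theorem cyclic_iterate_le (hp : ∀ l, 1 < p l) {C : ℝ} (hC : 1 ≤ C)
    {Y Z e : Fin k → ℝ} (hZ : ∀ l, 0 ≤ Z l) (hZY : ∀ l, Z l ≤ Y l) (he : ∀ l, 0 ≤ e l)
    (h : ∀ l, Y (cycPred l) + e (cycPred l) ≤ C * Z l ^ (p l)⁻¹) (m : Fin k) (n : ℕ) :
    Y (cycPred^[n + 1] m) + e (cycPred^[n + 1] m)
      ≤ C ^ (n + 1) * Z m ^ (∏ j ∈ Finset.range (n + 1), p (cycPred^[j] m))⁻¹ := by
  induction n with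
  | zero => simpa using h m
  | succ n ih =>
    set Q := ∏ j ∈ Finset.range (n + 1), p (cycPred^[j] m) with hQ
    have hC0 : 0 ≤ C := by linarith
    set l := cycPred^[n + 1] m with hl
    have hpl := hp l
    have hi0 : 0 ≤ (p l)⁻¹ := by positivity
    have hi1 : (p l)⁻¹ ≤ 1 := inv_le_one_of_one_le₀ hpl.le
    rw [Function.iterate_succ_apply' _ (n + 1), Finset.prod_range_succ, ← hQ, ← hl]
    have h1 : Z l ≤ C ^ (n + 1) * Z m ^ Q⁻¹ := (hZY l).trans (by linarith [he l])
    have h2 : 1 ≤ C ^ (n + 1) := one_le_pow₀ hC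
    calc _ ≤ C * Z l ^ (p l)⁻¹ := h l
      _ ≤ C * (C ^ (n + 1) * Z m ^ Q⁻¹) ^ (p l)⁻¹ := by
          have := hZ l
          gcongr
      _ = C * ((C ^ (n + 1)) ^ (p l)⁻¹ * Z m ^ (Q * p l)⁻¹) := by
          rw [Real.mul_rpow (by positivity) (Real.rpow_nonneg (hZ m) _), ← Real.rpow_mul (hZ m),
            mul_inv]
      _ ≤ C * (C ^ (n + 1) * Z m ^ (Q * p l)⁻¹) := by
          have : (C ^ (n + 1)) ^ (p l)⁻¹ ≤ C ^ (n + 1) := by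
            simpa using Real.rpow_le_rpow_of_exponent_le h2 hi1
          have := Real.rpow_nonneg (hZ m) (Q * p l)⁻¹
          gcongr
      _ = _ := by ring

/-- After `k` substitutions the cycle closes at `m`, and the exponents multiply to the product of
all `p_ℓ`. -/
theorem cyclic_le (hk : 2 ≤ k) (hp : ∀ l, 1 < p l) {C : ℝ} (hC : 1 ≤ C)
    {Y Z e : Fin k → ℝ} (hZ : ∀ l, 0 ≤ Z l) (hZY : ∀ l, Z l ≤ Y l) (he : ∀ l, 0 ≤ e l)
    (h : ∀ l, Y (cycPred l) + e (cycPred l) ≤ C * Z l ^ (p l)⁻¹) (m : Fin k) :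
    Y m + e m ≤ C ^ k * Z m ^ (∏ l, p l)⁻¹ := by
  have := cyclic_iterate_le hp hC hZ hZY he h m (k - 1)
  rwa [Nat.sub_add_cancel (by omega), iterate_cycPred_self hk, prod_iterate_cycPred hk] at this

/-! ### A discrete differential inequality -/

/-- Discrete counterpart of: `s' ≥ s^q / (C w^{q-1})` makes `s^{1-q}` decrease at a definite rate.
The increment `b - a` may be much larger than `a`, so the drop is compared with `(b - a)/b`, which
stays bounded; the bound `a ≤ K w` compensates for large jumps. -/
theorem rpow_one_sub_sub_ge {q a b C K w : ℝ} (hq : 1 < q) (ha : 0 < a) (hC : 0 < C)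
    (hK : 0 ≤ K) (hw : 0 < w) (h : a ^ q ≤ C * w ^ (q - 1) * (b - a)) (haw : a ≤ K * w) :
    (q - 1) / (q * (C + K ^ (q - 1))) * (w ^ (q - 1))⁻¹ ≤ a ^ (1 - q) - b ^ (1 - q) := by
  have hwq : 0 < w ^ (q - 1) := Real.rpow_pos_of_pos hw _
  have haq : 0 < a ^ q := Real.rpow_pos_of_pos ha _
  have hq1 : 0 < q - 1 := by linarith
  have hba : 0 < b - a := by
    by_contra hn
    have : C * w ^ (q - 1) * (b - a) ≤ 0 :=
      mul_nonpos_of_nonneg_of_nonpos (by positivity) (not_lt.1 hn)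
    linarith
  have hb : 0 < b := by linarith
  have ha1 : 0 < a ^ (1 - q) := Real.rpow_pos_of_pos ha _
  have hKq : 0 ≤ K ^ (q - 1) := Real.rpow_nonneg hK _
  -- comparison of the powers
  set y := (q - 1) * ((b - a) / b) with hy
  have hy0 : 0 < y := by positivity
  have hyq : y ≤ q - 1 := mul_le_of_le_one_right hq1.le ((div_le_one hb).2 (by linarith))
  have hlog : (b - a) / b ≤ Real.log (b / a) := by
    have := Real.one_sub_inv_le_log_of_pos (div_pos hb ha)
    rwa [inv_div, one_sub_div hb.ne'] at this
  have hexp : b ^ (1 - q) ≤ a ^ (1 - q) * (1 - y / q) := by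
    have h1 : b ^ (1 - q) = a ^ (1 - q) * (b / a) ^ (1 - q) := by
      rw [← Real.mul_rpow ha.le (by positivity), mul_div_cancel₀ _ ha.ne']
    have h2 : (b / a) ^ (1 - q) ≤ 1 - y / q := by
      rw [Real.rpow_def_of_pos (by positivity)]
      calc Real.exp (Real.log (b / a) * (1 - q)) ≤ Real.exp (-y) := by
            apply Real.exp_le_exp.2; nlinarith
        _ ≤ (1 + y)⁻¹ := by
            rw [Real.exp_neg]
            exact inv_anti₀ (by positivity) (by linarith [Real.add_one_le_exp y])
        _ ≤ 1 - y / q := by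
            rw [inv_le_iff_one_le_mul₀ (by positivity)]
            have : (1 - y / q) * (1 + y) = 1 + y / q * (q - 1 - y) := by field_simp; ring
            rw [this]
            have : 0 ≤ y / q * (q - 1 - y) := mul_nonneg (by positivity) (by linarith)
            linarith
    rw [h1]
    exact mul_le_mul_of_nonneg_left h2 ha1.le
  -- Write `a^{q-1} b = a^q + a^{q-1} (b - a)`: the growth hypothesis bounds the first term, and `a
  -- ≤ K w` the second.
  have hmain : (w ^ (q - 1))⁻¹ / (C + K ^ (q - 1)) ≤ a ^ (1 - q) * ((b - a) / b) := by
    have e1 : a ^ (1 - q) = a / a ^ q := by rw [Real.rpow_sub ha, Real.rpow_one]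
    have e2 : a ^ q = a * a ^ (q - 1) := by
      rw [← Real.rpow_one_add' ha.le (by linarith)]; congr 1; ring
    have e3 : a ^ (q - 1) ≤ K ^ (q - 1) * w ^ (q - 1) := by
      rw [← Real.mul_rpow hK hw.le]
      exact Real.rpow_le_rpow ha.le haw hq1.le
    have haq1 : 0 < a ^ (q - 1) := Real.rpow_pos_of_pos ha _
    rw [e1, div_mul_div_comm, inv_eq_one_div, div_div,
      div_le_div_iff₀ (by positivity) (by positivity)]
    rw [e2] at h ⊢
    nlinarith [mul_le_mul_of_nonneg_left e3 (mul_nonneg ha.le hba.le),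
      mul_le_mul_of_nonneg_left h ha.le]
  calc (q - 1) / (q * (C + K ^ (q - 1))) * (w ^ (q - 1))⁻¹
      = (q - 1) / q * ((w ^ (q - 1))⁻¹ / (C + K ^ (q - 1))) := by
        field_simp
    _ ≤ (q - 1) / q * (a ^ (1 - q) * ((b - a) / b)) := by gcongr
    _ = a ^ (1 - q) - a ^ (1 - q) * (1 - y / q) := by rw [hy]; ring
    _ ≤ _ := by linarith

/-- The drops of `z^{1-q}` telescope, and the final power is nonnegative. -/
theorem sum_inv_rpow_le {q C K : ℝ} (hq : 1 < q) (hC : 0 < C) (hK : 0 ≤ K) {N : ℕ} {z w : ℕ → ℝ}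
    (hz : ∀ n, n ≤ N → 0 < z n) (hw : ∀ n, n < N → 0 < w n)
    (h : ∀ n, n < N → z n ^ q ≤ C * w n ^ (q - 1) * (z (n + 1) - z n))
    (hzw : ∀ n, n < N → z n ≤ K * w n) :
    (q - 1) / (q * (C + K ^ (q - 1))) * ∑ n ∈ Finset.range N, (w n ^ (q - 1))⁻¹
      ≤ z 0 ^ (1 - q) := by
  have h1 : ∀ n ∈ Finset.range N, (q - 1) / (q * (C + K ^ (q - 1))) * (w n ^ (q - 1))⁻¹
      ≤ z n ^ (1 - q) - z (n + 1) ^ (1 - q) := fun n hn => by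
    have hn' := Finset.mem_range.1 hn
    exact rpow_one_sub_sub_ge hq (hz n hn'.le) hC hK (hw n hn') (h n hn') (hzw n hn')
  rw [Finset.mul_sum]
  refine (Finset.sum_le_sum h1).trans ?_
  rw [Finset.sum_range_sub']
  have := Real.rpow_nonneg (hz N le_rfl).le (1 - q)
  linarith

end CyclicSystems

section LifespanBounds

variable {d k : ℕ} {α β : ℝ} {p : Fin k → ℝ} {u₀ u₁ : Fin k → Space d → ℂ}

theorem lifespan_le {ε B : ℝ}
    (h : ∀ T u, 0 < T → IsWeakSolution α β p ε u₀ u₁ T u → T ≤ B) :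
    lifespan α β p ε u₀ u₁ ≤ ENNReal.ofReal B := by
  refine sSup_le ?_
  rintro _ ⟨T, hT, rfl, u, hu⟩
  exact ENNReal.ofReal_le_ofReal (h T u hT hu)

/-! ### Bounds on the lifespan from scalar inequalities -/

/-- If `T` exceeded the claimed bound `B`, the radius `ρ = √B` would be admissible; but there `ε
ρ^{2δ} = C^δ > K`. -/
theorem exists_power_bound {δ K ρ₀ : ℝ} (hδ : 0 < δ) (hρ₀ : 0 < ρ₀) (hK : 0 ≤ K) :
    ∃ C : ℝ, 0 < C ∧ ∀ ε, 0 < ε → ε ≤ 1 → ∀ T,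
      (∀ ρ, ρ₀ ≤ ρ → ρ ^ 2 < T → ε * ρ ^ (2 * δ) ≤ K) → T ≤ C * ε ^ (-δ⁻¹) := by
  -- The first entry makes `√B ≥ ρ₀`, the second makes `C^δ ≥ K + 1`.
  set C := max (ρ₀ ^ 2) ((K + 1) ^ δ⁻¹) with hC
  have hC0 : 0 < C := lt_max_of_lt_left (by positivity)
  refine ⟨C, hC0, fun ε hε hε1 T h => ?_⟩
  by_contra hT
  set B := C * ε ^ (-δ⁻¹) with hB
  have hε' : 1 ≤ ε ^ (-δ⁻¹) :=
    Real.one_le_rpow_of_pos_of_le_one_of_nonpos hε hε1 (neg_nonpos.2 (by positivity))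
  have hB0 : 0 < B := by positivity
  have hρB : ρ₀ ≤ √B := by
    apply Real.le_sqrt_of_sq_le
    exact (le_max_left _ _).trans (le_mul_of_one_le_right hC0.le hε')
  have h1 := h (√B) hρB (by rw [Real.sq_sqrt hB0.le]; exact not_le.1 hT)
  have h2 : √B ^ (2 * δ) = B ^ δ := by
    rw [Real.sqrt_eq_rpow, ← Real.rpow_mul hB0.le]
    congr 1
    ring
  have h3 : B ^ δ = C ^ δ * ε⁻¹ := by
    rw [hB, Real.mul_rpow hC0.le (by positivity), ← Real.rpow_mul hε.le, neg_mul,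
      inv_mul_cancel₀ hδ.ne', Real.rpow_neg_one]
  have h4 : K + 1 ≤ C ^ δ := by
    calc K + 1 = ((K + 1) ^ δ⁻¹) ^ δ := (Real.rpow_inv_rpow (by linarith) hδ.ne').symm
      _ ≤ C ^ δ := Real.rpow_le_rpow (by positivity) (le_max_right _ _) hδ.le
  rw [h2, h3] at h1
  have h5 : ε * (C ^ δ * ε⁻¹) = C ^ δ := by field_simp
  linarith

/-- At `ρ = √B` the left side is `C^δ log ε⁻¹`, while `log B ≤ (log C + 2/δ) log ε⁻¹`. For large `C`
this is contradictory, since `C^δ` outgrows `log C`. The restriction `ε ≤ 1/e` ensures `log ε⁻¹ ≥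
1`. -/
theorem exists_log_power_bound {δ K ρ₀ : ℝ} (hδ : 0 < δ) (hK : 0 ≤ K) :
    ∃ C : ℝ, 0 < C ∧ ∀ ε, 0 < ε → ε ≤ Real.exp (-1) → ∀ T,
      (∀ ρ, ρ₀ ≤ ρ → ρ ^ 2 < T → ε * ρ ^ (2 * δ) ≤ K * Real.log ρ) →
        T ≤ C * (ε⁻¹ * Real.log ε⁻¹) ^ δ⁻¹ := by
  have hlim : Tendsto (fun x : ℝ => K * (Real.log x + 2 * δ⁻¹) / x ^ δ) atTop (𝓝 0) := by
    have h1 := (isLittleO_log_rpow_atTop hδ).tendsto_div_nhds_zero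
    have h2 := (tendsto_rpow_neg_atTop hδ).const_mul (2 * δ⁻¹)
    have h3 := (h1.add h2).const_mul K
    simp only [mul_zero, add_zero] at h3
    refine h3.congr' ?_
    filter_upwards [eventually_gt_atTop 0] with x hx
    rw [Real.rpow_neg hx.le]
    ring
  obtain ⟨C, hC1, hC2, hC⟩ := ((hlim.eventually_lt_const one_pos).and
    ((eventually_ge_atTop 1).and (eventually_ge_atTop (ρ₀ ^ 2)))).exists
  have hC0 : 0 < C := by linarith
  have hCδ : 0 < C ^ δ := Real.rpow_pos_of_pos hC0 _
  rw [div_lt_one hCδ] at hC1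
  refine ⟨C, hC0, fun ε hε hε1 T h => ?_⟩
  by_contra hT
  set x := ε⁻¹ with hx
  have hx0 : 0 < x := inv_pos.2 hε
  have hxe : Real.exp 1 ≤ x := by
    rw [hx, ← inv_inv (Real.exp 1), ← Real.exp_neg]
    exact inv_anti₀ hε hε1
  have hl : 1 ≤ Real.log x := (Real.le_log_iff_exp_le hx0).2 hxe
  set y := x * Real.log x with hy
  have hx1 : 1 ≤ x := by linarith [Real.add_one_le_exp 1]
  have hy1 : 1 ≤ y := one_le_mul_of_one_le_of_one_le hx1 hl
  have hy' : 1 ≤ y ^ δ⁻¹ := Real.one_le_rpow hy1 (by positivity)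
  set B := C * y ^ δ⁻¹ with hB
  have hCB : C ≤ B := le_mul_of_one_le_right hC0.le hy'
  have hB0 : 0 < B := by linarith
  have h1 := h (√B) (Real.le_sqrt_of_sq_le (hC.trans hCB))
    (by rw [Real.sq_sqrt hB0.le]; exact not_le.1 hT)
  have h2 : √B ^ (2 * δ) = B ^ δ := by
    rw [Real.sqrt_eq_rpow, ← Real.rpow_mul hB0.le]
    congr 1
    ring
  have h3 : B ^ δ = C ^ δ * y := by
    rw [hB, Real.mul_rpow hC0.le (by positivity), Real.rpow_inv_rpow (by linarith) hδ.ne']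
  have h4 : Real.log B ≤ Real.log C + 2 * δ⁻¹ * Real.log x := by
    rw [hB, Real.log_mul hC0.ne' (by positivity), Real.log_rpow (by linarith), hy,
      Real.log_mul hx0.ne' (by positivity)]
    have h5 : Real.log (Real.log x) ≤ Real.log x :=
      (Real.log_le_sub_one_of_pos (by linarith)).trans (by linarith)
    have h6 : 0 ≤ δ⁻¹ := by positivity
    nlinarith
  have h5 : Real.log B ≤ (Real.log C + 2 * δ⁻¹) * Real.log x := by
    have := Real.log_nonneg hC2
    nlinarith
  have h6 : Real.log (√B) ≤ Real.log B := by
    rw [Real.log_sqrt hB0.le]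
    have := Real.log_nonneg (hC2.trans hCB)
    linarith
  have h7 : ε * (C ^ δ * y) = C ^ δ * Real.log x := by
    rw [hy, hx]; field_simp
  rw [h2, h3, h7] at h1
  have h8 := mul_le_mul_of_nonneg_left (h6.trans h5) hK
  nlinarith

/-- The dyadic form of the inequality `s' ≥ (s + e) ^ q / (C r L(r) ^ (q - 1))`. -/
structure DyadicGrowth (q C K e : ℝ) (L : ℝ → ℝ) (ρ₀ T : ℝ) (s : ℝ → ℝ) : Prop where
  nonneg : ∀ ρ, ρ₀ ≤ ρ → ρ ^ 2 < T → 0 ≤ s (ρ / 2)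
  le_sub : ∀ ρ, ρ₀ ≤ ρ → ρ ^ 2 < T →
    (s (ρ / 2) + e) ^ q ≤ C * L ρ ^ (q - 1) * (s ρ - s (ρ / 2))
  le : ∀ ρ, ρ₀ ≤ ρ → ρ ^ 2 < T → s (ρ / 2) + e ≤ K * L ρ

/-- Apply the discrete inequality to `s(ρ₀ 2ⁿ / 2) + e` with weights `L(ρ₀ 2ⁿ)`. The initial value
is at least `e`, so the total drop is at most `e^{1-q}`. -/
theorem DyadicGrowth.sum_le {q C K e ρ₀ T : ℝ} {L s : ℝ → ℝ} (h : DyadicGrowth q C K e L ρ₀ T s)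
    (hq : 1 < q) (hC : 0 < C) (hK : 0 ≤ K) (he : 0 < e) (hρ₀ : 0 < ρ₀)
    (hL : ∀ ρ, ρ₀ ≤ ρ → 0 < L ρ) {N : ℕ} (hN : (ρ₀ * 2 ^ N) ^ 2 < T) :
    (q - 1) / (q * (C + K ^ (q - 1))) * ∑ n ∈ Finset.range N, (L (ρ₀ * 2 ^ n) ^ (q - 1))⁻¹
      ≤ e ^ (1 - q) := by
  have h1 : ∀ n : ℕ, ρ₀ ≤ ρ₀ * 2 ^ n := fun n =>
    le_mul_of_one_le_right hρ₀.le (one_le_pow₀ one_le_two)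
  have h2 : ∀ n, n ≤ N → (ρ₀ * 2 ^ n) ^ 2 < T := fun n hn => by
    refine lt_of_le_of_lt ?_ hN
    gcongr
    exact one_le_two
  have h3 : ∀ n, n ≤ N → 0 ≤ s (ρ₀ * 2 ^ n / 2) := fun n hn => h.nonneg _ (h1 n) (h2 n hn)
  refine (sum_inv_rpow_le (z := fun n => s (ρ₀ * 2 ^ n / 2) + e) hq hC hK
    (fun n hn => by linarith [h3 n hn]) (fun n _ => hL _ (h1 n)) (fun n hn => ?_)
    fun n hn => h.le _ (h1 n) (h2 n hn.le)).trans ?_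
  · have := h.le_sub _ (h1 n) (h2 n hn.le)
    have h4 : ρ₀ * 2 ^ (n + 1) / 2 = ρ₀ * 2 ^ n := by ring
    rw [h4]
    refine this.trans_eq ?_
    ring
  · exact Real.rpow_le_rpow_of_nonpos he (by linarith [h3 0 (Nat.zero_le _)]) (by linarith)

/-- With `L = 1` every dyadic step costs the same amount, so at most of order `ε^{-(q-1)}` steps fit
below `√T`; and `T` is exponential in the number of steps. -/
theorem exists_exp_bound {q C K c ρ₀ : ℝ} (hq : 1 < q) (hC : 0 < C) (hK : 0 ≤ K) (hc : 0 < c)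
    (hρ₀ : 1 ≤ ρ₀) :
    ∃ C' : ℝ, 0 < C' ∧ ∀ ε, 0 < ε → ε ≤ 1 → ∀ T s,
      DyadicGrowth q C K (c * ε) (fun _ => 1) ρ₀ T s → T ≤ Real.exp (C' * ε ^ (-(q - 1))) := by
  set c₀ := (q - 1) / (q * (C + K ^ (q - 1))) with hc₀
  have hq1 : 0 < q - 1 := by linarith
  have hc₀0 : 0 < c₀ := by positivity
  have hlog := Real.log_nonneg hρ₀
  have hlog4 : 0 < Real.log 4 := Real.log_pos (by norm_num)
  refine ⟨2 * Real.log ρ₀ + Real.log 4 * (c ^ (1 - q) / c₀ + 1), by positivity,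
    fun ε hε hε1 T s h => ?_⟩
  set E := ε ^ (-(q - 1)) with hE
  have hE1 : 1 ≤ E :=
    Real.one_le_rpow_of_pos_of_le_one_of_nonpos hε hε1 (by linarith)
  -- The first integer for which the total cost `c₀ N` exceeds `(cε)^{1-q}`.
  set N := ⌊c ^ (1 - q) / c₀ * E⌋₊ + 1 with hN
  have hNgt : c ^ (1 - q) / c₀ * E < N := by
    rw [hN]; push_cast; exact Nat.lt_floor_add_one _
  have hNle : (N : ℝ) ≤ (c ^ (1 - q) / c₀ + 1) * E := by
    have : (⌊c ^ (1 - q) / c₀ * E⌋₊ : ℝ) ≤ c ^ (1 - q) / c₀ * E := Nat.floor_le (by positivity)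
    rw [hN]; push_cast; linarith
  have hT : T ≤ (ρ₀ * 2 ^ N) ^ 2 := by
    by_contra hT
    have h1 := h.sum_le hq hC hK (by positivity) (by linarith) (fun _ _ => one_pos) (not_le.1 hT)
    simp only [Real.one_rpow, inv_one, Finset.sum_const, Finset.card_range, nsmul_eq_mul,
      mul_one, ← hc₀] at h1
    rw [Real.mul_rpow hc.le hε.le, show 1 - q = -(q - 1) by ring, ← hE] at h1
    rw [show 1 - q = -(q - 1) by ring, div_mul_eq_mul_div, div_lt_iff₀ hc₀0] at hNgt
    linarith
  have h2 : (ρ₀ * 2 ^ N) ^ 2 = Real.exp (2 * Real.log ρ₀ + N * Real.log 4) := by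
    rw [Real.exp_add, mul_comm (2 : ℝ), mul_comm (N : ℝ), ← Real.rpow_def_of_pos (by linarith),
      ← Real.rpow_def_of_pos (by norm_num), Real.rpow_natCast, mul_pow, ← pow_mul, mul_comm N,
      pow_mul]
    norm_num
  rw [h2] at hT
  refine hT.trans (Real.exp_le_exp.2 ?_)
  nlinarith [mul_le_mul_of_nonneg_left hNle hlog4.le]

/-- For `q = 2` and `L = log` the cost of step `n` is of order `1/(n+1)`. The harmonic sum grows
like `log N`, so `N` may be as large as an exponential of `1/ε`, and `T` is exponential in `N`. -/
theorem exists_exp_exp_bound {C K c ρ₀ : ℝ} (hC : 0 < C) (hK : 0 ≤ K) (hc : 0 < c)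
    (hρ₀ : 1 < ρ₀) :
    ∃ C' : ℝ, 0 < C' ∧ ∀ ε, 0 < ε → ε ≤ 1 → ∀ T s,
      DyadicGrowth 2 C K (c * ε) Real.log ρ₀ T s → T ≤ Real.exp (Real.exp (C' * ε⁻¹)) := by
  set c₀ := ((2 : ℝ) - 1) / (2 * (C + K ^ ((2 : ℝ) - 1))) with hc₀
  have hKp := Real.rpow_nonneg hK ((2 : ℝ) - 1)
  have hc₀0 : 0 < c₀ := div_pos (by norm_num) (by linarith)
  have hlog := Real.log_pos hρ₀
  have hlog4 : 0 < Real.log 4 := Real.log_pos (by norm_num)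
  have hlog2 : Real.log 2 ≤ 1 := by
    linarith [Real.log_two_lt_d9]
  -- Chosen so that `log(N + 1) > a/ε` makes the total cost exceed `(cε)⁻¹`.
  set a := (Real.log ρ₀ + 1) / (c₀ * c) with ha
  have ha0 : 0 < a := by positivity
  set b := 2 * Real.log ρ₀ + Real.log 4 with hb
  refine ⟨b + a, by positivity, fun ε hε hε1 T s h => ?_⟩
  set N := ⌊Real.exp (a * ε⁻¹)⌋₊ with hN
  have hNgt : Real.exp (a * ε⁻¹) < N + 1 := Nat.lt_floor_add_one _
  have hNle : (N : ℝ) ≤ Real.exp (a * ε⁻¹) := Nat.floor_le (by positivity)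
  have hε' : 1 ≤ ε⁻¹ := (one_le_inv₀ hε).2 hε1
  have hT : T ≤ (ρ₀ * 2 ^ N) ^ 2 := by
    by_contra hT
    have h1 := h.sum_le one_lt_two hC hK (by positivity) (by linarith)
      (fun ρ hρ => Real.log_pos (by linarith)) (not_le.1 hT)
    rw [← hc₀, show (1 : ℝ) - 2 = -1 by norm_num, Real.rpow_neg_one] at h1
    have h2 : (Real.log ρ₀ + 1)⁻¹ * (harmonic N : ℝ)
        ≤ ∑ n ∈ Finset.range N, (Real.log (ρ₀ * 2 ^ n) ^ ((2 : ℝ) - 1))⁻¹ := by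
      rw [harmonic]
      push_cast
      rw [Finset.mul_sum]
      refine Finset.sum_le_sum fun n _ => ?_
      rw [show (2 : ℝ) - 1 = 1 by norm_num, Real.rpow_one, ← mul_inv,
        Real.log_mul (by linarith) (by positivity), Real.log_pow]
      have hn : (0 : ℝ) ≤ n := Nat.cast_nonneg n
      have hl2 : 0 < Real.log 2 := Real.log_pos one_lt_two
      apply inv_anti₀ (by positivity)
      -- `log ρ₀ + n log 2 ≤ (log ρ₀ + 1)(n + 1)`, using `log 2 ≤ 1`.
      nlinarith
    have h3 : Real.log (N + 1) ≤ harmonic N := by exact_mod_cast log_add_one_le_harmonic N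
    have h4 : a * ε⁻¹ < Real.log (N + 1) := (Real.lt_log_iff_exp_lt (by positivity)).2 hNgt
    have h5 : c₀ * ((Real.log ρ₀ + 1)⁻¹ * (a * ε⁻¹)) = (c * ε)⁻¹ := by
      rw [ha]; field_simp
    have h6 : c₀ * ((Real.log ρ₀ + 1)⁻¹ * (a * ε⁻¹))
        < c₀ * ((Real.log ρ₀ + 1)⁻¹ * (harmonic N : ℝ)) := by
      have : a * ε⁻¹ < harmonic N := h4.trans_le h3
      gcongr
    have h7 := mul_le_mul_of_nonneg_left h2 hc₀0.le
    linarith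
  have h2 : (ρ₀ * 2 ^ N) ^ 2 = Real.exp (2 * Real.log ρ₀ + N * Real.log 4) := by
    rw [Real.exp_add, mul_comm (2 : ℝ), mul_comm (N : ℝ), ← Real.rpow_def_of_pos (by linarith),
      ← Real.rpow_def_of_pos (by norm_num), Real.rpow_natCast, mul_pow, ← pow_mul, mul_comm N,
      pow_mul]
    norm_num
  rw [h2] at hT
  refine hT.trans (Real.exp_le_exp.2 ?_)
  have h3 : 1 ≤ Real.exp (a * ε⁻¹) := Real.one_le_exp (by positivity)
  have h4 : b ≤ Real.exp (b * ε⁻¹) := by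
    have : b ≤ b * ε⁻¹ := le_mul_of_one_le_right (by positivity) hε'
    linarith [Real.add_one_le_exp (b * ε⁻¹)]
  calc 2 * Real.log ρ₀ + N * Real.log 4 ≤ b * Real.exp (a * ε⁻¹) := by
        rw [hb]; nlinarith
    _ ≤ Real.exp (b * ε⁻¹) * Real.exp (a * ε⁻¹) := by gcongr
    _ = _ := by rw [← Real.exp_add]; ring_nf

end LifespanBounds

section ScaledEstimates

variable {d k : ℕ} {α β : ℝ} {p : Fin k → ℝ} {L : ℝ → ℝ} {c C ρ₀ ε T : ℝ}
  {J A S : Fin k → ℝ → ℝ}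

/-! ### Scaled mass estimates -/

/-- The scaling factor that makes the cyclic system of mass estimates homogeneous. -/
def massScale (d : ℕ) (p : Fin k → ℝ) (L : ℝ → ℝ) (l : Fin k) (ρ : ℝ) : ℝ :=
  ρ ^ (2 * gammaVec p l - d) / L ρ

theorem massScale_eq {γ : ℝ} {l : Fin k} (h : gammaVec p l = γ) (hγ : γ = d / 2) (ρ : ℝ) :
    massScale d p L l ρ = (L ρ)⁻¹ := by
  rw [massScale, h, hγ, mul_div_cancel₀ _ two_ne_zero, sub_self, Real.rpow_zero, one_div]

/-- This is where the definition of `γ` matters: `(D+2)(1-1/q) - 2 + 2γ' - D = (2γ - D)/q` is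
equivalent to `q γ' - γ = 1`. The factor `lam` enters with total power `-1/q` on both sides. -/
theorem scaling_identity {a ρ lam q γ γ' D : ℝ} (ha : 0 ≤ a) (hρ : 0 < ρ) (hlam : 0 < lam)
    (hq : 0 < q) (h : q * γ' - γ = 1) :
    a ^ q⁻¹ * ((ρ ^ (D + 2) * lam) ^ (1 - q⁻¹) / ρ ^ (2 : ℝ)) * (ρ ^ (2 * γ' - D) / lam)
      = (a * (ρ ^ (2 * γ - D) / lam)) ^ q⁻¹ := by
  rw [Real.mul_rpow ha (by positivity), Real.div_rpow (by positivity) hlam.le,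
    Real.mul_rpow (by positivity) hlam.le, ← Real.rpow_mul hρ.le, ← Real.rpow_mul hρ.le,
    Real.rpow_sub hlam, Real.rpow_one]
  have h1 : ρ ^ ((D + 2) * (1 - q⁻¹)) * ρ ^ (2 * γ' - D)
      = ρ ^ ((2 * γ - D) * q⁻¹) * ρ ^ (2 : ℝ) := by
    rw [← Real.rpow_add hρ, ← Real.rpow_add hρ]
    congr 1
    have : γ = q * γ' - 1 := by linarith
    rw [this]
    field_simp
    ring
  have hρ2 : 0 < ρ ^ (2 : ℝ) := by positivity
  have hl : 0 < lam ^ q⁻¹ := by positivity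
  calc _ = a ^ q⁻¹ * (ρ ^ ((D + 2) * (1 - q⁻¹)) * ρ ^ (2 * γ' - D))
        / (ρ ^ (2 : ℝ) * lam ^ q⁻¹) := by
        field_simp
    _ = _ := by
        rw [h1]
        field_simp

namespace MassEstimate

theorem scaled_le (h : MassEstimate d p L c C ρ₀ ε T J A S) (hk : 2 ≤ k) (hp : ∀ l, 1 < p l)
    (hρ₀ : 0 < ρ₀) (hL : ∀ ρ, ρ₀ ≤ ρ → 0 < L ρ) {ρ : ℝ} (hρ : ρ₀ ≤ ρ) (hT : ρ ^ 2 < T)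
    (l : Fin k) :
    J (cycPred l) ρ * massScale d p L (cycPred l) ρ
        + c * ε * massScale d p L (cycPred l) ρ
      ≤ C * (A l ρ * massScale d p L l ρ) ^ (p l)⁻¹ := by
  have hρ' : 0 < ρ := hρ₀.trans_le hρ
  have hlam := hL ρ hρ
  have hs : 0 ≤ massScale d p L (cycPred l) ρ := by unfold massScale; positivity
  have h1 := mul_le_mul_of_nonneg_right (h.key l ρ hρ hT) hs
  have h2 := scaling_identity (D := d) (h.annulus_nonneg l ρ hρ hT) hρ' hlam
    (by linarith [hp l] : 0 < p l) (gammaVec_eq hk hp l)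
  rw [← add_mul, massScale, massScale, ← h2]
  refine h1.trans_eq ?_
  rw [massScale, Real.rpow_two, ← Real.rpow_natCast ρ (d + 2)]
  push_cast
  ring

/-- The hypotheses of the estimates for cyclic systems, for the scaled masses. -/
theorem exists_scaled_bound (hk : 2 ≤ k) (hp : ∀ l, 1 < p l) (hρ₀ : 0 < ρ₀)
    (hL : ∀ ρ, ρ₀ ≤ ρ → 0 < L ρ) (hc : 0 < c) (hC : 1 ≤ C) :
    ∃ K : ℝ, 1 ≤ K ∧ ∀ ε, 0 < ε → ∀ T J A S, MassEstimate d p L c C ρ₀ ε T J A S →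
      ∀ ρ, ρ₀ ≤ ρ → ρ ^ 2 < T → ∀ l,
        J l ρ * massScale d p L l ρ ≤ K ∧ c * ε * massScale d p L l ρ ≤ K := by
  obtain ⟨K, hK, h⟩ := exists_cyclic_bound hk hp hC
  refine ⟨K, hK, fun ε hε T J A S hM ρ hρ hT => ?_⟩
  have hρ' : 0 < ρ := hρ₀.trans_le hρ
  have hlam := hL ρ hρ
  have hs : ∀ l, 0 ≤ massScale d p L l ρ := fun l => by unfold massScale; positivity
  exact h (fun l => J l ρ * massScale d p L l ρ) (fun l => A l ρ * massScale d p L l ρ)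
    (fun l => c * ε * massScale d p L l ρ)
    (fun l => mul_nonneg (hM.annulus_nonneg l ρ hρ hT) (hs l))
    (fun l => mul_le_mul_of_nonneg_right (hM.annulus_le l ρ hρ hT) (hs l))
    (fun l => mul_nonneg (by positivity) (hs l))
    (hM.scaled_le hk hp hρ₀ hL hρ hT)

/-- The bound on the data term is strongest for a component at which `γ` attains its maximum. -/
theorem power_le {K : ℝ}
    (h : ∀ ρ, ρ₀ ≤ ρ → ρ ^ 2 < T → ∀ l,
      J l ρ * massScale d p L l ρ ≤ K ∧ c * ε * massScale d p L l ρ ≤ K)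
    (hL : ∀ ρ, ρ₀ ≤ ρ → 0 < L ρ) (hc : 0 < c) {m : Fin k} (hm : gammaVec p m = gammaMax p) :
    ∀ ρ, ρ₀ ≤ ρ → ρ ^ 2 < T → ε * ρ ^ (2 * (gammaMax p - d / 2)) ≤ K / c * L ρ := by
  intro ρ hρ hT
  have h1 := (h ρ hρ hT m).2
  rw [massScale, hm, ← mul_div_assoc, div_le_iff₀ (hL ρ hρ)] at h1
  rw [div_mul_eq_mul_div, le_div_iff₀ hc, show 2 * (gammaMax p - d / 2) = 2 * gammaMax p - d by ring]
  linarith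

/-- Growth of a critical component, for constant `L`. -/
theorem dyadicGrowth_component (hM : MassEstimate d p (fun _ => 1) c C ρ₀ ε T J A S)
    (hk : 2 ≤ k) (hp : ∀ l, 1 < p l) (hρ₀ : 0 < ρ₀) (hc : 0 < c) (hε : 0 < ε) (hC : 1 ≤ C)
    {K : ℝ} (h : ∀ ρ, ρ₀ ≤ ρ → ρ ^ 2 < T → ∀ l,
      J l ρ * massScale d p (fun _ => 1) l ρ ≤ K ∧ c * ε * massScale d p (fun _ => 1) l ρ ≤ K)
    {m : Fin k} (hm : gammaVec p m = gammaMax p) (hγ : gammaMax p = d / 2) :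
    DyadicGrowth (∏ l, p l) ((C ^ k) ^ (∏ l, p l)) (2 * K) (c * ε) (fun _ => 1) ρ₀ T (S m) := by
  have hq0 : 0 < ∏ l, p l := Finset.prod_pos fun l _ => by linarith [hp l]
  have hsm := massScale_eq (d := d) (L := fun _ => 1) hm hγ
  simp only [inv_one] at hsm
  refine ⟨fun ρ hρ hT => hM.cylinder_nonneg m ρ hρ hT, fun ρ hρ hT => ?_, fun ρ hρ hT => ?_⟩
  · have hρ' : 0 < ρ := hρ₀.trans_le hρ
    have hs : ∀ l, 0 ≤ massScale d p (fun _ => 1) l ρ := fun l => by unfold massScale; positivity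
    -- The other components need not be critical, so their scales may depend on `ρ`. Going around
    -- the full cycle returns to `m`, whose scale is `1`.
    have h1 := cyclic_le hk hp hC
      (fun l => mul_nonneg (hM.annulus_nonneg l ρ hρ hT) (hs l))
      (fun l => mul_le_mul_of_nonneg_right (hM.annulus_le l ρ hρ hT) (hs l))
      (fun l => mul_nonneg (by positivity : 0 ≤ c * ε) (hs l))
      (hM.scaled_le hk hp hρ₀ (fun _ _ => one_pos) hρ hT) m
    simp only [hsm, mul_one] at h1
    have h2 := hM.cylinder_nonneg m ρ hρ hT
    have h3 := hM.cylinder_le m ρ hρ hT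
    have hA := hM.annulus_nonneg m ρ hρ hT
    have hcε : 0 < c * ε := by positivity
    calc (S m (ρ / 2) + c * ε) ^ (∏ l, p l)
        ≤ (C ^ k * A m ρ ^ (∏ l, p l)⁻¹) ^ (∏ l, p l) :=
          Real.rpow_le_rpow (by linarith) (by linarith) hq0.le
      _ = (C ^ k) ^ (∏ l, p l) * A m ρ := by
          rw [Real.mul_rpow (by positivity) (by positivity), Real.rpow_inv_rpow hA hq0.ne']
      _ ≤ (C ^ k) ^ (∏ l, p l) * 1 ^ ((∏ l, p l) - 1) * (S m ρ - S m (ρ / 2)) := by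
          rw [Real.one_rpow, mul_one]
          have := hM.annulus_le_sub m ρ hρ hT
          gcongr
  · have h1 := h ρ hρ hT m
    rw [hsm, mul_one, mul_one] at h1
    have := hM.cylinder_le m ρ hρ hT
    linarith

/-- Growth of the sum of the components, if all exponents coincide. -/
theorem dyadicGrowth_sum (hM : MassEstimate d p L c C ρ₀ ε T J A S)
    (hk : 2 ≤ k) (hp : ∀ l, 1 < p l) (hρ₀ : 0 < ρ₀) (hL : ∀ ρ, ρ₀ ≤ ρ → 0 < L ρ)
    (hc : 0 < c) (hε : 0 < ε) (hC : 1 ≤ C)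
    {K : ℝ} (h : ∀ ρ, ρ₀ ≤ ρ → ρ ^ 2 < T → ∀ l,
      J l ρ * massScale d p L l ρ ≤ K ∧ c * ε * massScale d p L l ρ ≤ K)
    {q : ℝ} (hq : ∀ l, p l = q) (hγ : gammaMax p = d / 2) :
    DyadicGrowth q ((k * C) ^ q) (k * (2 * K)) (c * ε) L ρ₀ T (fun ρ => ∑ l, S l ρ) := by
  have hq0 : 0 < q := by
    have := hp ⟨0, by omega⟩
    rw [hq] at this
    linarith
  have hsm : ∀ l ρ, massScale d p L l ρ = (L ρ)⁻¹ := fun l =>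
    massScale_eq ((gammaVec_eq_of_forall_eq hk hp hq).1 l) hγ
  have hk1 : (1 : ℝ) ≤ k := by exact_mod_cast (by omega : 1 ≤ k)
  have hcε : 0 < c * ε := by positivity
  have hsum : ∀ ρ, ρ₀ ≤ ρ → ρ ^ 2 < T →
      ∑ l, S l (ρ / 2) + c * ε ≤ ∑ l, (J l ρ + c * ε) := fun ρ hρ hT => by
    rw [Finset.sum_add_distrib]
    have h1 : ∑ l, S l (ρ / 2) ≤ ∑ l, J l ρ :=
      Finset.sum_le_sum fun l _ => hM.cylinder_le l ρ hρ hT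
    have h2 : c * ε ≤ ∑ _l : Fin k, c * ε := by
      simp only [Finset.sum_const, Finset.card_univ, Fintype.card_fin, nsmul_eq_mul]
      exact le_mul_of_one_le_left hcε.le hk1
    linarith
  have hnonneg : ∀ ρ, ρ₀ ≤ ρ → ρ ^ 2 < T → 0 ≤ ∑ l, S l (ρ / 2) := fun ρ hρ hT =>
    Finset.sum_nonneg fun l _ => hM.cylinder_nonneg l ρ hρ hT
  refine ⟨hnonneg, fun ρ hρ hT => ?_, fun ρ hρ hT => ?_⟩
  · have hlam := hL ρ hρ
    set a := ∑ l, A l ρ with ha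
    have ha0 : 0 ≤ a := Finset.sum_nonneg fun l _ => hM.annulus_nonneg l ρ hρ hT
    -- All scales equal `1/L`. Replacing each annulus mass by their sum `a` closes the system after
    -- a single step, with exponent `q` instead of the product.
    have h1 : ∀ l, J (cycPred l) ρ + c * ε ≤ L ρ * (C * (a / L ρ) ^ q⁻¹) := fun l => by
      have h2 := hM.scaled_le hk hp hρ₀ hL hρ hT l
      rw [hsm, hsm, ← add_mul, hq, ← div_eq_mul_inv, ← div_eq_mul_inv, div_le_iff₀ hlam] at h2
      rw [mul_comm (L ρ)]
      refine h2.trans ?_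
      have h3 : A l ρ ≤ a := Finset.single_le_sum (f := fun l => A l ρ)
        (fun j _ => hM.annulus_nonneg j ρ hρ hT) (Finset.mem_univ l)
      have h4 := hM.annulus_nonneg l ρ hρ hT
      gcongr
    have h2 : ∑ l, (J l ρ + c * ε) ≤ k * C * L ρ * (a / L ρ) ^ q⁻¹ := by
      rw [← (cycPred_bijective hk).sum_comp fun l => J l ρ + c * ε]
      refine (Finset.sum_le_sum fun l _ => h1 l).trans_eq ?_
      simp only [Finset.sum_const, Finset.card_univ, Fintype.card_fin, nsmul_eq_mul]
      ring
    have h3 : a ≤ ∑ l, S l ρ - ∑ l, S l (ρ / 2) := by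
      rw [← Finset.sum_sub_distrib]
      exact Finset.sum_le_sum fun l _ => hM.annulus_le_sub l ρ hρ hT
    have h4 := hnonneg ρ hρ hT
    calc (∑ l, S l (ρ / 2) + c * ε) ^ q
        ≤ (k * C * L ρ * (a / L ρ) ^ q⁻¹) ^ q :=
          Real.rpow_le_rpow (by linarith) ((hsum ρ hρ hT).trans h2) hq0.le
      -- The weight `L^{q-1}` arises as `(L (a/L)^{1/q})^q = L^{q-1} a`.
      _ = (k * C) ^ q * L ρ ^ (q - 1) * a := by
          rw [Real.mul_rpow (by positivity) (by positivity), Real.mul_rpow (by positivity) hlam.le,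
            Real.rpow_inv_rpow (by positivity) hq0.ne', Real.rpow_sub_one hlam.ne']
          ring
      _ ≤ _ := by gcongr
  · refine (hsum ρ hρ hT).trans ?_
    have hlam := hL ρ hρ
    have h1 : ∀ l, J l ρ + c * ε ≤ 2 * K * L ρ := fun l => by
      obtain ⟨h1, h2⟩ := h ρ hρ hT l
      rw [hsm, ← div_eq_mul_inv, div_le_iff₀ hlam] at h1 h2
      linarith
    refine (Finset.sum_le_sum fun l _ => h1 l).trans_eq ?_
    simp only [Finset.sum_const, Finset.card_univ, Fintype.card_fin, nsmul_eq_mul]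
    ring

end MassEstimate

/-! ### Comparison functions for the weight -/

/-- For `ρ ≥ e` one has `log ρ ≥ 1`, so the constant `α/β` is absorbed into the logarithm. -/
theorem psiRad_two_le (hβ : β ≠ 0) (hαβ : 0 ≤ α * β) {ρ r : ℝ}
    (hρ : Real.exp 1 ≤ ρ) (hr : 1 ≤ r) (hrρ : r ≤ ρ) :
    psiRad 2 α β r ≤ (1 + α / β) * Real.log ρ := by
  have h0 : 0 ≤ α / β := by
    have : α / β = α * β / β ^ 2 := by field_simp
    rw [this]; positivity
  have h1 : Real.log r ≤ Real.log ρ := Real.log_le_log (by linarith) hrρ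
  have h2 : 1 ≤ Real.log ρ := (Real.le_log_iff_exp_le (by linarith)).2 hρ
  simp only [psiRad, hβ, if_false, if_true]
  nlinarith

theorem exists_psiRad_le (hd : 2 ≤ d) (hαβ : 0 ≤ α * β) (h : ¬(β ≠ 0 ∧ d = 2)) :
    ∃ m : ℝ, 0 ≤ m ∧ ∀ r, 1 ≤ r → psiRad d α β r ≤ m := by
  by_cases hβ : β = 0
  · exact ⟨1, zero_le_one, fun r _ => by simp [psiRad, hβ]⟩
  have hd2 : d ≠ 2 := fun hd2 => h ⟨hβ, hd2⟩
  have h0 : 0 ≤ α / β := by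
    have : α / β = α * β / β ^ 2 := by field_simp
    rw [this]; positivity
  have hd' : (0 : ℝ) ≤ d - 2 := by
    have : (2 : ℝ) ≤ d := by exact_mod_cast hd
    linarith
  refine ⟨1 + α / β * (d - 2), by positivity, fun r hr => ?_⟩
  simp only [psiRad, hβ, hd2, if_false]
  have : 0 ≤ r ^ (2 - (d : ℝ)) := by positivity
  linarith

end ScaledEstimates

end DampedWave

end

/-! ### Proof of the lifespan bounds -/

theorem theorem2p2 (d k : ℕ) (hd : 2 ≤ d) (hk : 2 ≤ k) (α β : ℝ)
    (hαβ_ne : (α, β) ≠ (0, 0)) (hαβ : 0 ≤ α * β)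
    (p : Fin k → ℝ) (hp : ∀ l, 1 < p l)
    (hγ : (d : ℝ) / 2 ≤ DampedWave.gammaMax p)
    (u₀ u₁ : Fin k → DampedWave.Space d → ℂ)
    (hu₁ : ∀ l, MemLp (u₁ l) 2 (DampedWave.exteriorMeasure d))
    (hint : ∀ l, IntegrableOn
      (fun x => (u₀ l x + u₁ l x) * ((DampedWave.Psi d α β x : ℝ) : ℂ))
      (DampedWave.exterior d) volume)
    (hpos : ∀ l, 0 < (∫ x in DampedWave.exterior d,
      (u₀ l x + u₁ l x) * ((DampedWave.Psi d α β x : ℝ) : ℂ)).re) :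
    ∃ ε₀ : ℝ, 0 < ε₀ ∧ ∃ C : ℝ, 0 < C ∧ ∀ ε : ℝ, 0 < ε → ε ≤ ε₀ →
      -- Dirichlet and Robin conditions in two dimensions
      (β ≠ 0 → d = 2 → 1 < DampedWave.gammaMax p →
        DampedWave.lifespan α β p ε u₀ u₁ ≤ ENNReal.ofReal
          (C * (ε⁻¹ * Real.log ε⁻¹) ^ (DampedWave.gammaMax p - 1)⁻¹)) ∧
      (β ≠ 0 → d = 2 → DampedWave.gammaMax p = 1 → (∀ i j, p i = p j) →
        DampedWave.lifespan α β p ε u₀ u₁ ≤ ENNReal.ofReal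
          (Real.exp (Real.exp (C * ε⁻¹)))) ∧
      -- all remaining cases: `β ≠ 0` and `d ≥ 3`, or `β = 0` and `d ≥ 2`
      ((β ≠ 0 ∧ 3 ≤ d) ∨ β = 0 → (d : ℝ) / 2 < DampedWave.gammaMax p →
        DampedWave.lifespan α β p ε u₀ u₁ ≤ ENNReal.ofReal
          (C * ε ^ (-(DampedWave.gammaMax p - (d : ℝ) / 2)⁻¹))) ∧
      ((β ≠ 0 ∧ 3 ≤ d) ∨ β = 0 → DampedWave.gammaMax p = (d : ℝ) / 2 → (∃ i j, p i ≠ p j) →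
        DampedWave.lifespan α β p ε u₀ u₁ ≤ ENNReal.ofReal
          (Real.exp (C * ε ^ (-((∏ l, p l) - 1))))) ∧
      ((β ≠ 0 ∧ 3 ≤ d) ∨ β = 0 → DampedWave.gammaMax p = (d : ℝ) / 2 →
        ∀ q : ℝ, (∀ l, p l = q) →
          DampedWave.lifespan α β p ε u₀ u₁ ≤ ENNReal.ofReal
            (Real.exp (C * ε ^ (-(q - 1))))) := by 
  have : Nonempty (Fin k) := ⟨⟨0, by omega⟩⟩
  obtain ⟨mx, hmx, -⟩ := DampedWave.exists_gammaVec_eq_gammaMax (by omega : 0 < k) p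
  -- The division is by the growth of `Ψ`: logarithmic here, bounded in the other cases.
  by_cases hcase : β ≠ 0 ∧ d = 2
  · obtain ⟨hβ, rfl⟩ := hcase
    have hother : ¬((β ≠ 0 ∧ 3 ≤ 2) ∨ β = 0) := by simp [hβ]
    have hm : 0 ≤ 1 + α / β := by
      have : α / β = α * β / β ^ 2 := by field_simp
      rw [this]; positivity
    have he : 1 < Real.exp 1 := Real.one_lt_exp_iff.2 one_pos
    obtain ⟨ρ₀, c, C, hρ₀, hρ₁, hc, hC, hmass⟩ := DampedWave.exists_massEstimate hd (by omega) hαβ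
      hp hu₁ hint hpos (L := Real.log) (ρ₁ := Real.exp 1) hm
      (fun ρ hρ => Real.log_pos (by linarith))
      (fun ρ hρ r hr hrρ => DampedWave.psiRad_two_le hβ hαβ hρ hr hrρ)
    have hL : ∀ ρ, ρ₀ ≤ ρ → 0 < Real.log ρ := fun ρ hρ => Real.log_pos (by linarith)
    obtain ⟨K, hK, hbound⟩ := DampedWave.MassEstimate.exists_scaled_bound (d := 2) hk hp
      (by linarith) hL hc hC
    -- `ε₀ = 1/e`, so that `log ε⁻¹ ≥ 1`.
    refine ⟨Real.exp (-1), Real.exp_pos _, ?_⟩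
    have he1 : Real.exp (-1) ≤ 1 := Real.exp_le_one_iff.2 (by norm_num)
    push_cast at hγ
    rw [div_self two_ne_zero] at hγ
    rcases hγ.eq_or_lt with hγ1 | hγ1
    · by_cases heq : ∀ i j, p i = p j
      · have hq : ∀ l, p l = p mx := fun l => heq l mx
        -- For equal exponents `(q - 1) γ_max = 1`, so `γ_max = 1` forces `q = 2`.
        have hq2 : p mx = 2 := by
          have := (DampedWave.gammaVec_eq_of_forall_eq hk hp hq).2
          rw [← hγ1] at this
          linarith
        obtain ⟨C', hC', hfin⟩ := DampedWave.exists_exp_exp_bound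
          (C := (k * C) ^ (2 : ℝ)) (K := k * (2 * K)) (c := c) (ρ₀ := ρ₀) (by positivity)
          (by positivity) hc (by linarith)
        refine ⟨C', hC', fun ε hε hε1 => ⟨fun _ _ h => absurd hγ1 h.ne, fun _ _ _ _ => ?_,
          fun h => absurd h hother, fun h => absurd h hother, fun h => absurd h hother⟩⟩
        refine DampedWave.lifespan_le fun T u _ hu => ?_
        obtain ⟨J, A, S, hM⟩ := hmass ε hε T u hu
        refine hfin ε hε (hε1.trans he1) T (fun ρ => ∑ l, S l ρ) ?_
        exact hM.dyadicGrowth_sum hk hp (by linarith) hL hc hε hC (hbound ε hε T J A S hM)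
          (fun l => (hq l).trans hq2) (by rw [← hγ1]; norm_num)
      -- Critical two-dimensional case with unequal exponents: no bound is claimed, and any constant
      -- will do.
      · exact ⟨1, one_pos, fun ε hε hε1 => ⟨fun _ _ h => absurd hγ1 h.ne,
          fun _ _ _ h => absurd h heq,
          fun h => absurd h hother, fun h => absurd h hother, fun h => absurd h hother⟩⟩
    · obtain ⟨C', hC', hfin⟩ := DampedWave.exists_log_power_bound (K := K / c) (ρ₀ := ρ₀)
        (sub_pos.2 hγ1) (by positivity)
      refine ⟨C', hC', fun ε hε hε1 => ⟨fun _ _ _ => ?_, fun _ _ h => absurd h hγ1.ne',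
        fun h => absurd h hother, fun h => absurd h hother, fun h => absurd h hother⟩⟩
      refine DampedWave.lifespan_le fun T u _ hu => ?_
      obtain ⟨J, A, S, hM⟩ := hmass ε hε T u hu
      refine hfin ε hε hε1 T fun ρ hρ hT => ?_
      have := DampedWave.MassEstimate.power_le (hbound ε hε T J A S hM) hL hc hmx ρ hρ hT
      push_cast at this
      rwa [div_self two_ne_zero] at this
  · have hother : ∀ {P : Prop}, β ≠ 0 → d = 2 → P := fun h h' => absurd ⟨h, h'⟩ hcase
    obtain ⟨m, hm, hψ⟩ := DampedWave.exists_psiRad_le hd hαβ hcase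
    obtain ⟨ρ₀, c, C, hρ₀, -, hc, hC, hmass⟩ := DampedWave.exists_massEstimate hd (by omega) hαβ
      hp hu₁ hint hpos (L := fun _ => 1) (ρ₁ := 1) hm (fun _ _ => one_pos)
      (fun ρ _ r hr _ => by simpa using hψ r hr)
    have hL : ∀ ρ : ℝ, ρ₀ ≤ ρ → (0 : ℝ) < (fun _ => 1) ρ := fun _ _ => one_pos
    obtain ⟨K, hK, hbound⟩ := DampedWave.MassEstimate.exists_scaled_bound (d := d) hk hp
      (by linarith) hL hc hC
    refine ⟨1, one_pos, ?_⟩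
    rcases hγ.eq_or_lt with hγ1 | hγ1
    · by_cases heq : ∀ i j, p i = p j
      · have hq : ∀ l, p l = p mx := fun l => heq l mx
        obtain ⟨C', hC', hfin⟩ := DampedWave.exists_exp_bound (q := p mx)
          (C := (k * C) ^ p mx) (K := k * (2 * K)) (c := c) (ρ₀ := ρ₀) (hp mx) (by positivity)
          (by positivity) hc (by linarith)
        refine ⟨C', hC', fun ε hε hε1 => ⟨fun h h' => hother h h', fun h h' => hother h h',
          fun _ h => absurd hγ1 h.ne, fun _ _ ⟨i, j, hij⟩ => absurd (heq i j) hij,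
          fun _ _ q hpq => ?_⟩⟩
        rw [← hpq mx]
        refine DampedWave.lifespan_le fun T u _ hu => ?_
        obtain ⟨J, A, S, hM⟩ := hmass ε hε T u hu
        exact hfin ε hε hε1 T (fun ρ => ∑ l, S l ρ) (hM.dyadicGrowth_sum hk hp (by linarith) hL hc
          hε hC (hbound ε hε T J A S hM) hq hγ1.symm)
      · have hprod : 1 < ∏ l, p l := by
          have h1 : ∏ l : Fin k, (1 : ℝ) < ∏ l, p l :=
            Finset.prod_lt_prod_of_nonempty (fun _ _ => one_pos) (fun l _ => hp l)
              Finset.univ_nonempty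
          simpa using h1
        -- Only the component `mx`, where `γ` is maximal, is known to be critical, so its own
        -- cylinder mass is iterated, with the product as exponent.
        obtain ⟨C', hC', hfin⟩ := DampedWave.exists_exp_bound (q := ∏ l, p l)
          (C := (C ^ k) ^ (∏ l, p l)) (K := 2 * K) (c := c) (ρ₀ := ρ₀) hprod (by positivity)
          (by positivity) hc (by linarith)
        refine ⟨C', hC', fun ε hε hε1 => ⟨fun h h' => hother h h', fun h h' => hother h h',
          fun _ h => absurd hγ1 h.ne, fun _ _ _ => ?_,
          fun _ _ q hpq => absurd (fun i j => (hpq i).trans (hpq j).symm) heq⟩⟩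
        refine DampedWave.lifespan_le fun T u _ hu => ?_
        obtain ⟨J, A, S, hM⟩ := hmass ε hε T u hu
        exact hfin ε hε hε1 T (S mx) (hM.dyadicGrowth_component hk hp (by linarith) hc hε hC
          (hbound ε hε T J A S hM) hmx hγ1.symm)
    · obtain ⟨C', hC', hfin⟩ := DampedWave.exists_power_bound (K := K / c) (ρ₀ := ρ₀)
        (sub_pos.2 hγ1) (by linarith) (by positivity)
      refine ⟨C', hC', fun ε hε hε1 => ⟨fun h h' => hother h h', fun h h' => hother h h',
        fun _ _ => ?_, fun _ h => absurd h hγ1.ne', fun _ h => absurd h hγ1.ne'⟩⟩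
      refine DampedWave.lifespan_le fun T u _ hu => ?_
      obtain ⟨J, A, S, hM⟩ := hmass ε hε T u hu
      refine hfin ε hε hε1 T fun ρ hρ hT => ?_
      simpa using DampedWave.MassEstimate.power_le (hbound ε hε T J A S hM) hL hc hmx ρ hρ hT
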